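/- Let $\Pi=\{(x,t): 0<x<1,\ t>0\}$, $\overline\Pi=[0,1]\times[0,\infty)$, and let $1\le k\le n$ be integers. Consider the problem for $u=(u_1,\dots,u_n)$ $$\partial_t u_i+\lambda_i(x,t)\,\partial_x u_i=f_i(x,t,u),\qquad (x,t)\in\Pi,\ 1\le i\le n,$$ $$u(x,0)=\varphi(x),\qquad x\in(0,1),$$ $$u_i(0,t)=h_i(t,v(t))\ \ (k+1\le i\le n),\qquad u_i(1,t)=h_i(t,v(t))\ \ (1\le i\le k),\qquad t>0,$$ where $v(t)=(u_1(0,t),\dots,u_k(0,t),u_{k+1}(1,t),\dots,u_n(1,t))$ and, on $\overline\Pi$, $\lambda_1,\dots,\lambda_k<0$ and $\lambda_{k+1},\dots,\lambda_n>0$ (the $\lambda_i$ need not be distinct). Assume that $\lambda_i$ is continuous on $\overline\Pi$ with $\partial_x\lambda_i$ continuous on $\overline\Pi$; that $f$ is continuous on $\overline\Pi\times\mathbb R^n$ with $\partial_xf$ and $\nabla_uf$ continuous on $\overline\Pi\times\mathbb R^n$; that $\varphi\in C^1([0,1])$; and that $h\in C^1([0,\infty)\times\mathbb R^n)$. Assume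 that $\nabla_uf$ is bounded on $K\times\mathbb R^n$ for every compact $K\subset\overline\Pi$, and that $\nabla_vh$ is bounded on $K\times\mathbb R^n$ for every compact $K\subset[0,\infty)$. Put $v^0=(\varphi_1(0),\dots,\varphi_k(0),\varphi_{k+1}(1),\dots,\varphi_n(1))$ and $d_i(x)=f_i(x,0,\varphi(x))-\lambda_i(x,0)\varphi_i'(x)$, and let $w^0=(d_1(0),\dots,d_k(0),d_{k+1}(1),\dots,d_n(1))$. With $y_i=0$ for $i\ge k+1$ and $y_i=1$ for $i\le k$, assume the zero-order and the first-order compatibility conditions $$\varphi_i(y_i)=h_i(0,v^0),\qquad d_i(y_i)=\partial_th_i(0,v^0)+\nabla_vh_i(0,v^0)\cdot w^0,\qquad 1\le i\le n.$$ Then the problem has a unique global classical solution: there is a solution $u\in C^1(\overline\Pi)^n$, and every solution that is continuous on $\overline\Pi$ and continuously differentiable in $\Pi$ coincides with $u$ on $\overline\Pi$. -/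

import Mathlib

open Set

namespace HypIBVP

/-- The open half-strip `0 < x < 1`, `t > 0`; points are written `(x, t)`. -/
def openStrip : Set (ℝ × ℝ) := Ioo 0 1 ×ˢ Ioi 0

/-- The closed half-strip `0 ≤ x ≤ 1`, `t ≥ 0`. -/
def closedStrip : Set (ℝ × ℝ) := Icc 0 1 ×ˢ Ici 0

/-- The vector that takes its first `k` components from `a` and the remaining ones from `b`. -/
def splice {n : ℕ} (k : ℕ) (a b : Fin n → ℝ) : Fin n → ℝ :=
  fun i => if (i : ℕ) < k then a i else b i

/-- The outgoing boundary trace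
`v(t) = (u₁(0,t), …, u_k(0,t), u_{k+1}(1,t), …, u_n(1,t))`. -/
def outgoing {n : ℕ} (k : ℕ) (u : ℝ → ℝ → Fin n → ℝ) (t : ℝ) : Fin n → ℝ :=
  splice k (u 0 t) (u 1 t)

/-- The function `g(x,t)` on the closed half-strip is continuous, and its partial derivative in
`x` exists (one-sided at `x = 0, 1`) and is continuous on the closed half-strip. -/
def IsC1InX (g : ℝ → ℝ → ℝ) : Prop :=
  ContinuousOn (fun p : ℝ × ℝ => g p.1 p.2) closedStrip ∧
  (∀ t ∈ Ici (0 : ℝ), DifferentiableOn ℝ (fun x => g x t) (Icc 0 1)) ∧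
  ContinuousOn (fun p : ℝ × ℝ => derivWithin (fun x => g x p.2) (Icc 0 1) p.1) closedStrip

/-- The function `f(x,t,y)` is continuous on (closed half-strip) `× ℝⁿ`, and its derivatives in
`x` (one-sided at `x = 0, 1`) and in `y` exist and are continuous there. -/
def IsC1InXU {n : ℕ} (f : ℝ → ℝ → (Fin n → ℝ) → Fin n → ℝ) : Prop :=
  ContinuousOn (fun q : (ℝ × ℝ) × (Fin n → ℝ) => f q.1.1 q.1.2 q.2) (closedStrip ×ˢ univ) ∧
  (∀ t ∈ Ici (0 : ℝ), ∀ y, DifferentiableOn ℝ (fun x => f x t y) (Icc 0 1)) ∧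
  (∀ x ∈ Icc (0 : ℝ) 1, ∀ t ∈ Ici (0 : ℝ), Differentiable ℝ (fun y => f x t y)) ∧
  ContinuousOn (fun q : (ℝ × ℝ) × (Fin n → ℝ) =>
    derivWithin (fun x => f x q.1.2 q.2) (Icc 0 1) q.1.1) (closedStrip ×ˢ univ) ∧
  ContinuousOn (fun q : (ℝ × ℝ) × (Fin n → ℝ) =>
    fderiv ℝ (fun y => f q.1.1 q.1.2 y) q.2) (closedStrip ×ˢ univ)

/-- The vector `v(0)` computed from the initial function. -/
def v0 {n : ℕ} (k : ℕ) (φ : ℝ → Fin n → ℝ) : Fin n → ℝ := splice k (φ 0) (φ 1)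

/-- The value `f_i(x,0,φ(x)) - λ_i(x,0) φ_i'(x)` of `∂ₜu_i(x,0)` that the system prescribes. -/
noncomputable def initialTimeDeriv {n : ℕ} (lam : Fin n → ℝ → ℝ → ℝ)
    (f : ℝ → ℝ → (Fin n → ℝ) → Fin n → ℝ) (φ : ℝ → Fin n → ℝ) (x : ℝ) : Fin n → ℝ :=
  fun i => f x 0 (φ x) i - lam i x 0 * derivWithin (fun ξ => φ ξ i) (Icc 0 1) x

/-- The vector `v'(0)` computed from the initial function and the system. -/
noncomputable def v0' {n : ℕ} (k : ℕ) (lam : Fin n → ℝ → ℝ → ℝ)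
    (f : ℝ → ℝ → (Fin n → ℝ) → Fin n → ℝ) (φ : ℝ → Fin n → ℝ) : Fin n → ℝ :=
  splice k (initialTimeDeriv lam f φ 0) (initialTimeDeriv lam f φ 1)

/-- Zero-order compatibility conditions. -/
def Compat0 {n : ℕ} (k : ℕ) (φ : ℝ → Fin n → ℝ) (h : ℝ → (Fin n → ℝ) → Fin n → ℝ) : Prop :=
  ∀ i : Fin n,
    (k ≤ (i : ℕ) → φ 0 i = h 0 (v0 k φ) i) ∧
    ((i : ℕ) < k → φ 1 i = h 0 (v0 k φ) i)

/-- First-order compatibility conditions. -/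
def Compat1 {n : ℕ} (k : ℕ) (lam : Fin n → ℝ → ℝ → ℝ)
    (f : ℝ → ℝ → (Fin n → ℝ) → Fin n → ℝ) (φ : ℝ → Fin n → ℝ)
    (h : ℝ → (Fin n → ℝ) → Fin n → ℝ) : Prop :=
  ∀ i : Fin n,
    (k ≤ (i : ℕ) → initialTimeDeriv lam f φ 0 i =
      derivWithin (fun t => h t (v0 k φ) i) (Ici 0) 0 +
        fderiv ℝ (fun z => h 0 z i) (v0 k φ) (v0' k lam f φ)) ∧
    ((i : ℕ) < k → initialTimeDeriv lam f φ 1 i =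
      derivWithin (fun t => h t (v0 k φ) i) (Ici 0) 0 +
        fderiv ℝ (fun z => h 0 z i) (v0 k φ) (v0' k lam f φ))

/-- `u` is a classical solution: continuous on the closed half-strip, continuously differentiable
in the open half-strip, and satisfying the differential system, the initial condition and the
boundary conditions. -/
structure IsClassicalSolution {n : ℕ} (k : ℕ) (lam : Fin n → ℝ → ℝ → ℝ)
    (f : ℝ → ℝ → (Fin n → ℝ) → Fin n → ℝ) (φ : ℝ → Fin n → ℝ)
    (h : ℝ → (Fin n → ℝ) → Fin n → ℝ) (u : ℝ → ℝ → Fin n → ℝ) : Prop where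
  continuousOn : ContinuousOn (fun p : ℝ × ℝ => u p.1 p.2) closedStrip
  contDiffOn : ContDiffOn ℝ 1 (fun p : ℝ × ℝ => u p.1 p.2) openStrip
  system : ∀ x ∈ Ioo (0 : ℝ) 1, ∀ t ∈ Ioi (0 : ℝ), ∀ i : Fin n,
    deriv (fun s => u x s i) t + lam i x t * deriv (fun ξ => u ξ t i) x = f x t (u x t) i
  initial : ∀ x ∈ Ioo (0 : ℝ) 1, u x 0 = φ x
  boundary_left : ∀ t ∈ Ioi (0 : ℝ), ∀ i : Fin n, k ≤ (i : ℕ) → u 0 t i = h t (outgoing k u t) i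
  boundary_right : ∀ t ∈ Ioi (0 : ℝ), ∀ i : Fin n, (i : ℕ) < k → u 1 t i = h t (outgoing k u t) i

end HypIBVP

/-!
Along a characteristic `dx/dt = λᵢ(x,t)` the system prescribes the derivative of `uᵢ`, and since
`λᵢ` does not vanish, each characteristic enters the strip on the initial line or on the side where
`uᵢ` is given by the boundary condition (`entry k i`) and leaves it on the opposite side, where the
boundary operator reads `uᵢ`. On a box `[0,1] × [0,T]` the problem is therefore a fixed point
equation: given `v`, solve `n` decoupled linear transport problems with source `f(·, v)` and boundary
values `h(·, v)`.

*Linear problems* (`transport_right`, `transport_left`). After a reflection the speed is positive.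
It is extended to the whole plane, where its flow `X` is `C¹`, and the boundary values are carried
back along the flow to initial values on `x < 0`, so that only a Cauchy problem has to be solved
(`exists_transport_plane`). The zero-order and first-order compatibility conditions say precisely
that the resulting initial function is `C¹` at `x = 0`. Besides the `C¹` solution this gives an
equation for `p = ∂ₓu`, which is only continuous: along characteristics its derivative is
`∂ₓF - ∂ₓλ p`.

*Contraction* (`BoxSystem.IsImage.near`). Distances are measured relative to the weights
`exp (μ t - ν |x - e|)`, where `e` is the side of entry. By a comparison principle along
characteristics (`abs_le_weight`), `ν` large makes the boundary operators contracting, because they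
read values at the exit side, where the weight is smaller by the factor `exp (-ν)`; then `μ` large
makes the sources contracting. The global bounds on `∇ᵤf` and `∇ᵥh` enter here, and this is why no
smallness of `T` is needed. Uniqueness follows at once (`BoxSystem.IsImage.eq`); it needs the system
only along the parts of characteristics inside the strip, so it covers all classical solutions.

*Regularity* (`BoxSystem.exists_limit_p`). The iterates `u` converge uniformly. Their derivatives
`p` satisfy an iteration of the same kind, whose coefficients `∇ᵤf`, `∇ᵥh` are evaluated at the
convergent `u`; boundary values of `p` are obtained from the time derivative of the boundary
condition, on dividing by `λᵢ`. The same weighted estimate shows that the `p` are bounded, and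
that their distances are halved by each step up to errors that tend to zero. As `∇ᵤf` is merely
continuous these errors have no rate, but a Cauchy sequence results. So the limit is `C¹` on the
box, up to its boundary, and by uniqueness the solutions on the boxes fit together.
-/

namespace HypIBVP

open Filter Topology Metric

/-! ### Differential calculus in the plane -/

/-- The linear form `(dx, dt) ↦ p dx + r dt`. -/
noncomputable def grad (p r : ℝ) : ℝ × ℝ →L[ℝ] ℝ :=
  p • ContinuousLinearMap.fst ℝ ℝ ℝ + r • ContinuousLinearMap.snd ℝ ℝ ℝ

@[simp] lemma grad_apply (p r : ℝ) (v : ℝ × ℝ) : grad p r v = p * v.1 + r * v.2 := rfl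

lemma continuous_grad : Continuous fun q : ℝ × ℝ => grad q.1 q.2 := by
  unfold grad; fun_prop

lemma grad_self (A : ℝ × ℝ →L[ℝ] ℝ) : A = grad (A (1, 0)) (A (0, 1)) := by
  ext <;> simp [grad]

lemma norm_grad_le (p r : ℝ) : ‖grad p r‖ ≤ |p| + |r| := by
  refine ContinuousLinearMap.opNorm_le_bound _ (by positivity) fun v => ?_
  have h1 : |v.1| ≤ ‖v‖ := norm_fst_le v
  have h2 : |v.2| ≤ ‖v‖ := norm_snd_le v
  calc ‖grad p r v‖ = |p * v.1 + r * v.2| := rfl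
    _ ≤ |p * v.1| + |r * v.2| := abs_add_le _ _
    _ = |p| * |v.1| + |r| * |v.2| := by rw [abs_mul, abs_mul]
    _ ≤ (|p| + |r|) * ‖v‖ := by
      rw [add_mul]; gcongr

lemma hasFDerivAt_of_partials {f f₁ f₂ : ℝ → ℝ → ℝ}
    (h₁ : ∀ x y, HasDerivAt (fun x => f x y) (f₁ x y) x)
    (h₂ : ∀ x y, HasDerivAt (fun y => f x y) (f₂ x y) y)
    (c₁ : Continuous fun q : ℝ × ℝ => f₁ q.1 q.2) (c₂ : Continuous fun q : ℝ × ℝ => f₂ q.1 q.2)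
    (u : ℝ × ℝ) : HasFDerivAt (fun q : ℝ × ℝ => f q.1 q.2) (grad (f₁ u.1 u.2) (f₂ u.1 u.2)) u := by
  have hc : Continuous fun c : ℝ => ContinuousLinearMap.toSpanSingleton ℝ c := by
    have : (fun c : ℝ => ContinuousLinearMap.toSpanSingleton ℝ c) =
        fun c : ℝ => c • ContinuousLinearMap.id ℝ ℝ := by ext; simp
    rw [this]; fun_prop
  have key := hasStrictFDerivAt_uncurry_coprod (𝕜 := ℝ) (u := u) (f := f)
    (f₁ := fun x y => ContinuousLinearMap.toSpanSingleton ℝ (f₁ x y))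
    (f₂ := fun x y => ContinuousLinearMap.toSpanSingleton ℝ (f₂ x y))
    (Eventually.of_forall fun v => (h₁ v.1 v.2).hasFDerivAt)
    (Eventually.of_forall fun v => (h₂ v.1 v.2).hasFDerivAt)
    (hc.comp c₁).continuousAt
    (hc.comp c₂).continuousAt
  convert! key.hasFDerivAt using 1
  ext <;> simp [grad, Function.HasUncurry.uncurry]

lemma contDiff_of_partials {f f₁ f₂ : ℝ → ℝ → ℝ}
    (h₁ : ∀ x y, HasDerivAt (fun x => f x y) (f₁ x y) x)
    (h₂ : ∀ x y, HasDerivAt (fun y => f x y) (f₂ x y) y)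
    (c₁ : Continuous fun q : ℝ × ℝ => f₁ q.1 q.2) (c₂ : Continuous fun q : ℝ × ℝ => f₂ q.1 q.2) :
    ContDiff ℝ 1 (fun q : ℝ × ℝ => f q.1 q.2) :=
  contDiff_one_iff_hasFDerivAt.2 ⟨_, continuous_grad.comp (c₁.prodMk c₂),
    hasFDerivAt_of_partials h₁ h₂ c₁ c₂⟩

/-- Differentiation under the integral sign over a compact interval. -/
lemma hasDerivAt_integral_param {g g' : ℝ → ℝ → ℝ}
    (hg : ∀ r y, HasDerivAt (fun y => g r y) (g' r y) y)
    (cg : Continuous fun q : ℝ × ℝ => g q.1 q.2) (cg' : Continuous fun q : ℝ × ℝ => g' q.1 q.2)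
    (s y : ℝ) : HasDerivAt (fun y => ∫ r in (0 : ℝ)..s, g r y) (∫ r in (0 : ℝ)..s, g' r y) y := by
  obtain ⟨C, hC⟩ := (isCompact_uIcc (a := (0 : ℝ)) (b := s)).prod
    (isCompact_closedBall y 1) |>.exists_bound_of_continuousOn cg'.continuousOn
  refine (intervalIntegral.hasDerivAt_integral_of_dominated_loc_of_deriv_le
    (F := fun y r => g r y) (F' := fun y r => g' r y) (bound := fun _ => C)
    (closedBall_mem_nhds y one_pos) ?_ ?_ ?_ ?_ ?_ ?_).2
  · exact Eventually.of_forall fun x =>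
      (show Continuous fun r => g r x from by fun_prop).aestronglyMeasurable
  · exact (show Continuous fun r => g r y from by fun_prop).intervalIntegrable _ _
  · exact (show Continuous fun r => g' r y from by fun_prop).aestronglyMeasurable
  · exact Eventually.of_forall fun r hr x hx => hC (r, x) ⟨uIoc_subset_uIcc hr, hx⟩
  · exact intervalIntegrable_const
  · exact Eventually.of_forall fun r _ x _ => hg r x

lemma hasDerivAt_integral_upper {g : ℝ → ℝ} (cg : Continuous g) (s : ℝ) :
    HasDerivAt (fun s => ∫ r in (0 : ℝ)..s, g r) (g s) s :=
  (cg.integral_hasStrictDerivAt 0 s).hasDerivAt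

lemma continuous_integral_param {P : Type*} [TopologicalSpace P] {g : P → ℝ → ℝ} {s : P → ℝ}
    (cg : Continuous fun q : P × ℝ => g q.1 q.2) (cs : Continuous s) :
    Continuous fun q => ∫ r in (0 : ℝ)..s q, g q r :=
  intervalIntegral.continuous_parametric_intervalIntegral_of_continuous cg cs

/-- Global implicit function theorem for a function that has exactly one, nondegenerate, zero on
every line `{e} × ℝ`. -/
lemma contDiff_implicit {E : Type*} [NormedAddCommGroup E] [NormedSpace ℝ E] [CompleteSpace E]
    {G : E × ℝ → ℝ} (hG : ContDiff ℝ 1 G) {ψ : E → ℝ} (h0 : ∀ e s, G (e, s) = 0 ↔ s = ψ e)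
    {G' : E → ℝ → ℝ} (hd : ∀ e s, HasDerivAt (fun s => G (e, s)) (G' e s) s)
    (hne : ∀ e s, G' e s ≠ 0) : ContDiff ℝ 1 ψ := by
  rw [contDiff_iff_contDiffAt]
  intro e
  have hat : ContDiffAt ℝ 1 G (e, ψ e) := hG.contDiffAt
  have hinv : (fderiv ℝ G (e, ψ e) ∘L ContinuousLinearMap.inr ℝ E ℝ).IsInvertible := by
    have h1 : HasDerivAt (fun s => G (e, s))
        ((fderiv ℝ G (e, ψ e)) (0, 1)) (ψ e) :=
      (hat.differentiableAt one_ne_zero).hasFDerivAt.comp_hasDerivAt (ψ e)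
        ((hasDerivAt_const _ e).prodMk (hasDerivAt_id _))
    have h2 := h1.unique (hd e (ψ e))
    refine ⟨ContinuousLinearEquiv.unitsEquivAut ℝ (Units.mk0 _ (hne e (ψ e))), ?_⟩
    ext
    simp [← h2]
  have key := hat.contDiffAt_implicitFunction one_ne_zero hinv
  refine key.congr_of_eventuallyEq ?_
  have := hat.eventually_apply_implicitFunction one_ne_zero hinv
  filter_upwards [this] with x hx
  rw [(h0 e (ψ e)).2 rfl] at hx
  exact ((h0 _ _).1 hx).symm

/-! ### The flow of a uniformly positive speed on the plane -/

section Flow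

/-- A speed `l(x,t)` on the whole plane, with continuous `x`-derivative `lx`, such that
`0 < c ≤ l ≤ C` and `|lx| ≤ L`. -/
structure IsSpeed (l lx : ℝ → ℝ → ℝ) (c C L : ℝ) : Prop where
  cont : Continuous fun q : ℝ × ℝ => l q.1 q.2
  cont_deriv : Continuous fun q : ℝ × ℝ => lx q.1 q.2
  hasDerivAt : ∀ x t, HasDerivAt (fun x => l x t) (lx x t) x
  pos : 0 < c
  ge : ∀ x t, c ≤ l x t
  le : ∀ x t, l x t ≤ C
  deriv_le : ∀ x t, |lx x t| ≤ L

/-- `X s y` is the position at time `s` of the characteristic of `l` that starts at `y` at time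
`0`. -/
structure IsFlow (l : ℝ → ℝ → ℝ) (X : ℝ → ℝ → ℝ) : Prop where
  cont : Continuous fun q : ℝ × ℝ => X q.1 q.2
  zero : ∀ y, X 0 y = y
  hasDerivAt : ∀ s y, HasDerivAt (fun s => X s y) (l (X s y) s) s

variable {l lx X : ℝ → ℝ → ℝ} {c C L : ℝ}

lemma IsSpeed.lipschitz (hl : IsSpeed l lx c C L) (t : ℝ) :
    LipschitzWith L.toNNReal fun x => l x t := by
  refine lipschitzWith_of_nnnorm_deriv_le (fun x => (hl.hasDerivAt x t).differentiableAt) ?_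
  intro x
  rw [(hl.hasDerivAt x t).deriv, ← NNReal.coe_le_coe, coe_nnnorm]
  exact (hl.deriv_le x t).trans (Real.le_coe_toNNReal L)

lemma IsSpeed.flow_unique (hl : IsSpeed l lx c C L) {a b t₀ : ℝ} (ht : t₀ ∈ Ioo a b) {f g : ℝ → ℝ}
    (hf : ∀ t ∈ Ioo a b, HasDerivAt f (l (f t) t) t)
    (hg : ∀ t ∈ Ioo a b, HasDerivAt g (l (g t) t) t) (h : f t₀ = g t₀) : EqOn f g (Ioo a b) :=
  ODE_solution_unique_of_mem_Ioo (v := fun t x => l x t) (s := fun _ => univ)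
    (fun t _ => (hl.lipschitz t).lipschitzOnWith) ht (fun t ht => ⟨hf t ht, trivial⟩)
    (fun t ht => ⟨hg t ht, trivial⟩) h

/-- The flow on a large box, from the Picard–Lindelöf theorem. -/
lemma IsSpeed.exists_flow_box (hl : IsSpeed l lx c C L) {R : ℝ} (hR : 0 ≤ R) :
    ∃ α : ℝ × ℝ → ℝ, (∀ y ∈ closedBall (0 : ℝ) R, α (y, 0) = y ∧
      ∀ t ∈ Ioo (-R) R, HasDerivAt (fun s => α (y, s)) (l (α (y, t)) t) t) ∧
      ContinuousOn α (closedBall (0 : ℝ) R ×ˢ Icc (-R) R) := by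
  have hC : 0 ≤ C := hl.pos.le.trans ((hl.ge 0 0).trans (hl.le 0 0))
  have hPL : IsPicardLindelof (fun t x => l x t) (tmin := -R) (tmax := R)
      ⟨0, by constructor <;> linarith⟩ 0 (C * R + R).toNNReal R.toNNReal C.toNNReal
      L.toNNReal := by
    refine ⟨fun t _ => (hl.lipschitz t).lipschitzOnWith, fun x _ => ?_, fun t _ x _ => ?_, ?_⟩
    · have := hl.cont
      exact (show Continuous fun t => l x t from by fun_prop).continuousOn
    · rw [Real.coe_toNNReal _ hC, Real.norm_eq_abs, abs_of_nonneg (hl.pos.le.trans (hl.ge x t))]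
      exact hl.le x t
    · rw [Real.coe_toNNReal _ hC, Real.coe_toNNReal _ hR, Real.coe_toNNReal _ (by positivity)]
      simp
  obtain ⟨α, h1, h2⟩ := hPL.exists_forall_mem_closedBall_eq_hasDerivWithinAt_continuousOn
  rw [Real.coe_toNNReal _ hR] at h1 h2
  exact ⟨α, fun y hy => ⟨(h1 y hy).1, fun t ht =>
    ((h1 y hy).2 t (Ioo_subset_Icc_self ht)).hasDerivAt (Icc_mem_nhds ht.1 ht.2)⟩, h2⟩

lemma IsSpeed.exists_flow (hl : IsSpeed l lx c C L) : ∃ X, IsFlow l X := by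
  choose α h1 h2 using fun N : ℕ => hl.exists_flow_box (R := (N : ℝ)) N.cast_nonneg
  let N : ℝ → ℝ → ℕ := fun s y => ⌈|s|⌉₊ + ⌈|y|⌉₊ + 1
  have hNs : ∀ s y, |s| < N s y := fun s y => by
    have := Nat.le_ceil |s|
    have h2 : (0 : ℝ) ≤ ⌈|y|⌉₊ := Nat.cast_nonneg _
    simp only [N]; push_cast; linarith
  have hNy : ∀ s y, |y| < N s y := fun s y => by
    have := Nat.le_ceil |y|
    have h2 : (0 : ℝ) ≤ ⌈|s|⌉₊ := Nat.cast_nonneg _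
    simp only [N]; push_cast; linarith
  -- the boxes are compatible with each other
  have hle : ∀ M K : ℕ, M ≤ K → ∀ s y : ℝ, |s| < M → |y| ≤ M → α M (y, s) = α K (y, s) := by
    intro M K hMK s y hs hy
    have hMK' : (M : ℝ) ≤ K := by exact_mod_cast hMK
    have hyM : y ∈ closedBall (0 : ℝ) M := by simpa using hy
    have hyK : y ∈ closedBall (0 : ℝ) K := by simpa using hy.trans hMK'
    have hM : (0 : ℝ) < M := (abs_nonneg s).trans_lt hs
    refine hl.flow_unique (a := -M) (b := M) (t₀ := 0) ⟨by linarith, hM⟩ (h1 M y hyM).2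
      (fun t ht => (h1 K y hyK).2 t ⟨by linarith [ht.1], by linarith [ht.2]⟩) ?_ (abs_lt.1 hs)
    rw [(h1 M y hyM).1, (h1 K y hyK).1]
  let X : ℝ → ℝ → ℝ := fun s y => α (N s y) (y, s)
  have hX : ∀ (K : ℕ) (s y : ℝ), |s| < K → |y| < K → X s y = α K (y, s) := by
    intro K s y hs hy
    rcases le_total (N s y) K with h | h
    · exact hle _ _ h s y (hNs s y) (hNy s y).le
    · exact (hle _ _ h s y hs hy.le).symm
  refine ⟨X, ?_, fun y => ?_, fun s y => ?_⟩
  · rw [continuous_iff_continuousAt]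
    rintro ⟨s, y⟩
    obtain ⟨K, hK⟩ : ∃ K : ℕ, |s| < K ∧ |y| < K := ⟨N s y, hNs s y, hNy s y⟩
    have hc : ContinuousAt (α K) (y, s) := by
      refine (h2 K).continuousAt (prod_mem_nhds ?_ (Icc_mem_nhds ?_ ?_))
      · exact closedBall_mem_nhds_of_mem (by simpa using hK.2)
      · exact (abs_lt.1 hK.1).1
      · exact (abs_lt.1 hK.1).2
    have hc' : ContinuousAt (fun q : ℝ × ℝ => α K (q.2, q.1)) (s, y) :=
      ContinuousAt.comp (f := fun q : ℝ × ℝ => (q.2, q.1)) (g := α K) hc (by fun_prop)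
    refine hc'.congr ?_
    have e1 : ∀ᶠ q : ℝ × ℝ in 𝓝 (s, y), |q.1| < K :=
      (continuous_fst.abs.tendsto (s, y)).eventually_lt_const hK.1
    have e2 : ∀ᶠ q : ℝ × ℝ in 𝓝 (s, y), |q.2| < K :=
      (continuous_snd.abs.tendsto (s, y)).eventually_lt_const hK.2
    filter_upwards [e1, e2] with q hq1 hq2 using (hX K _ _ hq1 hq2).symm
  · exact (h1 _ y (by simpa using (hNy 0 y).le)).1
  · have hd := (h1 (N s y) y (by simpa using (hNy s y).le)).2 s (abs_lt.1 (hNs s y))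
    have e1 : ∀ᶠ q : ℝ in 𝓝 s, |q| < N s y :=
      (continuous_abs.tendsto s).eventually_lt_const (hNs s y)
    refine hd.congr_of_eventuallyEq ?_
    filter_upwards [e1] with q hq using hX _ _ _ hq (hNy s y)

/-- The `y`-derivative of the flow. -/
noncomputable def flowDeriv (lx X : ℝ → ℝ → ℝ) (s y : ℝ) : ℝ :=
  Real.exp (∫ r in (0 : ℝ)..s, lx (X r y) r)

lemma flowDeriv_pos (s y : ℝ) : 0 < flowDeriv lx X s y := Real.exp_pos _

namespace IsFlow

variable (hl : IsSpeed l lx c C L) (hX : IsFlow l X)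
include hl hX

/-- In one space dimension the difference of two characteristics solves a scalar linear equation,
which gives the difference quotients of the flow in the starting point in closed form. -/
lemma slope_formula (s y y' : ℝ) : X s y' - X s y = (y' - y) * Real.exp (∫ r in (0 : ℝ)..s,
    ∫ θ in (0 : ℝ)..1, lx (X r y + θ * (X r y' - X r y)) r) := by
  have := hl.cont_deriv
  have := hX.cont
  set A : ℝ → ℝ := fun r => ∫ θ in (0 : ℝ)..1, lx (X r y + θ * (X r y' - X r y)) r with hA
  have hAc : Continuous A :=
    continuous_integral_param (P := ℝ) (g := fun r θ => lx (X r y + θ * (X r y' - X r y)) r)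
      (by fun_prop) continuous_const
  have hmean : ∀ r, l (X r y') r - l (X r y) r = A r * (X r y' - X r y) := by
    intro r
    have h1 : ∀ θ ∈ uIcc (0 : ℝ) 1, HasDerivAt (fun θ => l (X r y + θ * (X r y' - X r y)) r)
        (lx (X r y + θ * (X r y' - X r y)) r * (X r y' - X r y)) θ := fun θ _ => by
      have h2 : HasDerivAt (fun θ => X r y + θ * (X r y' - X r y)) (X r y' - X r y) θ := by
        simpa using ((hasDerivAt_id θ).mul_const (X r y' - X r y)).const_add (X r y)
      exact HasDerivAt.comp θ (hl.hasDerivAt (X r y + θ * (X r y' - X r y)) r) h2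
    have h3 := intervalIntegral.integral_eq_sub_of_hasDerivAt h1
      (Continuous.intervalIntegrable (by fun_prop) _ _)
    rw [intervalIntegral.integral_mul_const] at h3
    simp only [one_mul, zero_mul, add_zero, add_sub_cancel] at h3
    rw [← h3]
  -- `(X r y' - X r y) * exp (-∫ A)` has zero derivative
  set w : ℝ → ℝ := fun s => (X s y' - X s y) * Real.exp (-∫ r in (0 : ℝ)..s, A r) with hw
  have hwd : ∀ s, HasDerivAt w 0 s := by
    intro s
    have h1 := ((hX.hasDerivAt s y').sub (hX.hasDerivAt s y)).mul
      ((hasDerivAt_integral_upper hAc s).neg.exp)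
    refine h1.congr_deriv ?_
    simp only [Pi.sub_apply]
    rw [hmean]; ring
  have hconst : w s = w 0 := is_const_of_deriv_eq_zero (fun s => (hwd s).differentiableAt)
    (fun s => (hwd s).deriv) s 0
  simp only [hw, hX.zero, intervalIntegral.integral_same, neg_zero, Real.exp_zero, mul_one]
    at hconst
  rw [← hconst, mul_assoc, ← Real.exp_add]
  simp

lemma continuous_flowDeriv : Continuous fun q : ℝ × ℝ => flowDeriv lx X q.1 q.2 := by
  have := hl.cont_deriv
  have := hX.cont
  exact Real.continuous_exp.comp (continuous_integral_param (P := ℝ × ℝ)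
    (g := fun q r => lx (X r q.2) r) (by fun_prop) continuous_fst)

lemma hasDerivAt_flowDeriv (s y : ℝ) : HasDerivAt (fun s => flowDeriv lx X s y)
    (lx (X s y) s * flowDeriv lx X s y) s := by
  have := hl.cont_deriv
  have := hX.cont
  have h := (hasDerivAt_integral_upper (g := fun r => lx (X r y) r) (by fun_prop) s).exp
  exact h.congr_deriv (mul_comm _ _)

lemma hasDerivAt_start (s y : ℝ) : HasDerivAt (fun y => X s y) (flowDeriv lx X s y) y := by
  have := hl.cont_deriv
  have := hX.cont
  rw [hasDerivAt_iff_tendsto_slope]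
  set B : ℝ → ℝ := fun y' => Real.exp (∫ r in (0 : ℝ)..s,
    ∫ θ in (0 : ℝ)..1, lx (X r y + θ * (X r y' - X r y)) r) with hB
  have hBc : Continuous B := by
    refine Real.continuous_exp.comp (continuous_integral_param (P := ℝ)
      (g := fun y' r => ∫ θ in (0 : ℝ)..1, lx (X r y + θ * (X r y' - X r y)) r) ?_
      continuous_const)
    exact continuous_integral_param (P := ℝ × ℝ)
      (g := fun q θ => lx (X q.2 y + θ * (X q.2 q.1 - X q.2 y)) q.2) (by fun_prop)
      continuous_const
  have hBy : B y = flowDeriv lx X s y := by simp [hB, flowDeriv]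
  rw [← hBy]
  refine (hBc.continuousAt.tendsto.mono_left nhdsWithin_le_nhds).congr' ?_
  filter_upwards [self_mem_nhdsWithin] with y' hy'
  have : y' - y ≠ 0 := sub_ne_zero.2 hy'
  rw [slope_def_field, slope_formula hl hX s y y', mul_div_cancel_left₀ _ this]

lemma contDiff : ContDiff ℝ 1 fun q : ℝ × ℝ => X q.1 q.2 := by
  have := hl.cont
  have := hX.cont
  exact contDiff_of_partials (f := X) hX.hasDerivAt (hasDerivAt_start hl hX) (by fun_prop)
    (continuous_flowDeriv hl hX)

lemma strictMono_start (s : ℝ) : StrictMono (X s) :=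
  strictMono_of_hasDerivAt_pos (hasDerivAt_start hl hX s) fun _ => flowDeriv_pos _ _

lemma strictMono_time (y : ℝ) : StrictMono fun s => X s y :=
  strictMono_of_hasDerivAt_pos (fun s => hX.hasDerivAt s y) fun _ =>
    hl.pos.trans_le (hl.ge _ _)

lemma le_of_nonneg {s : ℝ} (hs : 0 ≤ s) (y : ℝ) : y + c * s ≤ X s y ∧ X s y ≤ y + C * s := by
  have hd : Differentiable ℝ fun s => X s y := fun s => (hX.hasDerivAt s y).differentiableAt
  have h1 := mul_sub_le_image_sub_of_le_deriv hd
    (fun s => by rw [(hX.hasDerivAt s y).deriv]; exact hl.ge _ _) hs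
  have h2 := image_sub_le_mul_sub_of_deriv_le hd
    (fun s => by rw [(hX.hasDerivAt s y).deriv]; exact hl.le _ _) hs
  simp only [hX.zero] at h1 h2
  constructor <;> linarith

lemma le_of_nonpos {s : ℝ} (hs : s ≤ 0) (y : ℝ) : y + C * s ≤ X s y ∧ X s y ≤ y + c * s := by
  have hd : Differentiable ℝ fun s => X s y := fun s => (hX.hasDerivAt s y).differentiableAt
  have h1 := mul_sub_le_image_sub_of_le_deriv hd
    (fun s => by rw [(hX.hasDerivAt s y).deriv]; exact hl.ge _ _) hs
  have h2 := image_sub_le_mul_sub_of_deriv_le hd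
    (fun s => by rw [(hX.hasDerivAt s y).deriv]; exact hl.le _ _) hs
  simp only [hX.zero] at h1 h2
  constructor <;> linarith

/-- Every point lies on exactly one characteristic; its position at time `0` is a `C¹` function
of the point. -/
lemma exists_foot : ∃ z : ℝ × ℝ → ℝ, ContDiff ℝ 1 z ∧ ∀ x t y, X t y = x ↔ y = z (x, t) := by
  have hC : 0 ≤ C := hl.pos.le.trans ((hl.ge 0 0).trans (hl.le 0 0))
  have hsurj : ∀ x t, ∃ y, X t y = x := by
    intro x t
    have hc : Continuous (X t) := by have := hX.cont; fun_prop
    have hy := mem_range_of_exists_le_of_exists_ge hc (c := x)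
      ⟨x - C * |t|, ?_⟩ ⟨x + C * |t|, ?_⟩
    · exact hy
    · rcases le_total 0 t with h | h
      · have := (le_of_nonneg hl hX h (x - C * |t|)).2
        rw [abs_of_nonneg h] at *; linarith
      · have := (le_of_nonpos hl hX h (x - C * |t|)).2
        have h2 : c * t ≤ 0 := mul_nonpos_of_nonneg_of_nonpos hl.pos.le h
        have h3 : 0 ≤ C * |t| := by positivity
        linarith
    · rcases le_total 0 t with h | h
      · have := (le_of_nonneg hl hX h (x + C * |t|)).1
        have h2 : 0 ≤ c * t := mul_nonneg hl.pos.le h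
        have h3 : 0 ≤ C * |t| := by positivity
        linarith
      · have := (le_of_nonpos hl hX h (x + C * |t|)).1
        rw [abs_of_nonpos h] at *; linarith
  choose z hz using hsurj
  have hiff : ∀ x t y, X t y = x ↔ y = z x t := fun x t y =>
    ⟨fun h => (strictMono_start hl hX t).injective (h.trans (hz x t).symm), fun h => h ▸ hz x t⟩
  refine ⟨fun q => z q.1 q.2, ?_, hiff⟩
  have hG : ContDiff ℝ 1 fun e : (ℝ × ℝ) × ℝ => X e.1.2 e.2 - e.1.1 :=
    ((contDiff hl hX).comp (f := fun e : (ℝ × ℝ) × ℝ => (e.1.2, e.2)) (by fun_prop)).sub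
      (by fun_prop)
  refine contDiff_implicit hG (G' := fun e y => flowDeriv lx X e.2 y) ?_ ?_ ?_
  · intro e s
    rw [sub_eq_zero]; exact hiff _ _ _
  · exact fun e s => (hasDerivAt_start hl hX e.2 s).sub_const e.1
  · exact fun e s => (flowDeriv_pos _ _).ne'

/-- Every characteristic crosses the line `x = 0` exactly once; the crossing time is a `C¹`
function of the starting point. -/
lemma exists_crossing : ∃ τ : ℝ → ℝ, ContDiff ℝ 1 τ ∧ ∀ y s, X s y = 0 ↔ s = τ y := by
  have hc0 := hl.pos
  have hsurj : ∀ y, ∃ s, X s y = 0 := by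
    intro y
    have hc : Continuous fun s => X s y := by have := hX.cont; fun_prop
    have hy := mem_range_of_exists_le_of_exists_ge hc (c := 0)
      ⟨-(|y| / c), ?_⟩ ⟨|y| / c, ?_⟩
    · exact hy
    · have h := (le_of_nonpos hl hX (neg_nonpos.2 (by positivity : 0 ≤ |y| / c)) y).2
      have h2 : c * -(|y| / c) = -|y| := by field_simp
      have := le_abs_self y
      linarith
    · have h := (le_of_nonneg hl hX (by positivity : 0 ≤ |y| / c) y).1
      have h2 : c * (|y| / c) = |y| := by field_simp
      have := neg_abs_le y
      linarith
  choose τ hτ using hsurj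
  have hiff : ∀ y s, X s y = 0 ↔ s = τ y := fun y s =>
    ⟨fun h => (strictMono_time hl hX y).injective (h.trans (hτ y).symm), fun h => h ▸ hτ y⟩
  refine ⟨τ, ?_, hiff⟩
  have hG : ContDiff ℝ 1 fun e : ℝ × ℝ => X e.2 e.1 :=
    (contDiff hl hX).comp (f := fun e : ℝ × ℝ => (e.2, e.1)) (by fun_prop)
  exact contDiff_implicit hG (G' := fun e s => l (X s e) s) hiff
    (fun e s => hX.hasDerivAt s e) fun e s => (hl.pos.trans_le (hl.ge _ _)).ne'

end IsFlow

end Flow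

/-! ### The scalar transport problem on the plane -/

section PlaneTransport

lemma hasDerivAt_glue {f g f' g' : ℝ → ℝ} (hf : ∀ y, HasDerivAt f (f' y) y)
    (hg : ∀ y, HasDerivAt g (g' y) y) (h0 : f 0 = g 0) (h1 : f' 0 = g' 0) (y : ℝ) :
    HasDerivAt (fun y => if 0 ≤ y then f y else g y) (if 0 ≤ y then f' y else g' y) y := by
  rcases lt_trichotomy y 0 with hy | rfl | hy
  · rw [if_neg hy.not_ge]
    refine (hg y).congr_of_eventuallyEq ?_
    filter_upwards [Iio_mem_nhds hy] with z hz using if_neg (not_le.2 hz)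
  · rw [if_pos le_rfl, ← hasDerivWithinAt_univ, ← Iic_union_Ici (a := (0 : ℝ))]
    refine HasDerivWithinAt.union ?_ ?_
    · rw [h1]
      refine (hg 0).hasDerivWithinAt.congr (fun z hz => ?_) (by simpa using h0)
      rcases eq_or_lt_of_le (mem_Iic.1 hz) with rfl | hz
      · simpa using h0
      · exact if_neg hz.not_ge
    · exact (hf 0).hasDerivWithinAt.congr (fun z hz => if_pos hz) (if_pos le_rfl)
  · rw [if_pos hy.le]
    refine (hf y).congr_of_eventuallyEq ?_
    filter_upwards [Ioi_mem_nhds hy] with z hz using if_pos (le_of_lt hz)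

lemma continuous_glue {f g : ℝ → ℝ} (hf : Continuous f) (hg : Continuous g) (h0 : f 0 = g 0) :
    Continuous fun y => if 0 ≤ y then f y else g y :=
  hf.if_le hg continuous_const continuous_id fun y hy => by rw [← hy]; exact h0

variable {l lx X : ℝ → ℝ → ℝ} {c C L : ℝ}

/-- The Cauchy problem for `u_t + l u_x = F` with `C¹` initial values on the whole line: in the
coordinates (starting point, time) of the flow, the solution is a primitive of `F` along the
characteristics, and the chain rule gives the equation satisfied by `u_x` along them. -/
lemma exists_cauchy (hl : IsSpeed l lx c C L) (hX : IsFlow l X) {F Fx : ℝ → ℝ → ℝ}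
    (cF : Continuous fun q : ℝ × ℝ => F q.1 q.2) (cFx : Continuous fun q : ℝ × ℝ => Fx q.1 q.2)
    (hF : ∀ x t, HasDerivAt (fun x => F x t) (Fx x t) x)
    {ψ ψ' : ℝ → ℝ} (hψ : ∀ y, HasDerivAt ψ (ψ' y) y) (cψ' : Continuous ψ') :
    ∃ u p : ℝ → ℝ → ℝ, (Continuous fun q : ℝ × ℝ => p q.1 q.2) ∧
      (∀ q : ℝ × ℝ, HasFDerivAt (fun q : ℝ × ℝ => u q.1 q.2)
        (grad (p q.1 q.2) (F q.1 q.2 - l q.1 q.2 * p q.1 q.2)) q) ∧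
      (∀ s y, u (X s y) s = ψ y + ∫ r in (0 : ℝ)..s, F (X r y) r) ∧
      ∀ s y, HasDerivAt (fun s => p (X s y) s)
        (Fx (X s y) s - lx (X s y) s * p (X s y) s) s := by
  have cX := hX.cont
  have cE := IsFlow.continuous_flowDeriv hl hX
  obtain ⟨z, hz, hzX⟩ := IsFlow.exists_foot hl hX
  set E := flowDeriv lx X with hE
  set U : ℝ → ℝ → ℝ := fun s y => ψ y + ∫ r in (0 : ℝ)..s, F (X r y) r with hU
  set Uy : ℝ → ℝ → ℝ := fun s y => ψ' y + ∫ r in (0 : ℝ)..s, Fx (X r y) r * E r y with hUy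
  have hUs : ∀ s y, HasDerivAt (fun s => U s y) (F (X s y) s) s := fun s y =>
    (hasDerivAt_integral_upper (g := fun r => F (X r y) r) (by fun_prop) s).const_add _
  have hUyd : ∀ s y, HasDerivAt (fun y => U s y) (Uy s y) y := fun s y =>
    (hψ y).add (hasDerivAt_integral_param (g := fun r y => F (X r y) r)
      (g' := fun r y => Fx (X r y) r * E r y)
      (fun r y => HasDerivAt.comp y (hF (X r y) r) (IsFlow.hasDerivAt_start hl hX r y))
      (by fun_prop) (by fun_prop) s y)
  have cUy : Continuous fun q : ℝ × ℝ => Uy q.1 q.2 :=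
    (cψ'.comp continuous_snd).add (continuous_integral_param (P := ℝ × ℝ)
      (g := fun q r => Fx (X r q.2) r * E r q.2) (by fun_prop) continuous_fst)
  have hUyds : ∀ s y, HasDerivAt (fun s => Uy s y) (Fx (X s y) s * E s y) s := fun s y =>
    (hasDerivAt_integral_upper (g := fun r => Fx (X r y) r * E r y) (by fun_prop) s).const_add _
  have hEpos : ∀ s y, E s y ≠ 0 := fun s y => (flowDeriv_pos s y).ne'
  set P : ℝ → ℝ → ℝ := fun s y => Uy s y / E s y with hP
  have hUC : ContDiff ℝ 1 fun q : ℝ × ℝ => U q.1 q.2 :=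
    contDiff_of_partials (f := U) hUs hUyd (by fun_prop) cUy
  set u : ℝ → ℝ → ℝ := fun x t => U t (z (x, t)) with hu
  set p : ℝ → ℝ → ℝ := fun x t => P t (z (x, t)) with hp
  have hzX' : ∀ s y, z (X s y, s) = y := fun s y => ((hzX _ _ _).1 rfl).symm
  have hXz : ∀ x t, X t (z (x, t)) = x := fun x t => (hzX _ _ _).2 rfl
  have huC : ContDiff ℝ 1 fun q : ℝ × ℝ => u q.1 q.2 :=
    hUC.comp (f := fun q : ℝ × ℝ => (q.2, z q)) (by fun_prop)
  have huX : ∀ s y, u (X s y) s = U s y := fun s y => by simp only [hu, hzX']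
  have hpX : ∀ s y, p (X s y) s = P s y := fun s y => by simp only [hp, hzX']
  refine ⟨u, p, ?_, ?_, huX, ?_⟩
  · have cz := hz.continuous
    have cP : Continuous fun q : ℝ × ℝ => P q.1 q.2 := cUy.div cE fun q => hEpos _ _
    exact cP.comp (f := fun q : ℝ × ℝ => (q.2, z q)) (by fun_prop)
  · rintro ⟨x, t⟩
    obtain ⟨y, rfl⟩ : ∃ y, x = X t y := ⟨_, (hXz x t).symm⟩
    have hd := (huC.differentiable one_ne_zero (X t y, t)).hasFDerivAt
    set A := fderiv ℝ (fun q : ℝ × ℝ => u q.1 q.2) (X t y, t) with hA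
    have h1 : A (E t y, 0) = Uy t y := by
      have := hd.comp_hasDerivAt (f := fun y => (X t y, t)) y
        ((IsFlow.hasDerivAt_start hl hX t y).prodMk (hasDerivAt_const y t))
      refine this.unique ((hUyd t y).congr_of_eventuallyEq (Eventually.of_forall fun y => ?_))
      exact huX t y
    have h2 : A (l (X t y) t, 1) = F (X t y) t := by
      have := hd.comp_hasDerivAt (f := fun t => (X t y, t)) t
        ((hX.hasDerivAt t y).prodMk (hasDerivAt_id t))
      refine this.unique ((hUs t y).congr_of_eventuallyEq (Eventually.of_forall fun s => ?_))
      exact huX s y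
    rw [grad_self A] at h1 h2
    simp only [grad_apply, mul_zero, add_zero, mul_one] at h1 h2
    have h3 : A (1, 0) = p (X t y) t := by
      rw [hpX]; simp only [hP, ← h1]; field_simp [hEpos t y]
    have h4 : A (0, 1) = F (X t y) t - l (X t y) t * p (X t y) t := by
      rw [← h3, ← h2]; ring
    rw [grad_self A, h3, h4] at hd
    exact hd
  · intro s y
    simp only [hpX]
    refine ((hUyds s y).div (IsFlow.hasDerivAt_flowDeriv hl hX s y) (hEpos s y)).congr_deriv ?_
    simp only [hP, ← hE]
    have := hEpos s y
    field_simp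

/-- The initial-boundary value problem for `u_t + l u_x = F` in `x > 0`, `t > 0` becomes a Cauchy
problem once the boundary values are carried back along the characteristics to the half-line
`x < 0`, `t = 0`. The two compatibility conditions say that the resulting initial function is
`C¹` at `0`. -/
lemma exists_transport_plane (hl : IsSpeed l lx c C L) (hX : IsFlow l X) {F Fx : ℝ → ℝ → ℝ}
    (cF : Continuous fun q : ℝ × ℝ => F q.1 q.2) (cFx : Continuous fun q : ℝ × ℝ => Fx q.1 q.2)
    (hF : ∀ x t, HasDerivAt (fun x => F x t) (Fx x t) x)
    {φ φ' b b' : ℝ → ℝ} (hφ : ∀ y, HasDerivAt φ (φ' y) y) (cφ' : Continuous φ')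
    (hb : ∀ y, HasDerivAt b (b' y) y) (cb' : Continuous b') (h0 : φ 0 = b 0)
    (h1 : F 0 0 - l 0 0 * φ' 0 = b' 0) :
    ∃ u p : ℝ → ℝ → ℝ, (Continuous fun q : ℝ × ℝ => p q.1 q.2) ∧
      (∀ q : ℝ × ℝ, HasFDerivAt (fun q : ℝ × ℝ => u q.1 q.2)
        (grad (p q.1 q.2) (F q.1 q.2 - l q.1 q.2 * p q.1 q.2)) q) ∧
      (∀ x, 0 ≤ x → u x 0 = φ x) ∧ (∀ t, 0 ≤ t → u 0 t = b t) ∧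
      ∀ s y, HasDerivAt (fun s => p (X s y) s)
        (Fx (X s y) s - lx (X s y) s * p (X s y) s) s := by
  have cX := hX.cont
  have cE := IsFlow.continuous_flowDeriv hl hX
  obtain ⟨τ, hτ, hτX⟩ := IsFlow.exists_crossing hl hX
  set I : ℝ → ℝ → ℝ := fun s y => ∫ r in (0 : ℝ)..s, F (X r y) r with hI
  set Iy : ℝ → ℝ → ℝ := fun s y => ∫ r in (0 : ℝ)..s, Fx (X r y) r * flowDeriv lx X r y with hIy
  have hIs : ∀ s y, HasDerivAt (fun s => I s y) (F (X s y) s) s := fun s y =>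
    hasDerivAt_integral_upper (g := fun r => F (X r y) r) (by fun_prop) s
  have hIyd : ∀ s y, HasDerivAt (fun y => I s y) (Iy s y) y := fun s y =>
    hasDerivAt_integral_param (g := fun r y => F (X r y) r)
      (g' := fun r y => Fx (X r y) r * flowDeriv lx X r y)
      (fun r y => HasDerivAt.comp y (hF (X r y) r) (IsFlow.hasDerivAt_start hl hX r y))
      (by fun_prop) (by fun_prop) s y
  have cIy : Continuous fun q : ℝ × ℝ => Iy q.1 q.2 :=
    continuous_integral_param (P := ℝ × ℝ)
      (g := fun q r => Fx (X r q.2) r * flowDeriv lx X r q.2) (by fun_prop) continuous_fst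
  have hIF := hasFDerivAt_of_partials (f := I) hIs hIyd (by fun_prop) cIy
  have hτd : ∀ y, HasDerivAt τ (deriv τ y) y := fun y =>
    (hτ.differentiable one_ne_zero y).hasDerivAt
  have cτ' : Continuous (deriv τ) := (contDiff_one_iff_deriv.1 hτ).2
  have cτ := hτ.continuous
  set β : ℝ → ℝ := fun y => b (τ y) - I (τ y) y with hβ
  set β' : ℝ → ℝ := fun y => b' (τ y) * deriv τ y - (F (X (τ y) y) (τ y) * deriv τ y + Iy (τ y) y)
    with hβ'
  have hβd : ∀ y, HasDerivAt β (β' y) y := by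
    intro y
    have e1 : HasDerivAt (fun y => I (τ y) y) (F (X (τ y) y) (τ y) * deriv τ y + Iy (τ y) y) y := by
      have := (hIF (τ y, y)).comp_hasDerivAt (f := fun y => (τ y, y)) y
        ((hτd y).prodMk (hasDerivAt_id y))
      exact this.congr_deriv (by simp)
    exact (HasDerivAt.comp y (hb (τ y)) (hτd y)).sub e1
  have cβ' : Continuous β' := by
    have : Continuous fun y => Iy (τ y) y := cIy.comp (cτ.prodMk continuous_id)
    simp only [hβ']; fun_prop
  have hτ0 : τ 0 = 0 := ((hτX 0 0).1 (hX.zero 0)).symm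
  -- differentiating `X (τ y) y = 0` at `y = 0`
  have hτ'0 : l 0 0 * deriv τ 0 + 1 = 0 := by
    have hXF := hasFDerivAt_of_partials (f := X) hX.hasDerivAt (IsFlow.hasDerivAt_start hl hX)
      (by have := hl.cont; fun_prop) cE
    have e1 := (hXF (τ 0, 0)).comp_hasDerivAt (f := fun y => (τ y, y)) 0
        ((hτd 0).prodMk (hasDerivAt_id 0))
    have e2 : HasDerivAt (fun _ : ℝ => (0 : ℝ)) 0 0 := hasDerivAt_const _ _
    have e3 := e1.unique (e2.congr_of_eventuallyEq
      (Eventually.of_forall fun y => (hτX y (τ y)).2 rfl))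
    simpa [hτ0, hX.zero, flowDeriv] using e3
  have hg0 : φ 0 = β 0 := by simp [hβ, hτ0, hI, h0]
  have hg1 : φ' 0 = β' 0 := by
    have hne : l 0 0 ≠ 0 := (hl.pos.trans_le (hl.ge 0 0)).ne'
    simp only [hβ', hτ0, hX.zero, hIy, intervalIntegral.integral_same, add_zero, ← h1]
    linear_combination φ' 0 * hτ'0
  obtain ⟨u, p, hp, hu, huX, hpX⟩ := exists_cauchy hl hX cF cFx hF
    (hasDerivAt_glue hφ hβd hg0 hg1) (continuous_glue cφ' cβ' hg1)
  refine ⟨u, p, hp, hu, fun x hx => ?_, fun t ht => ?_, hpX⟩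
  · have := huX 0 x
    rw [hX.zero, if_pos hx] at this
    simpa using this
  · obtain ⟨z, -, hzX⟩ := IsFlow.exists_foot hl hX
    set y := z (0, t) with hy
    have hXy : X t y = 0 := (hzX 0 t y).2 hy
    have htau : τ y = t := ((hτX y t).1 hXy).symm
    have hy0 : y ≤ 0 := by
      have := (IsFlow.le_of_nonneg hl hX ht y).1
      have := mul_nonneg hl.pos.le ht
      linarith
    have h2 := huX t y
    rw [hXy] at h2
    rw [h2]
    rcases hy0.lt_or_eq with h | h
    · rw [if_neg h.not_ge]
      simp [hβ, htau, hI]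
    · rw [h, hτ0] at htau
      simp [h, ← htau, h0]

end PlaneTransport

/-! ### Extension from a box to the plane -/

section BoxTransport

/-- The box `[0,1] × [0,T]`. -/
def box (T : ℝ) : Set (ℝ × ℝ) := Icc 0 1 ×ˢ Icc 0 T

lemma isCompact_box (T : ℝ) : IsCompact (box T) := isCompact_Icc.prod isCompact_Icc

lemma box_subset_closedStrip (T : ℝ) : box T ⊆ closedStrip :=
  prod_mono_right Icc_subset_Ici_self

/-- `g` and its `x`-derivative `gx` (one-sided at `x = 0, 1`) are continuous on the box. -/
structure IsC1X (T : ℝ) (g gx : ℝ → ℝ → ℝ) : Prop where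
  cont : ContinuousOn (fun q : ℝ × ℝ => g q.1 q.2) (box T)
  cont_deriv : ContinuousOn (fun q : ℝ × ℝ => gx q.1 q.2) (box T)
  hasDerivWithinAt : ∀ x ∈ Icc (0 : ℝ) 1, ∀ t ∈ Icc (0 : ℝ) T,
    HasDerivWithinAt (fun x => g x t) (gx x t) (Icc 0 1) x

/-- The nearest point of `[a, b]`. -/
noncomputable def clamp (a b x : ℝ) : ℝ := max a (min b x)

lemma continuous_clamp (a b : ℝ) : Continuous (clamp a b) := by unfold clamp; fun_prop

lemma clamp_mem {a b : ℝ} (h : a ≤ b) (x : ℝ) : clamp a b x ∈ Icc a b :=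
  ⟨le_max_left _ _, max_le h (min_le_left _ _)⟩

lemma clamp_of_mem {a b x : ℝ} (h : x ∈ Icc a b) : clamp a b x = x := by
  rw [clamp, min_eq_right h.2, max_eq_right h.1]

lemma clamp_of_le {a b x : ℝ} (h : x ≤ a) : clamp a b x = a := by
  rw [clamp, max_eq_left ((min_le_right _ _).trans h)]

lemma clamp_of_ge {a b x : ℝ} (hab : a ≤ b) (h : b ≤ x) : clamp a b x = b := by
  rw [clamp, min_eq_left h, max_eq_right hab]

/-- A `C¹` function on `[a, b]` extends to a `C¹` function on the line: beyond an end point `x₀`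
by `g x₀ + E ((x - x₀) g'(x₀))`, where `E` is any function tangent to the identity at `0`. -/
lemma hasDerivAt_extend {a b : ℝ} (hab : a ≤ b) {g g' : ℝ → ℝ}
    (hg : ∀ x ∈ Icc a b, HasDerivWithinAt g (g' x) (Icc a b) x) {E E' : ℝ → ℝ}
    (hE : ∀ z, HasDerivAt E (E' z) z) (hE0 : E 0 = 0) (hE1 : E' 0 = 1) (x : ℝ) :
    HasDerivAt (fun x => g (clamp a b x) + E ((x - clamp a b x) * g' (clamp a b x)))
      (g' (clamp a b x) * E' ((x - clamp a b x) * g' (clamp a b x))) x := by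
  have hlin : ∀ x₀, HasDerivAt (fun x => g x₀ + E ((x - x₀) * g' x₀))
      (g' x₀ * E' ((x - x₀) * g' x₀)) x := fun x₀ => by
    have h1 : HasDerivAt (fun x => (x - x₀) * g' x₀) (g' x₀) x := by
      simpa using ((hasDerivAt_id x).sub_const x₀).mul_const (g' x₀)
    exact ((HasDerivAt.comp x (hE _) h1).const_add _).congr_deriv (mul_comm _ _)
  have hout : ∀ (S : Set ℝ) (f : ℝ → ℝ) (f' : ℝ), IsClosed S → x ∉ S →
      HasDerivWithinAt f f' S x := fun S f f' hS hx => by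
    refine HasFDerivWithinAt.of_notMem_closure ?_
    rwa [hS.closure_eq]
  have hcov : Iic a ∪ (Icc a b ∪ Ici b) = univ := by
    rw [Icc_union_Ici_eq_Ici hab, Iic_union_Ici]
  rw [← hasDerivWithinAt_univ, ← hcov]
  refine HasDerivWithinAt.union ?_ (HasDerivWithinAt.union ?_ ?_)
  · by_cases hx : x ∈ Iic a
    · rw [clamp_of_le hx]
      refine (hlin a).hasDerivWithinAt.congr (fun y hy => ?_) ?_
      · rw [clamp_of_le hy]
      · rw [clamp_of_le hx]
    · exact hout _ _ _ isClosed_Iic hx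
  · by_cases hx : x ∈ Icc a b
    · rw [clamp_of_mem hx, sub_self, zero_mul, hE1, mul_one]
      refine (hg x hx).congr (fun y hy => ?_) ?_
      · simp [clamp_of_mem hy, hE0]
      · simp [clamp_of_mem hx, hE0]
    · exact hout _ _ _ isClosed_Icc hx
  · by_cases hx : x ∈ Ici b
    · rw [clamp_of_ge hab hx]
      refine (hlin b).hasDerivWithinAt.congr (fun y hy => ?_) ?_
      · rw [clamp_of_ge hab hy]
      · rw [clamp_of_ge hab hx]
    · exact hout _ _ _ isClosed_Ici hx

/-- Linear `C¹` extension of a function of one variable. -/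
lemma exists_extend {a b : ℝ} (hab : a ≤ b) {g g' : ℝ → ℝ}
    (hg : ∀ x ∈ Icc a b, HasDerivWithinAt g (g' x) (Icc a b) x) (cg' : ContinuousOn g' (Icc a b)) :
    ∃ h h' : ℝ → ℝ, (∀ x, HasDerivAt h (h' x) x) ∧ Continuous h' ∧
      (∀ x ∈ Icc a b, h x = g x) ∧ ∀ x ∈ Icc a b, h' x = g' x := by
  refine ⟨_, _, hasDerivAt_extend hab hg (E := id) (E' := fun _ => 1) (fun z => hasDerivAt_id z)
    rfl rfl, ?_, fun x hx => ?_, fun x hx => ?_⟩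
  · simp only [mul_one]
    exact cg'.comp_continuous (continuous_clamp a b) (clamp_mem hab)
  · simp [clamp_of_mem hx]
  · simp [clamp_of_mem hx]

variable {T : ℝ}

lemma continuous_comp_clamp (hT : 0 ≤ T) {g : ℝ → ℝ → ℝ}
    (hg : ContinuousOn (fun q : ℝ × ℝ => g q.1 q.2) (box T)) :
    Continuous fun q : ℝ × ℝ => g (clamp 0 1 q.1) (clamp 0 T q.2) :=
  hg.comp_continuous (f := fun q : ℝ × ℝ => (clamp 0 1 q.1, clamp 0 T q.2))
    (((continuous_clamp 0 1).comp continuous_fst).prodMk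
      ((continuous_clamp 0 T).comp continuous_snd))
    fun _ => ⟨clamp_mem zero_le_one _, clamp_mem hT _⟩

/-- Linear extension in `x` and constant extension in `t`. -/
lemma IsC1X.exists_extend (hT : 0 ≤ T) {g gx : ℝ → ℝ → ℝ} (hg : IsC1X T g gx) :
    ∃ h hx : ℝ → ℝ → ℝ, (Continuous fun q : ℝ × ℝ => h q.1 q.2) ∧
      (Continuous fun q : ℝ × ℝ => hx q.1 q.2) ∧
      (∀ x t, HasDerivAt (fun x => h x t) (hx x t) x) ∧
      (∀ x ∈ Icc (0 : ℝ) 1, ∀ t ∈ Icc (0 : ℝ) T, h x t = g x t) ∧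
      ∀ x ∈ Icc (0 : ℝ) 1, ∀ t ∈ Icc (0 : ℝ) T, hx x t = gx x t := by
  have c1 := continuous_comp_clamp hT hg.cont
  have c2 := continuous_comp_clamp hT hg.cont_deriv
  have c3 := continuous_clamp 0 1
  refine ⟨fun x t => g (clamp 0 1 x) (clamp 0 T t) +
    id ((x - clamp 0 1 x) * gx (clamp 0 1 x) (clamp 0 T t)),
    fun x t => gx (clamp 0 1 x) (clamp 0 T t) * 1, ?_, ?_, fun x t => ?_, ?_, ?_⟩
  · exact c1.add ((continuous_fst.sub (c3.comp continuous_fst)).mul c2)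
  · simpa using c2
  · exact hasDerivAt_extend zero_le_one (g := fun x => g x (clamp 0 T t))
      (g' := fun x => gx x (clamp 0 T t))
      (fun x hx => hg.hasDerivWithinAt x hx _ (clamp_mem hT t)) (E := id) (E' := fun _ => 1)
      (fun z => hasDerivAt_id z) rfl rfl x
  · intro x hx t ht; simp [clamp_of_mem hx, clamp_of_mem ht]
  · intro x hx t ht; simp [clamp_of_mem hx, clamp_of_mem ht]

/-- A positive speed on the box extends to a uniformly positive bounded speed with bounded
`x`-derivative: its logarithm is extended with the bounded profile `E = sin`. -/
lemma IsC1X.exists_isSpeed (hT : 0 ≤ T) {l lx : ℝ → ℝ → ℝ} (hl : IsC1X T l lx)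
    (hpos : ∀ q ∈ box T, 0 < l q.1 q.2) :
    ∃ (m mx : ℝ → ℝ → ℝ) (c C L : ℝ), IsSpeed m mx c C L ∧
      (∀ x ∈ Icc (0 : ℝ) 1, ∀ t ∈ Icc (0 : ℝ) T, m x t = l x t) ∧
      ∀ x ∈ Icc (0 : ℝ) 1, ∀ t ∈ Icc (0 : ℝ) T, mx x t = lx x t := by
  have cg : ContinuousOn (fun q : ℝ × ℝ => Real.log (l q.1 q.2)) (box T) :=
    hl.cont.log fun q hq => (hpos q hq).ne'
  have cg' : ContinuousOn (fun q : ℝ × ℝ => lx q.1 q.2 / l q.1 q.2) (box T) :=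
    hl.cont_deriv.div hl.cont fun q hq => (hpos q hq).ne'
  obtain ⟨M, hM⟩ := (isCompact_box T).exists_bound_of_continuousOn cg
  obtain ⟨M', hM'⟩ := (isCompact_box T).exists_bound_of_continuousOn cg'
  have c1 := continuous_comp_clamp hT (g := fun x t => Real.log (l x t)) cg
  have c2 := continuous_comp_clamp hT (g := fun x t => lx x t / l x t) cg'
  have c3 := continuous_clamp 0 1
  set g : ℝ → ℝ → ℝ := fun x t => Real.log (l (clamp 0 1 x) (clamp 0 T t)) with hg
  set g' : ℝ → ℝ → ℝ := fun x t => lx (clamp 0 1 x) (clamp 0 T t) / l (clamp 0 1 x) (clamp 0 T t)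
    with hg'
  set k : ℝ → ℝ → ℝ := fun x t => g x t + Real.sin ((x - clamp 0 1 x) * g' x t) with hk
  set k' : ℝ → ℝ → ℝ := fun x t => g' x t * Real.cos ((x - clamp 0 1 x) * g' x t) with hk'
  have ck : Continuous fun q : ℝ × ℝ => k q.1 q.2 := by simp only [hk]; fun_prop
  have ck' : Continuous fun q : ℝ × ℝ => k' q.1 q.2 := by simp only [hk']; fun_prop
  have hkd : ∀ x t, HasDerivAt (fun x => k x t) (k' x t) x := fun x t => by
    have := hasDerivAt_extend zero_le_one (g := fun x => Real.log (l x (clamp 0 T t)))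
      (g' := fun x => lx x (clamp 0 T t) / l x (clamp 0 T t))
      (fun x hx => ?_) (E := Real.sin) (E' := Real.cos) Real.hasDerivAt_sin Real.sin_zero
      Real.cos_zero x
    · exact this
    · exact (hl.hasDerivWithinAt x hx _ (clamp_mem hT t)).log
        (hpos (x, clamp 0 T t) ⟨hx, clamp_mem hT t⟩).ne'
  have hmem : ∀ x t, (clamp 0 1 x, clamp 0 T t) ∈ box T := fun x t =>
    ⟨clamp_mem zero_le_one _, clamp_mem hT _⟩
  have hkb : ∀ x t, |k x t| ≤ M + 1 := fun x t =>
    (abs_add_le _ _).trans (add_le_add (hM _ (hmem x t)) (Real.abs_sin_le_one _))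
  have hkb' : ∀ x t, |k' x t| ≤ M' := fun x t => by
    have h1 : |g' x t| ≤ M' := hM' _ (hmem x t)
    rw [hk', abs_mul]
    calc |g' x t| * |Real.cos _| ≤ |g' x t| * 1 := by
          gcongr; exact Real.abs_cos_le_one _
      _ ≤ M' := by rwa [mul_one]
  refine ⟨fun x t => Real.exp (k x t), fun x t => Real.exp (k x t) * k' x t,
    Real.exp (-(M + 1)), Real.exp (M + 1), Real.exp (M + 1) * M',
    ⟨by fun_prop, by fun_prop, fun x t => (hkd x t).exp, Real.exp_pos _, fun x t => ?_,
    fun x t => ?_, fun x t => ?_⟩, ?_, ?_⟩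
  · exact Real.exp_le_exp.2 (abs_le.1 (hkb x t)).1
  · exact Real.exp_le_exp.2 (abs_le.1 (hkb x t)).2
  · rw [abs_mul, Real.abs_exp]
    exact mul_le_mul (Real.exp_le_exp.2 (abs_le.1 (hkb x t)).2) (hkb' x t) (abs_nonneg _)
      (Real.exp_pos _).le
  · intro x hx t ht
    simp [hk, hg, clamp_of_mem hx, clamp_of_mem ht, Real.exp_log (hpos (x, t) ⟨hx, ht⟩)]
  · intro x hx t ht
    have h := hpos (x, t) ⟨hx, ht⟩
    simp only at h
    simp only [hk, hk', hg, hg', clamp_of_mem hx, clamp_of_mem ht, sub_self, zero_mul,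
      Real.sin_zero, Real.cos_zero, add_zero, mul_one, Real.exp_log h]
    field_simp

/-! ### The scalar transport problem on a box -/

/-- `γ` is, on the time interval `[a, b]`, a characteristic of `l` inside `[0,1]`. -/
def IsChar (l : ℝ → ℝ → ℝ) (γ : ℝ → ℝ) (a b : ℝ) : Prop :=
  ∀ s ∈ Icc a b, γ s ∈ Icc (0 : ℝ) 1 ∧ HasDerivWithinAt γ (l (γ s) s) (Icc a b) s

/-- `G` is the derivative of `q` along the characteristics of `l` in the box. This is the sense in
which the merely continuous function `∂ₓu` satisfies the differentiated equation. Only points with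
`0 < x < 1` are concerned, so that it also makes sense for functions differentiable inside. -/
def HasCharDeriv (T : ℝ) (l q G : ℝ → ℝ → ℝ) : Prop :=
  ∀ (γ : ℝ → ℝ) (a b : ℝ), 0 ≤ a → b ≤ T → IsChar l γ a b → ∀ s ∈ Ioo a b,
    γ s ∈ Ioo (0 : ℝ) 1 → HasDerivAt (fun s => q (γ s) s) (G (γ s) s) s

/-- Every point of the box is reached by a characteristic that comes from the initial line or from
the side `x = e`. -/
def HasBackChars (T : ℝ) (l : ℝ → ℝ → ℝ) (e : ℝ) : Prop :=
  ∀ x ∈ Icc (0 : ℝ) 1, ∀ t ∈ Icc (0 : ℝ) T, ∃ a ∈ Icc (0 : ℝ) t, ∃ γ : ℝ → ℝ, IsChar l γ a t ∧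
    γ t = x ∧ (a = 0 ∨ γ a = e) ∧ ∀ s ∈ Ioo a t, γ s ∈ Ioo (0 : ℝ) 1

/-- The transport equation `u_t + l u_x = F` on the box has a `C¹` solution with given compatible
`C¹` values for `t = 0` and for `x = e`, and `u_x` satisfies the differentiated equation. -/
def TransportSolvable (T : ℝ) (l lx : ℝ → ℝ → ℝ) (e : ℝ) : Prop :=
  ∀ (F Fx : ℝ → ℝ → ℝ) (φ φ' b b' : ℝ → ℝ), IsC1X T F Fx →
    (∀ x ∈ Icc (0 : ℝ) 1, HasDerivWithinAt φ (φ' x) (Icc 0 1) x) → ContinuousOn φ' (Icc 0 1) →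
    (∀ t ∈ Icc (0 : ℝ) T, HasDerivWithinAt b (b' t) (Icc 0 T) t) → ContinuousOn b' (Icc 0 T) →
    φ e = b 0 → F e 0 - l e 0 * φ' e = b' 0 →
    ∃ u p : ℝ → ℝ → ℝ, ContinuousOn (fun q : ℝ × ℝ => p q.1 q.2) (box T) ∧
      (∀ q ∈ box T, HasFDerivWithinAt (fun q : ℝ × ℝ => u q.1 q.2)
        (grad (p q.1 q.2) (F q.1 q.2 - l q.1 q.2 * p q.1 q.2)) (box T) q) ∧
      (∀ x ∈ Icc (0 : ℝ) 1, u x 0 = φ x) ∧ (∀ t ∈ Icc (0 : ℝ) T, u e t = b t) ∧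
      HasCharDeriv T l p fun x t => Fx x t - lx x t * p x t

/-- For positive speeds the box may be replaced by the plane: the extended data have the same
characteristics inside the box. -/
lemma transport_right (hT : 0 ≤ T) {l lx : ℝ → ℝ → ℝ} (hl : IsC1X T l lx)
    (hpos : ∀ q ∈ box T, 0 < l q.1 q.2) :
    HasBackChars T l 0 ∧ TransportSolvable T l lx 0 := by
  obtain ⟨m, mx, c, C, L, hm, hml, hmlx⟩ := hl.exists_isSpeed hT hpos
  obtain ⟨X, hX⟩ := hm.exists_flow
  obtain ⟨z, -, hz⟩ := IsFlow.exists_foot hm hX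
  have h00 : (0 : ℝ) ∈ Icc (0 : ℝ) 1 := ⟨le_rfl, zero_le_one⟩
  have h0T : (0 : ℝ) ∈ Icc (0 : ℝ) T := ⟨le_rfl, hT⟩
  constructor
  · intro x hx t ht
    obtain ⟨τ, -, hτ⟩ := IsFlow.exists_crossing hm hX
    set y := z (x, t) with hy
    have hXt : X t y = x := (hz x t y).2 hy
    have hmono := IsFlow.strictMono_time hm hX y
    have key : ∀ a ∈ Icc (0 : ℝ) t, 0 ≤ X a y → IsChar l (fun s => X s y) a t ∧
        ∀ s ∈ Ioo a t, X s y ∈ Ioo (0 : ℝ) 1 := by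
      intro a ha hXa
      refine ⟨fun s hs => ?_, fun s hs => ⟨hXa.trans_lt (hmono hs.1), ?_⟩⟩
      · have hsx : X s y ∈ Icc (0 : ℝ) 1 :=
          ⟨hXa.trans (hmono.monotone hs.1), (hmono.monotone hs.2).trans (hXt.trans_le hx.2)⟩
        refine ⟨hsx, ?_⟩
        rw [← hml _ hsx s ⟨ha.1.trans hs.1, hs.2.trans ht.2⟩]
        exact (hX.hasDerivAt s y).hasDerivWithinAt
      · exact (hmono hs.2).trans_le (hXt.trans_le hx.2)
    rcases le_or_gt 0 y with h | h
    · have ha : (0 : ℝ) ∈ Icc (0 : ℝ) t := ⟨le_rfl, ht.1⟩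
      obtain ⟨h1, h2⟩ := key 0 ha (by rwa [hX.zero])
      exact ⟨0, ha, _, h1, hXt, Or.inl rfl, h2⟩
    · have hXτ : X (τ y) y = 0 := (hτ y _).2 rfl
      have ha : τ y ∈ Icc (0 : ℝ) t := by
        constructor
        · refine le_of_lt (hmono.lt_iff_lt.1 ?_)
          simp only [hX.zero, hXτ, h]
        · refine hmono.le_iff_le.1 ?_
          simp only [hXt, hXτ, hx.1]
      obtain ⟨h1, h2⟩ := key _ ha hXτ.ge
      exact ⟨τ y, ha, _, h1, hXt, Or.inr hXτ, h2⟩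
  · intro F Fx φ φ' b b' hF hφ cφ' hb cb' h0 h1
    obtain ⟨F₁, Fx₁, cF, cFx, hFd, hFe, hFxe⟩ := hF.exists_extend hT
    obtain ⟨φ₁, φ₁', hφ₁, cφ₁, eφ, eφ'⟩ := exists_extend zero_le_one hφ cφ'
    obtain ⟨b₁, b₁', hb₁, cb₁, eb, eb'⟩ := exists_extend hT hb cb'
    obtain ⟨u, p, cp, hu, hu0, hub, hp⟩ := exists_transport_plane hm hX cF cFx hFd hφ₁ cφ₁ hb₁ cb₁
      (by rw [eφ 0 h00, eb 0 h0T, h0])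
      (by rw [hFe 0 h00 0 h0T, hml 0 h00 0 h0T, eφ' 0 h00, eb' 0 h0T, h1])
    refine ⟨u, p, cp.continuousOn, fun q hq => ?_, fun x hx => ?_, fun t ht => ?_, ?_⟩
    · have := hu q
      rw [hFe _ hq.1 _ hq.2, hml _ hq.1 _ hq.2] at this
      exact this.hasFDerivWithinAt
    · rw [hu0 x hx.1, eφ x hx]
    · rw [hub t ht.1, eb t ht]
    · intro γ a b ha hb hγ s hs _
      have hsI : s ∈ Icc (0 : ℝ) T := ⟨ha.trans hs.1.le, hs.2.le.trans hb⟩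
      have hγs := (hγ s (Ioo_subset_Icc_self hs)).1
      set y := z (γ s, s) with hy
      have hXs : X s y = γ s := (hz _ _ _).2 hy
      have hEq : EqOn γ (fun s => X s y) (Ioo a b) := by
        refine hm.flow_unique hs (fun r hr => ?_) (fun r hr => hX.hasDerivAt r y) hXs.symm
        obtain ⟨h3, h4⟩ := hγ r (Ioo_subset_Icc_self hr)
        rw [hml _ h3 r ⟨ha.trans hr.1.le, hr.2.le.trans hb⟩]
        exact h4.hasDerivAt (Icc_mem_nhds hr.1 hr.2)
      have h5 := hp s y
      rw [hXs, hFxe _ hγs _ hsI, hmlx _ hγs _ hsI] at h5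
      refine h5.congr_of_eventuallyEq ?_
      filter_upwards [Ioo_mem_nhds hs.1 hs.2] with r hr
      rw [hEq hr]

lemma one_sub_mem {x : ℝ} (hx : x ∈ Icc (0 : ℝ) 1) : 1 - x ∈ Icc (0 : ℝ) 1 :=
  ⟨by linarith [hx.2], by linarith [hx.1]⟩

lemma hasDerivWithinAt_one_sub {g : ℝ → ℝ} {g' x : ℝ}
    (h : HasDerivWithinAt g g' (Icc 0 1) (1 - x)) :
    HasDerivWithinAt (fun x => g (1 - x)) (-g') (Icc 0 1) x := by
  have h2 : HasDerivWithinAt (fun x : ℝ => 1 - x) (-1) (Icc 0 1) x :=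
    ((hasDerivAt_id x).const_sub 1).hasDerivWithinAt
  have := HasDerivWithinAt.comp x h h2 fun y hy => one_sub_mem hy
  exact this.congr_deriv (by ring)

lemma mapsTo_one_sub : MapsTo (fun q : ℝ × ℝ => (1 - q.1, q.2)) (box T) (box T) :=
  fun _ hq => ⟨one_sub_mem hq.1, hq.2⟩

lemma continuousOn_one_sub {g : ℝ → ℝ → ℝ}
    (h : ContinuousOn (fun q : ℝ × ℝ => g q.1 q.2) (box T)) :
    ContinuousOn (fun q : ℝ × ℝ => g (1 - q.1) q.2) (box T) :=
  h.comp (f := fun q : ℝ × ℝ => (1 - q.1, q.2)) (by fun_prop) mapsTo_one_sub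

lemma IsC1X.one_sub {g gx : ℝ → ℝ → ℝ} (hg : IsC1X T g gx) :
    IsC1X T (fun x t => g (1 - x) t) fun x t => -gx (1 - x) t :=
  ⟨continuousOn_one_sub hg.cont, (continuousOn_one_sub hg.cont_deriv).neg, fun _ hx t ht =>
    hasDerivWithinAt_one_sub (hg.hasDerivWithinAt _ (one_sub_mem hx) t ht)⟩

lemma IsChar.one_sub {l m : ℝ → ℝ → ℝ} {γ : ℝ → ℝ} {a b : ℝ} (hγ : IsChar l γ a b)
    (hlm : ∀ x t, m x t = -l (1 - x) t) : IsChar m (fun s => 1 - γ s) a b := fun s hs => by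
  refine ⟨one_sub_mem (hγ s hs).1, ?_⟩
  rw [hlm, sub_sub_cancel]
  exact (hγ s hs).2.const_sub 1

/-- The reflection `x ↦ 1 - x` reduces negative speeds to positive ones. -/
lemma transport_left (hT : 0 ≤ T) {l lx : ℝ → ℝ → ℝ} (hl : IsC1X T l lx)
    (hneg : ∀ q ∈ box T, l q.1 q.2 < 0) :
    HasBackChars T l 1 ∧ TransportSolvable T l lx 1 := by
  have hm : IsC1X T (fun x t => -l (1 - x) t) fun x t => lx (1 - x) t := by
    have h := hl.one_sub
    exact ⟨h.cont.neg, continuousOn_one_sub hl.cont_deriv, fun x hx t ht =>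
      (h.hasDerivWithinAt x hx t ht).neg.congr_deriv (neg_neg _)⟩
  obtain ⟨h1, h2⟩ := transport_right hT hm fun q hq => by
    simpa using hneg _ (mapsTo_one_sub hq)
  constructor
  · intro x hx t ht
    obtain ⟨a, ha, γ, h3, h4, h5, h6⟩ := h1 _ (one_sub_mem hx) t ht
    refine ⟨a, ha, fun s => 1 - γ s, h3.one_sub (by simp), by simp [h4], ?_, fun s hs => ?_⟩
    · rcases h5 with h5 | h5
      · exact Or.inl h5
      · exact Or.inr (by simp [h5])
    · have := h6 s hs
      exact ⟨by linarith [this.2], by linarith [this.1]⟩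
  · intro F Fx φ φ' b b' hF hφ cφ' hb cb' h0 h10
    obtain ⟨u, p, cp, hu, hu0, hub, hp⟩ := h2 _ _ (fun x => φ (1 - x)) (fun x => -φ' (1 - x)) b b'
      hF.one_sub (fun _ hx => hasDerivWithinAt_one_sub (hφ _ (one_sub_mem hx)))
      (cφ'.comp (by fun_prop) fun _ hx => one_sub_mem hx).neg hb cb' (by simpa using h0)
      (by simpa using h10)
    refine ⟨fun x t => u (1 - x) t, fun x t => -p (1 - x) t, (continuousOn_one_sub cp).neg, ?_,
      fun x hx => by simp [hu0 _ (one_sub_mem hx)], fun t ht => by simp [hub t ht], ?_⟩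
    · intro q hq
      have h3 := hu _ (mapsTo_one_sub hq)
      have h4 : HasFDerivWithinAt (fun q : ℝ × ℝ => (1 - q.1, q.2))
          ((-ContinuousLinearMap.fst ℝ ℝ ℝ).prod (ContinuousLinearMap.snd ℝ ℝ ℝ)) (box T) q :=
        ((hasFDerivAt_fst.const_sub 1).prodMk hasFDerivAt_snd).hasFDerivWithinAt
      have h5 := HasFDerivWithinAt.comp q h3 h4 mapsTo_one_sub
      refine h5.congr_fderiv ?_
      ext <;> simp [grad]
    · intro γ a b ha hb hγ s hs hγs
      have h3 := (hp _ a b ha hb (hγ.one_sub (m := fun x t => -l (1 - x) t) (by simp)) s hs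
        ⟨by linarith [hγs.2], by linarith [hγs.1]⟩).neg
      refine h3.congr_deriv ?_
      simp only [sub_sub_cancel]
      ring

end BoxTransport

/-! ### Weighted estimates along characteristics -/

section Weight

/-- The weight `exp (μ t - ν |x - e|)` for a side `e ∈ {0, 1}`; `|x - e| = e + (1 - 2e) x` on
`[0,1]`. -/
noncomputable def weight (μ ν e x t : ℝ) : ℝ := Real.exp (μ * t - ν * (e + (1 - 2 * e) * x))

variable {μ ν e T : ℝ}

lemma weight_pos (x t : ℝ) : 0 < weight μ ν e x t := Real.exp_pos _

lemma continuous_weight : Continuous fun q : ℝ × ℝ => weight μ ν e q.1 q.2 := by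
  unfold weight; fun_prop

lemma weight_entry (he : e = 0 ∨ e = 1) (t : ℝ) : weight μ ν e e t = Real.exp (μ * t) := by
  rcases he with rfl | rfl
  · simp [weight]
  · norm_num [weight]

lemma weight_exit (he : e = 0 ∨ e = 1) (t : ℝ) :
    weight μ ν e (1 - e) t = Real.exp (-ν) * Real.exp (μ * t) := by
  rw [← Real.exp_add]
  rcases he with rfl | rfl <;> simp only [weight] <;> congr 1 <;> ring

lemma depth_mem (he : e = 0 ∨ e = 1) {x : ℝ} (hx : x ∈ Icc (0 : ℝ) 1) :
    e + (1 - 2 * e) * x ∈ Icc (0 : ℝ) 1 := by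
  rcases he with rfl | rfl
  · simpa using hx
  · have := one_sub_mem hx
    convert this using 1; ring

lemma weight_le (he : e = 0 ∨ e = 1) (hν : 0 ≤ ν) {x : ℝ} (hx : x ∈ Icc (0 : ℝ) 1) (t : ℝ) :
    weight μ ν e x t ≤ Real.exp (μ * t) := by
  refine Real.exp_le_exp.2 ?_
  have := mul_nonneg hν (depth_mem he hx).1
  linarith

lemma exp_le_weight (he : e = 0 ∨ e = 1) (hν : 0 ≤ ν) {x : ℝ} (hx : x ∈ Icc (0 : ℝ) 1) (t : ℝ) :
    Real.exp (μ * t) ≤ Real.exp ν * weight μ ν e x t := by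
  rw [weight, ← Real.exp_add]
  refine Real.exp_le_exp.2 ?_
  have := mul_le_mul_of_nonneg_left (depth_mem he hx).2 hν
  linarith

/-- Comparison principle. The barrier `K * weight` is an upper bound for `|q|` as soon as it is one
on the initial line and on the entry side, and the derivative of `q` along the characteristics is
smaller than that of the barrier where the barrier is touched. -/
lemma abs_le_weight {l q G : ℝ → ℝ → ℝ} {Λ K : ℝ} (hl : HasBackChars T l e)
    (hΛ : ∀ p ∈ box T, (1 - 2 * e) * l p.1 p.2 ≤ Λ) (hν : 0 ≤ ν) (hK : 0 < K)
    (cq : ContinuousOn (fun p : ℝ × ℝ => q p.1 p.2) (box T)) (hq : HasCharDeriv T l q G)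
    (hinit : ∀ x ∈ Icc (0 : ℝ) 1, |q x 0| < K * weight μ ν e x 0)
    (hbdry : ∀ t ∈ Icc (0 : ℝ) T, |q e t| < K * weight μ ν e e t)
    (hsrc : ∀ x ∈ Ioo (0 : ℝ) 1, ∀ t ∈ Ioo (0 : ℝ) T, |q x t| = K * weight μ ν e x t →
      |G x t| < (μ - ν * Λ) * (K * weight μ ν e x t)) :
    ∀ x ∈ Icc (0 : ℝ) 1, ∀ t ∈ Icc (0 : ℝ) T, |q x t| ≤ K * weight μ ν e x t := by
  intro x hx t ht
  obtain ⟨a, ha, γ, hγ, rfl, hend, hint⟩ := hl x hx t ht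
  have hIcc : ∀ s ∈ Icc a t, (γ s, s) ∈ box T := fun s hs =>
    ⟨(hγ s hs).1, ha.1.trans hs.1, hs.2.trans ht.2⟩
  have cγ : ContinuousOn γ (Icc a t) := fun s hs => (hγ s hs).2.continuousWithinAt
  have cf : ContinuousOn (fun s => q (γ s) s) (Icc a t) :=
    cq.comp (f := fun s => (γ s, s)) (cγ.prodMk continuousOn_id) hIcc
  have cB : ContinuousOn (fun s => K * weight μ ν e (γ s) s) (Icc a t) :=
    continuousOn_const.mul ((continuous_weight (μ := μ) (ν := ν) (e := e)).comp_continuousOn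
      (f := fun s => (γ s, s)) (cγ.prodMk continuousOn_id))
  have hstart : |q (γ a) a| < K * weight μ ν e (γ a) a := by
    rcases hend with h | h
    · rw [h]; exact hinit _ (h ▸ (hγ a ⟨le_rfl, ha.2⟩).1)
    · rw [h]; exact hbdry a ⟨ha.1, ha.2.trans ht.2⟩
  rcases ha.2.eq_or_lt with hat | hat
  · rw [← hat]; exact hstart.le
  -- start slightly later, where the characteristic is inside the open strip
  obtain ⟨a', ha', hle⟩ : ∃ a' ∈ Ioo a t, |q (γ a') a'| ≤ K * weight μ ν e (γ a') a' := by
    have h1 : ∀ᶠ s in 𝓝[Ioo a t] a, |q (γ s) s| < K * weight μ ν e (γ s) s := by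
      have ha_mem : a ∈ Icc a t := left_mem_Icc.2 hat.le
      have h2 := (cf a ha_mem).abs.eventually_lt (cB a ha_mem) hstart
      exact h2.filter_mono (nhdsWithin_mono _ Ioo_subset_Icc_self)
    have : (𝓝[Ioo a t] a).NeBot := left_nhdsWithin_Ioo_neBot hat
    obtain ⟨s, h3, h4⟩ := (h1.and self_mem_nhdsWithin).exists
    exact ⟨s, h4, h3.le⟩
  have hsub : Icc a' t ⊆ Icc a t := Icc_subset_Icc_left ha'.1.le
  have hIoo : ∀ s ∈ Ico a' t, s ∈ Ioo a t := fun s hs => ⟨ha'.1.trans_le hs.1, hs.2⟩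
  refine image_norm_le_of_norm_deriv_right_lt_deriv_boundary' (f := fun s => q (γ s) s)
    (f' := fun s => G (γ s) s) (B := fun s => K * weight μ ν e (γ s) s)
    (B' := fun s => K * weight μ ν e (γ s) s * (μ - ν * ((1 - 2 * e) * l (γ s) s)))
    (cf.mono hsub) (fun s hs => ?_) hle (cB.mono hsub) (fun s hs => ?_) (fun s hs heq => ?_)
    (right_mem_Icc.2 ha'.2.le)
  · exact (hq γ a t ha.1 ht.2 hγ s (hIoo s hs) (hint s (hIoo s hs))).hasDerivWithinAt
  · have hs' := hIoo s hs
    have h1 : HasDerivAt γ (l (γ s) s) s :=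
      (hγ s (Ioo_subset_Icc_self hs')).2.hasDerivAt (Icc_mem_nhds hs'.1 hs'.2)
    have h2 : HasDerivAt (fun s => μ * s - ν * (e + (1 - 2 * e) * γ s))
        (μ - ν * ((1 - 2 * e) * l (γ s) s)) s := by
      have := ((hasDerivAt_id s).const_mul μ).sub
        (((h1.const_mul (1 - 2 * e)).const_add e).const_mul ν)
      exact this.congr_deriv (by ring)
    exact ((h2.exp.const_mul K).congr_deriv (by rw [weight]; ring)).hasDerivWithinAt
  · have hs' := hIoo s hs
    refine (hsrc _ (hint s hs') s ⟨ha.1.trans_lt hs'.1, hs'.2.trans_le ht.2⟩ heq).trans_le ?_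
    rw [mul_comm]
    have h1 := hΛ _ (hIcc s (Ioo_subset_Icc_self hs'))
    have h2 := weight_pos (μ := μ) (ν := ν) (e := e) (γ s) s
    gcongr

lemma hasCharDeriv_of_hasFDerivAt {l u p r : ℝ → ℝ → ℝ}
    (hu : ∀ x ∈ Ioo (0 : ℝ) 1, ∀ t ∈ Ioo (0 : ℝ) T,
      HasFDerivAt (fun q : ℝ × ℝ => u q.1 q.2) (grad (p x t) (r x t)) (x, t)) :
    HasCharDeriv T l u fun x t => r x t + l x t * p x t := by
  intro γ a b ha hb hγ s hs hγs
  have h1 : HasDerivAt γ (l (γ s) s) s :=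
    (hγ s (Ioo_subset_Icc_self hs)).2.hasDerivAt (Icc_mem_nhds hs.1 hs.2)
  have h2 := (hu _ hγs s ⟨ha.trans_lt hs.1, hs.2.trans_le hb⟩).comp_hasDerivAt
    (f := fun s => (γ s, s)) s (h1.prodMk (hasDerivAt_id s))
  refine h2.congr_deriv ?_
  simp only [grad_apply]; ring

lemma HasCharDeriv.sub {l q q' G G' : ℝ → ℝ → ℝ} (h : HasCharDeriv T l q G)
    (h' : HasCharDeriv T l q' G') :
    HasCharDeriv T l (fun x t => q x t - q' x t) fun x t => G x t - G' x t :=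
  fun γ a b ha hb hγ s hs hγs => (h γ a b ha hb hγ s hs hγs).sub (h' γ a b ha hb hγ s hs hγs)

end Weight

/-! ### The system on a box and the contraction estimate -/

/-- The side from which the `i`-th characteristics enter: `x = 1` for the first `k` components,
`x = 0` for the others. -/
def entry (k : ℕ) {n : ℕ} (i : Fin n) : ℝ := if (i : ℕ) < k then 1 else 0

lemma entry_eq (k : ℕ) {n : ℕ} (i : Fin n) : entry k i = 0 ∨ entry k i = 1 := by
  unfold entry; split_ifs <;> simp

lemma entry_mem (k : ℕ) {n : ℕ} (i : Fin n) : entry k i ∈ Icc (0 : ℝ) 1 := by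
  rcases entry_eq k i with h | h <;> simp [h]

lemma splice_eq {n : ℕ} (k : ℕ) (u : ℝ → Fin n → ℝ) (i : Fin n) :
    splice k (u 0) (u 1) i = u (1 - entry k i) i := by
  unfold splice entry; split_ifs <;> simp

lemma outgoing_apply {n : ℕ} (k : ℕ) (u : ℝ → ℝ → Fin n → ℝ) (t : ℝ) (i : Fin n) :
    outgoing k u t i = u (1 - entry k i) t i :=
  splice_eq k (fun x => u x t) i

/-- The initial-boundary value problem on the box `[0,1] × [0,T]` with all the quantitative
information that the construction uses. The derivatives of `f` and `h` enter only through the chain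
rule, so they are given as functions `fx`, `fu`, `ht`, `hv` together with that rule. The time
derivative at `t = 0` that the system prescribes is `d`. The constants are bounds: `c ≤ |lam| ≤ Λ`,
`|lamx| ≤ a`, `‖fu‖ ≤ Cf`, `‖hv‖ ≤ H`. -/
structure BoxSystem (n k : ℕ) where
  T : ℝ
  lam : Fin n → ℝ → ℝ → ℝ
  lamx : Fin n → ℝ → ℝ → ℝ
  f : ℝ → ℝ → (Fin n → ℝ) → Fin n → ℝ
  fx : ℝ → ℝ → (Fin n → ℝ) → Fin n → ℝ
  fu : ℝ → ℝ → (Fin n → ℝ) → (Fin n → ℝ) →L[ℝ] (Fin n → ℝ)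
  h : ℝ → (Fin n → ℝ) → Fin n → ℝ
  ht : ℝ → (Fin n → ℝ) → Fin n → ℝ
  hv : ℝ → (Fin n → ℝ) → (Fin n → ℝ) →L[ℝ] (Fin n → ℝ)
  φ : ℝ → Fin n → ℝ
  φ' : ℝ → Fin n → ℝ
  d : ℝ → Fin n → ℝ
  c : ℝ
  Λ : ℝ
  a : ℝ
  Cf : ℝ
  H : ℝ
  T_pos : 0 < T
  c_pos : 0 < c
  a_nonneg : 0 ≤ a
  Cf_nonneg : 0 ≤ Cf
  H_nonneg : 0 ≤ H
  lam_c1 : ∀ i, IsC1X T (lam i) (lamx i)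
  le_lam : ∀ i, ∀ q ∈ box T, c ≤ (1 - 2 * entry k i) * lam i q.1 q.2
  lam_le : ∀ i, ∀ q ∈ box T, (1 - 2 * entry k i) * lam i q.1 q.2 ≤ Λ
  lamx_le : ∀ i, ∀ q ∈ box T, |lamx i q.1 q.2| ≤ a
  chars : ∀ i, HasBackChars T (lam i) (entry k i)
  solvable : ∀ i, TransportSolvable T (lam i) (lamx i) (entry k i)
  f_cont : ContinuousOn (fun q : (ℝ × ℝ) × (Fin n → ℝ) => f q.1.1 q.1.2 q.2) (box T ×ˢ univ)
  fx_cont : ContinuousOn (fun q : (ℝ × ℝ) × (Fin n → ℝ) => fx q.1.1 q.1.2 q.2) (box T ×ˢ univ)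
  fu_cont : ContinuousOn (fun q : (ℝ × ℝ) × (Fin n → ℝ) => fu q.1.1 q.1.2 q.2) (box T ×ˢ univ)
  f_chain : ∀ (v : ℝ → Fin n → ℝ) (v' : Fin n → ℝ), ∀ x ∈ Icc (0 : ℝ) 1, ∀ t ∈ Icc (0 : ℝ) T,
    HasDerivWithinAt v v' (Icc 0 1) x → HasDerivWithinAt (fun x => f x t (v x))
      (fx x t (v x) + fu x t (v x) v') (Icc 0 1) x
  fu_le : ∀ q ∈ box T, ∀ y, ‖fu q.1 q.2 y‖ ≤ Cf
  f_lip : ∀ q ∈ box T, ∀ y y', ‖f q.1 q.2 y - f q.1 q.2 y'‖ ≤ Cf * ‖y - y'‖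
  h_cont : ContinuousOn (fun q : ℝ × (Fin n → ℝ) => h q.1 q.2) (Icc 0 T ×ˢ univ)
  ht_cont : ContinuousOn (fun q : ℝ × (Fin n → ℝ) => ht q.1 q.2) (Icc 0 T ×ˢ univ)
  hv_cont : ContinuousOn (fun q : ℝ × (Fin n → ℝ) => hv q.1 q.2) (Icc 0 T ×ˢ univ)
  h_chain : ∀ (v : ℝ → Fin n → ℝ) (v' : Fin n → ℝ), ∀ t ∈ Icc (0 : ℝ) T,
    HasDerivWithinAt v v' (Icc 0 T) t → HasDerivWithinAt (fun t => h t (v t))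
      (ht t (v t) + hv t (v t) v') (Icc 0 T) t
  hv_le : ∀ t ∈ Icc (0 : ℝ) T, ∀ z, ‖hv t z‖ ≤ H
  h_lip : ∀ t ∈ Icc (0 : ℝ) T, ∀ z z', ‖h t z - h t z'‖ ≤ H * ‖z - z'‖
  hasDeriv_φ : ∀ x ∈ Icc (0 : ℝ) 1, HasDerivWithinAt φ (φ' x) (Icc 0 1) x
  cont_φ' : ContinuousOn φ' (Icc 0 1)
  d_eq : ∀ x ∈ Icc (0 : ℝ) 1, ∀ i, d x i = f x 0 (φ x) i - lam i x 0 * φ' x i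
  compat0 : ∀ i, φ (entry k i) i = h 0 (splice k (φ 0) (φ 1)) i
  compat1 : ∀ i, d (entry k i) i = ht 0 (splice k (φ 0) (φ 1)) i +
    hv 0 (splice k (φ 0) (φ 1)) (splice k (d 0) (d 1)) i

namespace BoxSystem

variable {n k : ℕ} (S : BoxSystem n k)

/-- The exponential `exp ν` of the decay rate `ν` of the weight: so large that the boundary
operators, which read outgoing values and prescribe incoming ones, become contractions, that is,
`H exp (-ν) ≤ 1/4` for `u` and `H Λ exp (-ν) ≤ c/4` for `∂ₓu`, whose values at the entry and at the
exit are related to time derivatives by factors `1/λ` and `λ`. -/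
noncomputable def expν : ℝ := 1 + 4 * S.H + 4 * (S.H * S.Λ / S.c)

/-- The decay rate of the weight between the entry and the exit. -/
noncomputable def ν : ℝ := Real.log S.expν

/-- The growth rate of the weight: so large that the sources become small. -/
noncomputable def μ : ℝ := S.ν * S.Λ + S.a + S.expν * (1 + 2 * S.Cf) + 1

/-- The weight of the `i`-th component. -/
noncomputable def wt (i : Fin n) (x t : ℝ) : ℝ := weight S.μ S.ν (entry k i) x t

/-- `a` and `b` differ by at most `K` in the weighted supremum norm. -/
def Near (K : ℝ) (a b : ℝ → ℝ → Fin n → ℝ) : Prop :=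
  ∀ i, ∀ x ∈ Icc (0 : ℝ) 1, ∀ t ∈ Icc (0 : ℝ) S.T, |a x t i - b x t i| ≤ K * S.wt i x t

lemma zero_mem_time : (0 : ℝ) ∈ Icc (0 : ℝ) S.T := ⟨le_rfl, S.T_pos.le⟩

include S in
lemma Λ_nonneg (i : Fin n) : 0 ≤ S.Λ :=
  have h : ((0 : ℝ), (0 : ℝ)) ∈ box S.T := ⟨⟨le_rfl, zero_le_one⟩, S.zero_mem_time⟩
  S.c_pos.le.trans ((S.le_lam i _ h).trans (S.lam_le i _ h))

lemma abs_lam_le (i : Fin n) {q : ℝ × ℝ} (hq : q ∈ box S.T) : |S.lam i q.1 q.2| ≤ S.Λ := by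
  have h1 := S.le_lam i q hq
  have h2 := S.lam_le i q hq
  have h3 := S.c_pos
  rw [abs_le]
  rcases entry_eq k i with h | h <;> rw [h] at h1 h2 <;> constructor <;> linarith

lemma le_abs_lam (i : Fin n) {q : ℝ × ℝ} (hq : q ∈ box S.T) : S.c ≤ |S.lam i q.1 q.2| := by
  have h1 := S.le_lam i q hq
  rw [le_abs]
  rcases entry_eq k i with h | h <;> rw [h] at h1
  · left; linarith
  · right; linarith

lemma one_le_expν (i : Fin n) : 1 ≤ S.expν := by
  have h1 := S.H_nonneg
  have h2 := S.c_pos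
  have h3 := S.Λ_nonneg i
  have : 0 ≤ S.H * S.Λ / S.c := by positivity
  unfold expν; linarith

lemma exp_ν (i : Fin n) : Real.exp S.ν = S.expν :=
  Real.exp_log (zero_lt_one.trans_le (S.one_le_expν i))

lemma ν_nonneg (i : Fin n) : 0 ≤ S.ν := Real.log_nonneg (S.one_le_expν i)

lemma μ_nonneg (i : Fin n) : 0 ≤ S.μ := by
  have := S.ν_nonneg i
  have := S.Λ_nonneg i
  have := S.a_nonneg
  have := S.Cf_nonneg
  have := S.one_le_expν i
  unfold μ; positivity

lemma H_mul_le (i : Fin n) : S.H * Real.exp (-S.ν) ≤ 1 / 4 := by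
  have h0 := S.one_le_expν i
  have h1 := S.Λ_nonneg i
  have h2 := S.c_pos
  have h3 := S.H_nonneg
  have h4 : 0 ≤ S.H * S.Λ / S.c := by positivity
  rw [Real.exp_neg, S.exp_ν i, ← div_eq_mul_inv, div_le_iff₀ (by linarith)]
  unfold expν; linarith

lemma HΛ_mul_le (i : Fin n) : S.H * S.Λ * Real.exp (-S.ν) ≤ S.c / 4 := by
  have h0 := S.one_le_expν i
  have h1 := S.Λ_nonneg i
  have h2 := S.c_pos
  have h3 := S.H_nonneg
  rw [Real.exp_neg, S.exp_ν i, ← div_eq_mul_inv, div_le_iff₀ (by linarith)]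
  have h4 : S.c * (S.H * S.Λ / S.c) = S.H * S.Λ := by field_simp
  have h5 : 0 ≤ S.c * S.H := by positivity
  unfold expν; nlinarith

lemma one_le_exp (i : Fin n) {t : ℝ} (ht : 0 ≤ t) : 1 ≤ Real.exp (S.μ * t) :=
  Real.one_le_exp (mul_nonneg (S.μ_nonneg i) ht)

variable {S}

lemma wt_pos (i : Fin n) (x t : ℝ) : 0 < S.wt i x t := weight_pos _ _

lemma wt_le (i : Fin n) {x : ℝ} (hx : x ∈ Icc (0 : ℝ) 1) (t : ℝ) :
    S.wt i x t ≤ Real.exp (S.μ * t) :=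
  weight_le (entry_eq k i) (S.ν_nonneg i) hx t

lemma exp_le_wt (i : Fin n) {x : ℝ} (hx : x ∈ Icc (0 : ℝ) 1) (t : ℝ) :
    Real.exp (S.μ * t) ≤ S.expν * S.wt i x t := by
  rw [← S.exp_ν i]; exact exp_le_weight (entry_eq k i) (S.ν_nonneg i) hx t

namespace Near

variable {K : ℝ} {a b : ℝ → ℝ → Fin n → ℝ}

lemma mono {K' : ℝ} (h : S.Near K a b) (hK : K ≤ K') : S.Near K' a b := fun i x hx t ht =>
  (h i x hx t ht).trans (mul_le_mul_of_nonneg_right hK (wt_pos i x t).le)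

lemma symm (h : S.Near K a b) : S.Near K b a := fun i x hx t ht => by
  rw [abs_sub_comm]; exact h i x hx t ht

lemma trans {K' : ℝ} {c : ℝ → ℝ → Fin n → ℝ} (h : S.Near K a b) (h' : S.Near K' b c) :
    S.Near (K + K') a c := fun i x hx t ht => by
  have h1 := h i x hx t ht
  have h2 := h' i x hx t ht
  have h3 := abs_sub_le (a x t i) (b x t i) (c x t i)
  rw [add_mul]; linarith

lemma norm_le (h : S.Near K a b) (hK : 0 ≤ K) {x t : ℝ} (hx : x ∈ Icc (0 : ℝ) 1)
    (ht : t ∈ Icc (0 : ℝ) S.T) : ‖a x t - b x t‖ ≤ K * Real.exp (S.μ * t) := by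
  rw [pi_norm_le_iff_of_nonneg (by positivity)]
  intro i
  exact (h i x hx t ht).trans (mul_le_mul_of_nonneg_left (wt_le i hx t) hK)

lemma abs_exit_le (h : S.Near K a b) {t : ℝ} (ht : t ∈ Icc (0 : ℝ) S.T) (i : Fin n) :
    |a (1 - entry k i) t i - b (1 - entry k i) t i| ≤
      K * (Real.exp (-S.ν) * Real.exp (S.μ * t)) := by
  have := h i _ (one_sub_mem (entry_mem k i)) t ht
  rwa [wt, weight_exit (entry_eq k i)] at this

lemma norm_outgoing_le (h : S.Near K a b) (hK : 0 ≤ K) {t : ℝ} (ht : t ∈ Icc (0 : ℝ) S.T) :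
    ‖outgoing k a t - outgoing k b t‖ ≤ K * (Real.exp (-S.ν) * Real.exp (S.μ * t)) := by
  rw [pi_norm_le_iff_of_nonneg (by positivity)]
  intro i
  rw [Pi.sub_apply, outgoing_apply, outgoing_apply]
  exact h.abs_exit_le ht i

end Near

/-- The comparison principle with the constants of the system. -/
lemma near_zero_of_bounds {K : ℝ} (hK : 0 < K) {q G : ℝ → ℝ → Fin n → ℝ}
    (cq : ∀ i, ContinuousOn (fun p : ℝ × ℝ => q p.1 p.2 i) (box S.T))
    (hq : ∀ i, HasCharDeriv S.T (S.lam i) (fun x t => q x t i) fun x t => G x t i)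
    (hinit : ∀ i, ∀ x ∈ Icc (0 : ℝ) 1, |q x 0 i| * S.expν < K)
    (hbdry : ∀ i, ∀ t ∈ Icc (0 : ℝ) S.T, |q (entry k i) t i| < K * Real.exp (S.μ * t))
    (hsrc : ∀ i, ∀ x ∈ Icc (0 : ℝ) 1, ∀ t ∈ Icc (0 : ℝ) S.T,
      |G x t i| ≤ (1 + 2 * S.Cf) * K * Real.exp (S.μ * t) + S.a * |q x t i|) :
    S.Near K q 0 := by
  intro i x hx t ht
  simp only [Pi.zero_apply, sub_zero]
  refine abs_le_weight (q := fun x t => q x t i) (S.chars i) (S.lam_le i) (S.ν_nonneg i) hK (cq i)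
    (hq i) (fun x hx => ?_) (fun t ht => ?_) (fun x hx t ht heq => ?_) x hx t ht
  · have h0 := S.one_le_expν i
    have h1 := hinit i x hx
    have h2 := exp_le_wt (S := S) i hx 0
    rw [mul_zero, Real.exp_zero] at h2
    have h3 : S.expν * |q x 0 i| < S.expν * (K * S.wt i x 0) := by
      calc S.expν * |q x 0 i| < K * 1 := by rw [mul_comm, mul_one]; exact h1
        _ ≤ K * (S.expν * S.wt i x 0) := by gcongr
        _ = _ := by ring
    exact lt_of_mul_lt_mul_left h3 (by linarith)
  · rw [weight_entry (entry_eq k i)]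
    exact hbdry i t ht
  · have hx' := Ioo_subset_Icc_self hx
    have h1 := hsrc i x hx' t (Ioo_subset_Icc_self ht)
    have h2 := exp_le_wt (S := S) i hx' t
    have h3 : 0 < K * S.wt i x t := mul_pos hK (wt_pos i x t)
    have h4 := S.Cf_nonneg
    simp only [heq] at h1
    change |G x t i| < (S.μ - S.ν * S.Λ) * (K * S.wt i x t)
    change |G x t i| ≤ _ + S.a * (K * S.wt i x t) at h1
    have h5 : (1 + 2 * S.Cf) * K * Real.exp (S.μ * t) ≤
        (1 + 2 * S.Cf) * K * (S.expν * S.wt i x t) := by gcongr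
    have h6 : (S.μ - S.ν * S.Λ) * (K * S.wt i x t) = S.a * (K * S.wt i x t) +
        (1 + 2 * S.Cf) * K * (S.expν * S.wt i x t) + K * S.wt i x t := by
      unfold μ; ring
    rw [h6]; linarith

/-- `u` solves the linear transport problems with source `f(·, v)` and boundary values
`h(·, v)`, in the sense of characteristics. -/
structure IsImage (S : BoxSystem n k) (v u : ℝ → ℝ → Fin n → ℝ) : Prop where
  cont : ∀ i, ContinuousOn (fun p : ℝ × ℝ => u p.1 p.2 i) (box S.T)
  charDeriv : ∀ i, HasCharDeriv S.T (S.lam i) (fun x t => u x t i) fun x t => S.f x t (v x t) i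
  init : ∀ x ∈ Icc (0 : ℝ) 1, u x 0 = S.φ x
  bdry : ∀ i, ∀ t ∈ Icc (0 : ℝ) S.T, u (entry k i) t i = S.h t (outgoing k v t) i

/-- The solution operator of the linear problems halves the weighted distance. -/
lemma IsImage.near {v v' u u' : ℝ → ℝ → Fin n → ℝ} (h : S.IsImage v u) (h' : S.IsImage v' u')
    {M : ℝ} (hM : 0 < M) (hv : S.Near M v v') : S.Near (M / 2) u u' := by
  have key : S.Near (M / 2) (fun x t i => u x t i - u' x t i) 0 := by
    refine near_zero_of_bounds (by positivity)
      (G := fun x t i => S.f x t (v x t) i - S.f x t (v' x t) i)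
      (fun i => (h.cont i).sub (h'.cont i)) (fun i => (h.charDeriv i).sub (h'.charDeriv i))
      (fun i x hx => ?_) (fun i t ht => ?_) (fun i x hx t ht => ?_)
    · simp only [h.init x hx, h'.init x hx, sub_self, abs_zero, zero_mul]; positivity
    · rw [h.bdry i t ht, h'.bdry i t ht]
      have h1 := (norm_le_pi_norm _ i).trans
        (S.h_lip t ht (outgoing k v t) (outgoing k v' t))
      have h2 := hv.norm_outgoing_le hM.le ht
      have h3 := S.H_mul_le i
      have h4 := Real.exp_pos (S.μ * t)
      rw [Pi.sub_apply, Real.norm_eq_abs] at h1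
      calc _ ≤ S.H * ‖outgoing k v t - outgoing k v' t‖ := h1
        _ ≤ S.H * (M * (Real.exp (-S.ν) * Real.exp (S.μ * t))) :=
          mul_le_mul_of_nonneg_left h2 S.H_nonneg
        _ = (S.H * Real.exp (-S.ν)) * (M * Real.exp (S.μ * t)) := by ring
        _ ≤ 1 / 4 * (M * Real.exp (S.μ * t)) := by gcongr
        _ < M / 2 * Real.exp (S.μ * t) := by
          have := mul_pos hM h4
          linarith
    · have h1 := (norm_le_pi_norm _ i).trans (S.f_lip (x, t) ⟨hx, ht⟩ (v x t) (v' x t))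
      have h2 := hv.norm_le hM.le hx ht
      have h3 := S.Cf_nonneg
      have h4 := S.a_nonneg
      rw [Pi.sub_apply, Real.norm_eq_abs] at h1
      have h5 : S.Cf * ‖v x t - v' x t‖ ≤ S.Cf * (M * Real.exp (S.μ * t)) := by gcongr
      have h6 : 0 ≤ M * Real.exp (S.μ * t) := by positivity
      have h7 : 0 ≤ S.a * |u x t i - u' x t i| := by positivity
      have h8 : (1 + 2 * S.Cf) * (M / 2) * Real.exp (S.μ * t) =
          S.Cf * (M * Real.exp (S.μ * t)) + (M * Real.exp (S.μ * t)) / 2 := by ring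
      linarith
  intro i x hx t ht
  simpa using key i x hx t ht

lemma Near.of_bound {a b : ℝ → ℝ → Fin n → ℝ} {N : ℝ} (hN : 0 ≤ N)
    (h : ∀ i, ∀ x ∈ Icc (0 : ℝ) 1, ∀ t ∈ Icc (0 : ℝ) S.T, |a x t i - b x t i| ≤ N) :
    S.Near (N * S.expν) a b := fun i x hx t ht => by
  have h1 := exp_le_wt (S := S) i hx t
  have h2 := S.one_le_exp i ht.1
  calc _ ≤ N * 1 := by rw [mul_one]; exact h i x hx t ht
    _ ≤ N * (S.expν * S.wt i x t) := by gcongr; exact h2.trans h1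
    _ = _ := by ring

lemma exists_near {a b : ℝ → ℝ → Fin n → ℝ}
    (ha : ∀ i, ContinuousOn (fun p : ℝ × ℝ => a p.1 p.2 i) (box S.T))
    (hb : ∀ i, ContinuousOn (fun p : ℝ × ℝ => b p.1 p.2 i) (box S.T)) :
    ∃ M, 0 < M ∧ S.Near M a b := by
  have h1 : ContinuousOn (fun p : ℝ × ℝ => a p.1 p.2 - b p.1 p.2) (box S.T) :=
    continuousOn_pi.2 fun i => (ha i).sub (hb i)
  obtain ⟨N, hN⟩ := (isCompact_box S.T).exists_bound_of_continuousOn h1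
  have h2 : S.Near (|N| * S.expν) a b := Near.of_bound (abs_nonneg N) fun i x hx t ht =>
    ((norm_le_pi_norm _ i).trans (hN (x, t) ⟨hx, ht⟩)).trans (le_abs_self N)
  exact ⟨max 1 (|N| * S.expν), by positivity, h2.mono (le_max_right _ _)⟩

/-- Fixed points of the solution operator are unique. -/
lemma IsImage.eq {u u' : ℝ → ℝ → Fin n → ℝ} (h : S.IsImage u u) (h' : S.IsImage u' u') :
    ∀ q ∈ box S.T, u q.1 q.2 = u' q.1 q.2 := by
  obtain ⟨M, hM, hnear⟩ := exists_near (S := S) h.cont h'.cont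
  have hj : ∀ j : ℕ, S.Near (M / 2 ^ j) u u' := by
    intro j
    induction j with
    | zero => simpa using hnear
    | succ j ih => simpa [pow_succ, div_div] using h.near h' (by positivity) ih
  intro q hq
  ext i
  have hlim : Tendsto (fun j : ℕ => M / 2 ^ j * S.wt i q.1 q.2) atTop (𝓝 0) := by
    have := ((tendsto_pow_atTop_nhds_zero_of_lt_one (by norm_num : (0 : ℝ) ≤ 1 / 2)
      (by norm_num)).const_mul M).mul_const (S.wt i q.1 q.2)
    simpa [div_eq_mul_inv] using this
  have h0 := ge_of_tendsto' hlim fun j => hj j i q.1 hq.1 q.2 hq.2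
  exact sub_eq_zero.1 (abs_nonpos_iff.1 h0)

end BoxSystem

/-! ### The iteration -/

/-- An approximation `u` of the solution together with its partial derivatives `p = ∂ₓu` and
`r = ∂ₜu`. -/
structure Iterate (n : ℕ) where
  u : ℝ → ℝ → Fin n → ℝ
  p : ℝ → ℝ → Fin n → ℝ
  r : ℝ → ℝ → Fin n → ℝ

namespace BoxSystem

variable {n k : ℕ} (S : BoxSystem n k)

/-- `A.u` is `C¹` on the box with derivatives `A.p`, `A.r`, has the initial values `φ`, and its
outgoing values have the time derivative at `t = 0` that the system prescribes. -/
structure IsAdmissible (A : Iterate n) : Prop where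
  hasFDeriv : ∀ i, ∀ q ∈ box S.T, HasFDerivWithinAt (fun q : ℝ × ℝ => A.u q.1 q.2 i)
    (grad (A.p q.1 q.2 i) (A.r q.1 q.2 i)) (box S.T) q
  cont_p : ContinuousOn (fun q : ℝ × ℝ => A.p q.1 q.2) (box S.T)
  cont_r : ContinuousOn (fun q : ℝ × ℝ => A.r q.1 q.2) (box S.T)
  init : ∀ x ∈ Icc (0 : ℝ) 1, A.u x 0 = S.φ x
  init_r : ∀ i, A.r (1 - entry k i) 0 i = S.d (1 - entry k i) i

/-- `B` arises from `A` by solving the linear transport problems with source `f(·, A.u)` and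
boundary values `h(·, A.u)`. -/
structure IsStep (A B : Iterate n) : Prop where
  adm : S.IsAdmissible B
  init_p : ∀ x ∈ Icc (0 : ℝ) 1, B.p x 0 = S.φ' x
  r_eq : ∀ i, ∀ x ∈ Icc (0 : ℝ) 1, ∀ t ∈ Icc (0 : ℝ) S.T,
    B.r x t i = S.f x t (A.u x t) i - S.lam i x t * B.p x t i
  bdry : ∀ i, ∀ t ∈ Icc (0 : ℝ) S.T, B.u (entry k i) t i = S.h t (outgoing k A.u t) i
  bdry_r : ∀ i, ∀ t ∈ Icc (0 : ℝ) S.T, B.r (entry k i) t i =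
    S.ht t (outgoing k A.u t) i + S.hv t (outgoing k A.u t) (outgoing k A.r t) i
  charDeriv : ∀ i, HasCharDeriv S.T (S.lam i) (fun x t => B.p x t i) fun x t =>
    S.fx x t (A.u x t) i + S.fu x t (A.u x t) (A.p x t) i - S.lamx i x t * B.p x t i

variable {S}

namespace IsAdmissible

variable {A : Iterate n} (hA : S.IsAdmissible A)
include hA

lemma hasDeriv_x (i : Fin n) {x t : ℝ} (hx : x ∈ Icc (0 : ℝ) 1) (ht : t ∈ Icc (0 : ℝ) S.T) :
    HasDerivWithinAt (fun x => A.u x t i) (A.p x t i) (Icc 0 1) x := by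
  have h2 : HasDerivWithinAt (fun x : ℝ => (x, t)) (1, 0) (Icc 0 1) x :=
    ((hasDerivAt_id x).prodMk (hasDerivAt_const x t)).hasDerivWithinAt
  exact ((hA.hasFDeriv i (x, t) ⟨hx, ht⟩).comp_hasDerivWithinAt (f := fun x : ℝ => (x, t)) x h2
    fun y hy => ⟨hy, ht⟩).congr_deriv (by simp)

lemma hasDeriv_t (i : Fin n) {x t : ℝ} (hx : x ∈ Icc (0 : ℝ) 1) (ht : t ∈ Icc (0 : ℝ) S.T) :
    HasDerivWithinAt (fun t => A.u x t i) (A.r x t i) (Icc 0 S.T) t := by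
  have h2 : HasDerivWithinAt (fun t : ℝ => (x, t)) (0, 1) (Icc 0 S.T) t :=
    ((hasDerivAt_const t x).prodMk (hasDerivAt_id t)).hasDerivWithinAt
  exact ((hA.hasFDeriv i (x, t) ⟨hx, ht⟩).comp_hasDerivWithinAt (f := fun t : ℝ => (x, t)) t h2
    fun y hy => ⟨hx, hy⟩).congr_deriv (by simp)

lemma cont_u : ContinuousOn (fun q : ℝ × ℝ => A.u q.1 q.2) (box S.T) :=
  continuousOn_pi.2 fun i q hq => (hA.hasFDeriv i q hq).continuousWithinAt

lemma hasDeriv_outgoing {t : ℝ} (ht : t ∈ Icc (0 : ℝ) S.T) :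
    HasDerivWithinAt (outgoing k A.u) (outgoing k A.r t) (Icc 0 S.T) t := by
  rw [hasDerivWithinAt_pi]
  intro i
  simp only [outgoing_apply]
  exact hA.hasDeriv_t i (one_sub_mem (entry_mem k i)) ht

lemma outgoing_u_zero : outgoing k A.u 0 = splice k (S.φ 0) (S.φ 1) := by
  rw [outgoing, hA.init 0 ⟨le_rfl, zero_le_one⟩, hA.init 1 ⟨zero_le_one, le_rfl⟩]

lemma outgoing_r_zero : outgoing k A.r 0 = splice k (S.d 0) (S.d 1) := by
  ext i
  rw [outgoing_apply, hA.init_r, splice_eq]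

end IsAdmissible

lemma continuousOn_outgoing {u : ℝ → ℝ → Fin n → ℝ}
    (hu : ContinuousOn (fun q : ℝ × ℝ => u q.1 q.2) (box S.T)) :
    ContinuousOn (outgoing k u) (Icc 0 S.T) := by
  refine continuousOn_pi.2 fun i => ?_
  simp only [outgoing_apply]
  exact (continuousOn_pi.1 hu i).comp (f := fun t : ℝ => (1 - entry k i, t)) (by fun_prop)
    fun t ht => ⟨one_sub_mem (entry_mem k i), ht⟩

lemma continuousOn_comp_prodMk {P E F : Type*} [TopologicalSpace P] [TopologicalSpace E] [TopologicalSpace F]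
    {K : Set P} {g : P → E → F} (hg : ContinuousOn (fun q : P × E => g q.1 q.2) (K ×ˢ univ))
    {v : P → E} (hv : ContinuousOn v K) : ContinuousOn (fun x => g x (v x)) K :=
  hg.comp (f := fun x => (x, v x)) (continuousOn_id.prodMk hv) fun _ hx => ⟨hx, trivial⟩

/-- The linear problems are solvable, since the compatibility conditions for their data are those of
the original problem: they involve only the initial values of `A.u` and the values `d` of the time
derivatives of its outgoing components, and both are inherited by the solution. -/
lemma exists_step {A : Iterate n} (hA : S.IsAdmissible A) : ∃ B, S.IsStep A B := by
  have h0 := S.zero_mem_time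
  have h01 : (0 : ℝ) ∈ Icc (0 : ℝ) 1 := ⟨le_rfl, zero_le_one⟩
  have cu := hA.cont_u
  have co := continuousOn_outgoing (S := S) cu
  have cor := continuousOn_outgoing (S := S) hA.cont_r
  have cF := continuousOn_comp_prodMk (g := fun (q : ℝ × ℝ) y => S.f q.1 q.2 y) S.f_cont cu
  have cFx : ContinuousOn (fun q : ℝ × ℝ => S.fx q.1 q.2 (A.u q.1 q.2) +
      S.fu q.1 q.2 (A.u q.1 q.2) (A.p q.1 q.2)) (box S.T) :=
    (continuousOn_comp_prodMk (g := fun (q : ℝ × ℝ) y => S.fx q.1 q.2 y) S.fx_cont cu).add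
      ((continuousOn_comp_prodMk (g := fun (q : ℝ × ℝ) y => S.fu q.1 q.2 y) S.fu_cont cu).clm_apply hA.cont_p)
  have cb : ContinuousOn (fun t => S.ht t (outgoing k A.u t) +
      S.hv t (outgoing k A.u t) (outgoing k A.r t)) (Icc 0 S.T) :=
    (continuousOn_comp_prodMk (g := S.ht) S.ht_cont co).add
      ((continuousOn_comp_prodMk (g := S.hv) S.hv_cont co).clm_apply cor)
  have hb : ∀ t ∈ Icc (0 : ℝ) S.T, HasDerivWithinAt (fun t => S.h t (outgoing k A.u t))
      (S.ht t (outgoing k A.u t) + S.hv t (outgoing k A.u t) (outgoing k A.r t))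
      (Icc 0 S.T) t := fun t ht => S.h_chain _ _ t ht (hA.hasDeriv_outgoing ht)
  have hF : ∀ x ∈ Icc (0 : ℝ) 1, ∀ t ∈ Icc (0 : ℝ) S.T,
      HasDerivWithinAt (fun x => S.f x t (A.u x t))
        (S.fx x t (A.u x t) + S.fu x t (A.u x t) (A.p x t)) (Icc 0 1) x := fun x hx t ht =>
    S.f_chain (fun x => A.u x t) (A.p x t) x hx t ht
      (hasDerivWithinAt_pi.2 fun i => hA.hasDeriv_x i hx ht)
  have hsolve := fun i => S.solvable i (fun x t => S.f x t (A.u x t) i)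
    (fun x t => (S.fx x t (A.u x t) + S.fu x t (A.u x t) (A.p x t)) i)
    (fun x => S.φ x i) (fun x => S.φ' x i) (fun t => S.h t (outgoing k A.u t) i)
    (fun t => (S.ht t (outgoing k A.u t) + S.hv t (outgoing k A.u t) (outgoing k A.r t)) i)
    ⟨continuousOn_pi.1 cF i, continuousOn_pi.1 cFx i,
      fun x hx t ht => hasDerivWithinAt_pi.1 (hF x hx t ht) i⟩
    (fun x hx => hasDerivWithinAt_pi.1 (S.hasDeriv_φ x hx) i) (continuousOn_pi.1 S.cont_φ' i)
    (fun t ht => hasDerivWithinAt_pi.1 (hb t ht) i) (continuousOn_pi.1 cb i)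
    (by rw [hA.outgoing_u_zero]; exact S.compat0 i)
    (by
      rw [hA.init _ (entry_mem k i), hA.outgoing_u_zero, hA.outgoing_r_zero,
        ← S.d_eq _ (entry_mem k i) i]
      exact S.compat1 i)
  choose u p cp hu hu0 hub hp using hsolve
  set B : Iterate n := ⟨fun x t i => u i x t, fun x t i => p i x t,
    fun x t i => S.f x t (A.u x t) i - S.lam i x t * p i x t⟩ with hB
  -- the conditions on derivatives at `t = 0` and at the sides follow from those on values
  have hinit : ∀ x ∈ Icc (0 : ℝ) 1, B.u x 0 = S.φ x := fun x hx => funext fun i => hu0 i x hx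
  have hadm' : ∀ i, ∀ q ∈ box S.T, HasFDerivWithinAt (fun q : ℝ × ℝ => B.u q.1 q.2 i)
    (grad (B.p q.1 q.2 i) (B.r q.1 q.2 i)) (box S.T) q := fun i q hq => hu i q hq
  have hinit_p : ∀ x ∈ Icc (0 : ℝ) 1, B.p x 0 = S.φ' x := by
    intro x hx
    ext i
    have h2 : HasDerivWithinAt (fun x : ℝ => (x, (0 : ℝ))) (1, 0) (Icc 0 1) x :=
      ((hasDerivAt_id x).prodMk (hasDerivAt_const x (0 : ℝ))).hasDerivWithinAt
    have h3 := (hadm' i (x, 0) ⟨hx, h0⟩).comp_hasDerivWithinAt (f := fun x : ℝ => (x, (0 : ℝ))) x h2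
      fun y hy => ⟨hy, h0⟩
    have h4 := hasDerivWithinAt_pi.1 (S.hasDeriv_φ x hx) i
    have h5 := UniqueDiffWithinAt.eq_deriv _ (uniqueDiffOn_Icc zero_lt_one x hx)
      (h4.congr (fun y hy => congrFun (hinit y hy) i) (congrFun (hinit x hx) i)) h3
    simpa using h5.symm
  have hadm : S.IsAdmissible B := by
    refine ⟨hadm', continuousOn_pi.2 cp, continuousOn_pi.2 fun i =>
      (continuousOn_pi.1 cF i).sub ((S.lam_c1 i).cont.mul (cp i)), hinit, fun i => ?_⟩
    have hm := one_sub_mem (entry_mem k i)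
    have h6 := congrFun (hinit_p _ hm) i
    simp only [hB] at h6 ⊢
    rw [hA.init _ hm, h6, S.d_eq _ hm]
  refine ⟨B, hadm, hinit_p, fun i x _ t _ => rfl, fun i t ht => hub i t ht, fun i t ht => ?_,
    fun i => hp i⟩
  have h4 := hasDerivWithinAt_pi.1 (hb t ht) i
  have h5 := UniqueDiffWithinAt.eq_deriv _ (uniqueDiffOn_Icc S.T_pos t ht)
    (h4.congr (fun y hy => hub i y hy) (hub i t ht)) (hadm.hasDeriv_t i (entry_mem k i) ht)
  exact h5.symm

/-- The first approximation: `φ` plus `t` times a function that has the prescribed time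
derivatives at the two corners. -/
lemma exists_admissible : ∃ A, S.IsAdmissible A := by
  refine ⟨⟨fun x t i => S.φ x i + t * ((1 - x) * S.d 0 i + x * S.d 1 i),
    fun x t i => S.φ' x i + t * (S.d 1 i - S.d 0 i),
    fun x t i => (1 - x) * S.d 0 i + x * S.d 1 i⟩, ?_, ?_, ?_, ?_, ?_⟩
  · intro i q hq
    have h1 : HasFDerivWithinAt (fun q : ℝ × ℝ => S.φ q.1 i)
        (S.φ' q.1 i • ContinuousLinearMap.fst ℝ ℝ ℝ) (box S.T) q := by
      have h2 := hasDerivWithinAt_pi.1 (S.hasDeriv_φ q.1 hq.1) i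
      exact h2.comp_hasFDerivWithinAt q hasFDerivAt_fst.hasFDerivWithinAt fun y hy => hy.1
    have hfst : HasFDerivAt (fun q : ℝ × ℝ => q.1) (ContinuousLinearMap.fst ℝ ℝ ℝ) q :=
      hasFDerivAt_fst
    have h2 : HasFDerivAt (fun q : ℝ × ℝ => q.2 * ((1 - q.1) * S.d 0 i + q.1 * S.d 1 i))
        (grad (q.2 * (S.d 1 i - S.d 0 i)) ((1 - q.1) * S.d 0 i + q.1 * S.d 1 i)) q := by
      have h3 : HasFDerivAt (fun q : ℝ × ℝ => (1 - q.1) * S.d 0 i + q.1 * S.d 1 i) _ q :=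
        ((hfst.const_sub 1).mul_const (S.d 0 i)).add
          (hfst.mul_const (S.d 1 i))
      refine (hasFDerivAt_snd.mul h3).congr_fderiv ?_
      ext
      · simp [grad]; ring
      · simp [grad]
    refine (h1.add h2.hasFDerivWithinAt).congr_fderiv ?_
    ext <;> simp [grad]
  · refine continuousOn_pi.2 fun i => ContinuousOn.add ?_ (by fun_prop)
    exact (continuousOn_pi.1 S.cont_φ' i).comp continuousOn_fst fun q hq => hq.1
  · exact (show Continuous fun q : ℝ × ℝ => fun i => (1 - q.1) * S.d 0 i + q.1 * S.d 1 i
      from by fun_prop).continuousOn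
  · intro x hx; simp
  · intro i
    rcases entry_eq k i with h | h <;> simp [h]

/-- The sequence of successive approximations. -/
lemma exists_iteration (S : BoxSystem n k) :
    ∃ A : ℕ → Iterate n, ∀ m, S.IsStep (A m) (A (m + 1)) := by
  obtain ⟨A₀, h0⟩ := exists_admissible (S := S)
  choose! step hstep using fun (A : Iterate n) (hA : S.IsAdmissible A) => exists_step hA
  have hadm : ∀ m : ℕ, S.IsAdmissible (step^[m] A₀) := by
    intro m
    induction m with
    | zero => exact h0
    | succ m ih => rw [Function.iterate_succ_apply']; exact (hstep _ ih).adm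
  refine ⟨fun m => step^[m] A₀, fun m => ?_⟩
  simp only [Function.iterate_succ_apply']
  exact hstep _ (hadm m)

lemma IsStep.isImage {A B : Iterate n} (h : S.IsStep A B) : S.IsImage A.u B.u where
  cont := continuousOn_pi.1 h.adm.cont_u
  charDeriv i := by
    have h1 := hasCharDeriv_of_hasFDerivAt (T := S.T) (l := S.lam i) (u := fun x t => B.u x t i)
      (p := fun x t => B.p x t i) (r := fun x t => B.r x t i) fun x hx t ht =>
        (h.adm.hasFDeriv i (x, t) ⟨Ioo_subset_Icc_self hx, Ioo_subset_Icc_self ht⟩).hasFDerivAt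
          (prod_mem_nhds (Icc_mem_nhds hx.1 hx.2) (Icc_mem_nhds ht.1 ht.2))
    intro γ a b ha hb hγ s hs hγs
    refine (h1 γ a b ha hb hγ s hs hγs).congr_deriv ?_
    beta_reduce
    rw [h.r_eq i _ (hγ s (Ioo_subset_Icc_self hs)).1 s ⟨ha.trans hs.1.le, hs.2.le.trans hb⟩]
    ring
  init := h.adm.init
  bdry := h.bdry

end BoxSystem

/-! ### Uniform convergence of the iteration -/

/-- Composition with a continuous function preserves uniform convergence on compact sets to a
continuous limit. -/
lemma tendstoUniformlyOn_comp {P E F : Type*} [TopologicalSpace P] [PseudoMetricSpace E]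
    [PseudoMetricSpace F] {K : Set P} (hK : IsCompact K) {g : P → E → F}
    (hg : ContinuousOn (fun q : P × E => g q.1 q.2) (K ×ˢ univ)) {v : ℕ → P → E} {w : P → E}
    (hv : TendstoUniformlyOn v w atTop K) (hw : ContinuousOn w K) :
    TendstoUniformlyOn (fun m q => g q (v m q)) (fun q => g q (w q)) atTop K := by
  rw [← tendstoLocallyUniformlyOn_iff_tendstoUniformlyOn_of_compact hK,
    tendstoLocallyUniformlyOn_iff_forall_tendsto]
  intro x hx
  have h1 : Tendsto (fun y : ℕ × P => v y.1 y.2) (atTop ×ˢ 𝓝[K] x) (𝓝 (w x)) := by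
    have h2 := (tendstoUniformlyOn_iff_tendsto.1 hv).mono_left
      (prod_mono_right atTop (show 𝓝[K] x ≤ 𝓟 K from inf_le_right))
    exact ((hw x hx).tendsto.comp tendsto_snd).congr_uniformity h2
  have hmem : ∀ᶠ y : ℕ × P in atTop ×ˢ 𝓝[K] x, y.2 ∈ K :=
    tendsto_snd.eventually (eventually_mem_nhdsWithin (a := x) (s := K))
  have h3 : Tendsto (fun y : ℕ × P => g y.2 (v y.1 y.2)) (atTop ×ˢ 𝓝[K] x) (𝓝 (g x (w x))) := by
    refine (hg (x, w x) ⟨hx, trivial⟩).tendsto.comp (f := fun y : ℕ × P => (y.2, v y.1 y.2))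
      (tendsto_nhdsWithin_iff.2 ⟨?_, hmem.mono fun y hy => ⟨hy, trivial⟩⟩)
    exact (tendsto_nhds_of_tendsto_nhdsWithin tendsto_snd).prodMk_nhds h1
  have h4 : Tendsto (fun y : ℕ × P => g y.2 (w y.2)) (atTop ×ˢ 𝓝[K] x) (𝓝 (g x (w x))) := by
    refine (hg (x, w x) ⟨hx, trivial⟩).tendsto.comp (f := fun y : ℕ × P => (y.2, w y.2))
      (tendsto_nhdsWithin_iff.2 ⟨?_, hmem.mono fun y hy => ⟨hy, trivial⟩⟩)
    exact (tendsto_nhds_of_tendsto_nhdsWithin tendsto_snd).prodMk_nhds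
      ((hw x hx).tendsto.comp tendsto_snd)
  exact (h4.prodMk_nhds h3).mono_right (nhds_le_uniformity _)

lemma abs_clm_apply_le {n : ℕ} {A : (Fin n → ℝ) →L[ℝ] (Fin n → ℝ)} {v : Fin n → ℝ} {C D : ℝ}
    (hA : ‖A‖ ≤ C) (hv : ‖v‖ ≤ D) (i : Fin n) : |A v i| ≤ C * D :=
  (norm_le_pi_norm (A v) i).trans ((A.le_opNorm v).trans
    (mul_le_mul hA hv (norm_nonneg _) ((norm_nonneg _).trans hA)))

lemma TendstoUniformlyOn.exists_bound {P E : Type*} [TopologicalSpace P]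
    [SeminormedAddCommGroup E] {K : Set P} (hK : IsCompact K) {v : ℕ → P → E} {w : P → E}
    (hv : TendstoUniformlyOn v w atTop K) (hw : ContinuousOn w K) :
    ∃ C : ℝ, ∀ᶠ m in atTop, ∀ q ∈ K, ‖v m q‖ ≤ C := by
  obtain ⟨C, hC⟩ := hK.exists_bound_of_continuousOn hw
  refine ⟨C + 1, ?_⟩
  filter_upwards [Metric.tendstoUniformlyOn_iff.1 hv 1 one_pos] with m hm q hq
  have h1 := hm q hq
  rw [dist_comm, dist_eq_norm] at h1
  have h2 := norm_le_norm_add_norm_sub' (v m q) (w q)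
  linarith [hC q hq]

lemma TendstoUniformlyOn.exists_near {P E : Type*} [SeminormedAddCommGroup E] {K : Set P}
    {v : ℕ → P → E} {w : P → E} (hv : TendstoUniformlyOn v w atTop K) {ε : ℝ} (hε : 0 < ε) :
    ∀ᶠ N in atTop, ∀ m ≥ N, ∀ l ≥ N, ∀ q ∈ K, ‖v m q - v l q‖ ≤ ε := by
  obtain ⟨N, hN⟩ := Metric.uniformCauchySeqOn_iff.1 hv.uniformCauchySeqOn ε hε
  filter_upwards [eventually_ge_atTop N] with N' hN' m hm l hl q hq
  rw [← dist_eq_norm]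
  exact (hN m (hN'.trans hm) l (hN'.trans hl) q hq).le

namespace BoxSystem

variable {n k : ℕ} {S : BoxSystem n k}

/-- Cauchy sequences for the weighted distance converge uniformly on the box. -/
lemma exists_limit {a : ℕ → ℝ → ℝ → Fin n → ℝ}
    (ha : ∀ ε > 0, ∃ N, ∀ m ≥ N, ∀ l ≥ N, S.Near ε (a m) (a l)) :
    ∃ U : ℝ → ℝ → Fin n → ℝ, TendstoUniformlyOn (fun m (q : ℝ × ℝ) => a m q.1 q.2)
      (fun q => U q.1 q.2) atTop (box S.T) := by
  have hC : UniformCauchySeqOn (fun m (q : ℝ × ℝ) => a m q.1 q.2) atTop (box S.T) := by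
    rw [Metric.uniformCauchySeqOn_iff]
    intro ε hε
    set W := Real.exp (|S.μ| * S.T)
    have hW : 0 < W := Real.exp_pos _
    obtain ⟨N, hN⟩ := ha (ε / 2 / W) (by positivity)
    refine ⟨N, fun m hm l hl q hq => ?_⟩
    have h1 := (hN m hm l hl).norm_le (by positivity) hq.1 hq.2
    rw [dist_eq_norm]
    have h2 : Real.exp (S.μ * q.2) ≤ W := Real.exp_le_exp.2 <|
      (mul_le_mul_of_nonneg_right (le_abs_self _) hq.2.1).trans
        (mul_le_mul_of_nonneg_left hq.2.2 (abs_nonneg _))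
    calc _ ≤ ε / 2 / W * Real.exp (S.μ * q.2) := h1
      _ ≤ ε / 2 / W * W := by gcongr
      _ = ε / 2 := by field_simp
      _ < ε := by linarith
  have hlim : ∀ x t, ∃ y, (x, t) ∈ box S.T → Tendsto (fun m => a m x t) atTop (𝓝 y) := by
    intro x t
    by_cases h : (x, t) ∈ box S.T
    · obtain ⟨y, hy⟩ := cauchySeq_tendsto_of_complete (hC.cauchySeq h)
      exact ⟨y, fun _ => hy⟩
    · exact ⟨0, fun h' => absurd h' h⟩
  choose U hU using hlim
  exact ⟨U, hC.tendstoUniformlyOn_of_tendsto fun q hq => hU q.1 q.2 hq⟩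

lemma tendstoUniformlyOn_outgoing {a : ℕ → ℝ → ℝ → Fin n → ℝ} {U : ℝ → ℝ → Fin n → ℝ}
    (ha : TendstoUniformlyOn (fun m (q : ℝ × ℝ) => a m q.1 q.2) (fun q => U q.1 q.2) atTop
      (box S.T)) :
    TendstoUniformlyOn (fun m => outgoing k (a m)) (outgoing k U) atTop (Icc 0 S.T) := by
  rw [Metric.tendstoUniformlyOn_iff] at ha ⊢
  intro ε hε
  filter_upwards [ha ε hε] with m hm t ht
  rw [dist_pi_lt_iff hε]
  intro i
  rw [outgoing_apply, outgoing_apply]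
  exact (dist_le_pi_dist _ _ i).trans_lt (hm (1 - entry k i, t) ⟨one_sub_mem (entry_mem k i), ht⟩)

/-- The iterates `u` converge geometrically. -/
lemma exists_limit_u {A : ℕ → Iterate n} (hA : ∀ m, S.IsStep (A m) (A (m + 1))) :
    ∃ U : ℝ → ℝ → Fin n → ℝ, TendstoUniformlyOn (fun m (q : ℝ × ℝ) => (A m).u q.1 q.2)
      (fun q => U q.1 q.2) atTop (box S.T) := by
  obtain ⟨M, hM, h0⟩ := exists_near (S := S) (continuousOn_pi.1 (hA 0).adm.cont_u)
    (continuousOn_pi.1 (hA 1).adm.cont_u)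
  have h1 : ∀ j : ℕ, S.Near (M / 2 ^ j) (A (j + 1)).u (A (j + 2)).u := by
    intro j
    induction j with
    | zero => simpa using h0
    | succ j ih =>
      have := (hA (j + 1)).isImage.near (hA (j + 2)).isImage (by positivity) ih
      simpa [pow_succ, div_div] using this
  have h2 : ∀ j m : ℕ, S.Near (2 * M / 2 ^ j - 2 * M / 2 ^ (j + m)) (A (j + 1)).u
      (A (j + m + 1)).u := by
    intro j m
    induction m with
    | zero => intro i x hx t ht; simp
    | succ m ih =>
      refine (ih.trans (h1 (j + m))).mono (le_of_eq ?_)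
      rw [← add_assoc, pow_succ]
      field_simp; ring
  refine exists_limit fun ε hε => ?_
  obtain ⟨j, hj⟩ := exists_pow_lt_of_lt_one (show 0 < ε / (4 * M) by positivity)
    (show (1 / 2 : ℝ) < 1 by norm_num)
  have hj' : 2 * M / 2 ^ j ≤ ε / 2 := by
    rw [one_div, inv_pow, lt_div_iff₀ (by positivity)] at hj
    have : 2 * M / 2 ^ j = ((2 : ℝ) ^ j)⁻¹ * (4 * M) / 2 := by field_simp; ring
    rw [this]; linarith
  have h3 : ∀ m ≥ j + 1, S.Near (ε / 2) (A (j + 1)).u (A m).u := by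
    intro m hm
    obtain ⟨l, rfl⟩ := Nat.exists_eq_add_of_le hm
    have := h2 j l
    rw [show j + 1 + l = j + l + 1 by ring]
    refine this.mono (le_trans ?_ hj')
    have : 0 ≤ 2 * M / 2 ^ (j + l) := by positivity
    linarith
  refine ⟨j + 1, fun m hm l hl => ?_⟩
  have := (h3 m hm).symm.trans (h3 l hl)
  rwa [add_halves] at this

/-! ### Estimates for the derivatives of the iterates -/

/-- At the entry, `λ ∂ₓu = f - ∂ₜu`, and `∂ₜu` is known from the boundary condition. -/
lemma IsStep.abs_p_entry_le {A B : Iterate n} (h : S.IsStep A B) (i : Fin n) {t : ℝ}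
    (ht : t ∈ Icc (0 : ℝ) S.T) : S.c * |B.p (entry k i) t i| ≤
      |S.f (entry k i) t (A.u (entry k i) t) i - (S.ht t (outgoing k A.u t) i +
        S.hv t (outgoing k A.u t) (outgoing k A.r t) i)| := by
  have h1 := h.r_eq i _ (entry_mem k i) t ht
  rw [h.bdry_r i t ht] at h1
  have h2 : S.f (entry k i) t (A.u (entry k i) t) i - (S.ht t (outgoing k A.u t) i +
        S.hv t (outgoing k A.u t) (outgoing k A.r t) i) =
      S.lam i (entry k i) t * B.p (entry k i) t i := by rw [h1]; ring
  rw [h2, abs_mul]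
  exact mul_le_mul_of_nonneg_right (S.le_abs_lam i (q := (entry k i, t)) ⟨entry_mem k i, ht⟩)
    (abs_nonneg _)

/-- The bound `B` for `∂ₓu` is passed on to the next iterate. -/
lemma IsStep.near_p_zero {A₀ A₁ A₂ : Iterate n} (h₁ : S.IsStep A₀ A₁) (h₂ : S.IsStep A₁ A₂)
    {N B : ℝ} (hN : 0 ≤ N) (hB : 0 < B) (hf₀ : ∀ q ∈ box S.T, ‖S.f q.1 q.2 (A₀.u q.1 q.2)‖ ≤ N)
    (hf₁ : ∀ q ∈ box S.T, ‖S.f q.1 q.2 (A₁.u q.1 q.2)‖ ≤ N)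
    (hfx : ∀ q ∈ box S.T, ‖S.fx q.1 q.2 (A₁.u q.1 q.2)‖ ≤ N)
    (hht : ∀ t ∈ Icc 0 S.T, ‖S.ht t (outgoing k A₁.u t)‖ ≤ N)
    (hφ : ∀ x ∈ Icc (0 : ℝ) 1, ‖S.φ' x‖ ≤ N) (hB1 : N * (2 + S.H) ≤ S.c * B / 2)
    (hB2 : N * S.expν < B) (hp : S.Near B A₁.p 0) :
    S.Near B A₂.p 0 := by
  have hH := S.H_nonneg
  have hc := S.c_pos
  have hCf := S.Cf_nonneg
  refine near_zero_of_bounds hB (fun i => continuousOn_pi.1 h₂.adm.cont_p i)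
    (G := fun x t i => S.fx x t (A₁.u x t) i + S.fu x t (A₁.u x t) (A₁.p x t) i -
      S.lamx i x t * A₂.p x t i) h₂.charDeriv (fun i x hx => ?_) (fun i t ht => ?_)
    (fun i x hx t ht => ?_)
  · rw [h₂.init_p x hx]
    have h1 : |S.φ' x i| ≤ N := (norm_le_pi_norm _ i).trans (hφ x hx)
    have h2 := S.one_le_expν i
    exact (mul_le_mul_of_nonneg_right h1 (by linarith)).trans_lt hB2
  · have h1 := h₂.abs_p_entry_le i ht
    have hE := S.one_le_exp i ht.1
    have hΛ := S.Λ_nonneg i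
    set E := Real.exp (S.μ * t)
    have e1 : |S.f (entry k i) t (A₁.u (entry k i) t) i| ≤ N :=
      (norm_le_pi_norm _ i).trans (hf₁ (entry k i, t) ⟨entry_mem k i, ht⟩)
    have e2 : |S.ht t (outgoing k A₁.u t) i| ≤ N := (norm_le_pi_norm _ i).trans (hht t ht)
    have e3 : ‖outgoing k A₁.r t‖ ≤ N + S.Λ * (B * (Real.exp (-S.ν) * E)) := by
      rw [pi_norm_le_iff_of_nonneg (by positivity)]
      intro j
      have hj := one_sub_mem (entry_mem k j)
      rw [outgoing_apply, h₁.r_eq j _ hj t ht]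
      refine (norm_sub_le _ _).trans (add_le_add ((norm_le_pi_norm _ j).trans
        (hf₀ (_, t) ⟨hj, ht⟩)) ?_)
      rw [norm_mul]
      have := hp.abs_exit_le ht j
      simp only [Pi.zero_apply, sub_zero] at this
      exact mul_le_mul (S.abs_lam_le j (q := (1 - entry k j, t)) ⟨hj, ht⟩) this (norm_nonneg _) hΛ
    have e4 : |S.hv t (outgoing k A₁.u t) (outgoing k A₁.r t) i| ≤
        S.H * (N + S.Λ * (B * (Real.exp (-S.ν) * E))) :=
      abs_clm_apply_le (S.hv_le t ht _) e3 i
    have e5 : S.H * (N + S.Λ * (B * (Real.exp (-S.ν) * E))) =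
        N * S.H + S.H * S.Λ * Real.exp (-S.ν) * (B * E) := by ring
    have e6 : S.H * S.Λ * Real.exp (-S.ν) * (B * E) ≤ S.c / 4 * (B * E) :=
      mul_le_mul_of_nonneg_right (S.HΛ_mul_le i) (by positivity)
    have e7 := (abs_sub _ _).trans (add_le_add e1 ((abs_add_le _ _).trans (add_le_add e2 e4)))
    have e8 : S.c * B ≤ S.c * (B * E) := by
      have := mul_le_mul_of_nonneg_left hE (by positivity : 0 ≤ S.c * B)
      linarith
    have e9 : 0 < S.c * B := by positivity
    refine lt_of_mul_lt_mul_left ?_ hc.le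
    linarith
  · have hE := S.one_le_exp i ht.1
    have e1 : |S.fx x t (A₁.u x t) i| ≤ N := (norm_le_pi_norm _ i).trans (hfx (x, t) ⟨hx, ht⟩)
    have e2 := hp.norm_le hB.le hx ht
    simp only [Pi.zero_apply, sub_zero] at e2
    have e3 : |S.fu x t (A₁.u x t) (A₁.p x t) i| ≤ S.Cf * (B * Real.exp (S.μ * t)) :=
      abs_clm_apply_le (S.fu_le (x, t) ⟨hx, ht⟩ _) e2 i
    have e4 : |S.lamx i x t * A₂.p x t i| ≤ S.a * |A₂.p x t i| := by
      rw [abs_mul]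
      exact mul_le_mul_of_nonneg_right (S.lamx_le i (x, t) ⟨hx, ht⟩) (abs_nonneg _)
    have e5 := (abs_sub _ _).trans (add_le_add ((abs_add_le _ _).trans (add_le_add e1 e3)) e4)
    have e6 : N ≤ B * Real.exp (S.μ * t) := by
      have h1 : N * 1 ≤ N * S.expν := mul_le_mul_of_nonneg_left (S.one_le_expν i) hN
      have h3 := mul_le_mul_of_nonneg_left hE hB.le
      linarith
    have e7 : 0 ≤ S.Cf * (B * Real.exp (S.μ * t)) := by positivity
    calc _ ≤ N + S.Cf * (B * Real.exp (S.μ * t)) + S.a * |A₂.p x t i| := e5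
      _ ≤ (1 + 2 * S.Cf) * B * Real.exp (S.μ * t) + S.a * |A₂.p x t i| := by
        have : (1 + 2 * S.Cf) * B * Real.exp (S.μ * t) = B * Real.exp (S.μ * t) +
          S.Cf * (B * Real.exp (S.μ * t)) + S.Cf * (B * Real.exp (S.μ * t)) := by ring
        linarith

/-- The weighted distance of two derivatives `∂ₓu` is halved by a step of the iteration once all
coefficients that depend on `u` are `ε`-close. -/
lemma IsStep.near_p {A₀ A₁ A₂ B₀ B₁ B₂ : Iterate n} (hA₁ : S.IsStep A₀ A₁) (hA₂ : S.IsStep A₁ A₂)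
    (hB₁ : S.IsStep B₀ B₁) (hB₂ : S.IsStep B₁ B₂) {ε P R M : ℝ} (hε : 0 ≤ ε) (hM : 0 < M)
    (hf₀ : ∀ q ∈ box S.T,
      ‖S.f q.1 q.2 (A₀.u q.1 q.2) - S.f q.1 q.2 (B₀.u q.1 q.2)‖ ≤ ε)
    (hf₁ : ∀ q ∈ box S.T,
      ‖S.f q.1 q.2 (A₁.u q.1 q.2) - S.f q.1 q.2 (B₁.u q.1 q.2)‖ ≤ ε)
    (hfx : ∀ q ∈ box S.T,
      ‖S.fx q.1 q.2 (A₁.u q.1 q.2) - S.fx q.1 q.2 (B₁.u q.1 q.2)‖ ≤ ε)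
    (hfu : ∀ q ∈ box S.T,
      ‖S.fu q.1 q.2 (A₁.u q.1 q.2) - S.fu q.1 q.2 (B₁.u q.1 q.2)‖ ≤ ε)
    (hht : ∀ t ∈ Icc 0 S.T, ‖S.ht t (outgoing k A₁.u t) - S.ht t (outgoing k B₁.u t)‖ ≤ ε)
    (hhv : ∀ t ∈ Icc 0 S.T, ‖S.hv t (outgoing k A₁.u t) - S.hv t (outgoing k B₁.u t)‖ ≤ ε)
    (hP : ∀ q ∈ box S.T, ‖B₁.p q.1 q.2‖ ≤ P) (hR : ∀ t ∈ Icc 0 S.T, ‖outgoing k B₁.r t‖ ≤ R)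
    (h1 : ε * (2 + S.H + R) < S.c * M / 4) (h2 : ε * (1 + P) ≤ M / 2)
    (hp : S.Near M A₁.p B₁.p) : S.Near (M / 2) A₂.p B₂.p := by
  have hH := S.H_nonneg
  have hc := S.c_pos
  have hCf := S.Cf_nonneg
  have key : S.Near (M / 2) (fun x t i => A₂.p x t i - B₂.p x t i) 0 := by
    refine near_zero_of_bounds (by positivity)
      (fun i => (continuousOn_pi.1 hA₂.adm.cont_p i).sub (continuousOn_pi.1 hB₂.adm.cont_p i))
      (G := fun x t i => (S.fx x t (A₁.u x t) i + S.fu x t (A₁.u x t) (A₁.p x t) i -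
        S.lamx i x t * A₂.p x t i) - (S.fx x t (B₁.u x t) i + S.fu x t (B₁.u x t) (B₁.p x t) i -
        S.lamx i x t * B₂.p x t i)) (fun i => (hA₂.charDeriv i).sub (hB₂.charDeriv i))
      (fun i x hx => ?_) (fun i t ht => ?_) (fun i x hx t ht => ?_)
    · simp only [hA₂.init_p x hx, hB₂.init_p x hx, sub_self, abs_zero, zero_mul]; positivity
    · have hE := S.one_le_exp i ht.1
      have hΛ := S.Λ_nonneg i
      set E := Real.exp (S.μ * t)
      set e := entry k i
      set vA := outgoing k A₁.u t
      set vB := outgoing k B₁.u t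
      set rA := outgoing k A₁.r t
      set rB := outgoing k B₁.r t
      have e1 : |S.f e t (A₁.u e t) i - S.f e t (B₁.u e t) i| ≤ ε :=
        (norm_le_pi_norm _ i).trans (hf₁ (e, t) ⟨entry_mem k i, ht⟩)
      have e2 : |S.ht t vA i - S.ht t vB i| ≤ ε := (norm_le_pi_norm _ i).trans (hht t ht)
      have e3 : ‖rA - rB‖ ≤ ε + S.Λ * (M * (Real.exp (-S.ν) * E)) := by
        rw [pi_norm_le_iff_of_nonneg (by positivity)]
        intro j
        have hj := one_sub_mem (entry_mem k j)
        simp only [rA, rB, Pi.sub_apply, outgoing_apply]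
        rw [hA₁.r_eq j _ hj t ht, hB₁.r_eq j _ hj t ht]
        have hsplit : ∀ a b l x y : ℝ, a - l * x - (b - l * y) = (a - b) - l * (x - y) := by
          intros; ring
        rw [hsplit]
        refine (norm_sub_le _ _).trans (add_le_add ((norm_le_pi_norm _ j).trans
          (hf₀ (_, t) ⟨hj, ht⟩)) ?_)
        rw [norm_mul]
        exact mul_le_mul (S.abs_lam_le j (q := (1 - entry k j, t)) ⟨hj, ht⟩)
          (hp.abs_exit_le ht j) (norm_nonneg _) hΛ
      have e4 : |S.hv t vA (rA - rB) i| ≤ S.H * (ε + S.Λ * (M * (Real.exp (-S.ν) * E))) :=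
        abs_clm_apply_le (S.hv_le t ht _) e3 i
      have e5 : |(S.hv t vA - S.hv t vB) rB i| ≤ ε * R :=
        abs_clm_apply_le (hhv t ht) (hR t ht) i
      have e6 : S.H * (ε + S.Λ * (M * (Real.exp (-S.ν) * E))) =
          ε * S.H + S.H * S.Λ * Real.exp (-S.ν) * (M * E) := by ring
      have e7 : S.H * S.Λ * Real.exp (-S.ν) * (M * E) ≤ S.c / 4 * (M * E) :=
        mul_le_mul_of_nonneg_right (S.HΛ_mul_le i) (by positivity)
      -- the difference of the two entry identities
      have e8 : S.lam i e t * (A₂.p e t i - B₂.p e t i) =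
          (S.f e t (A₁.u e t) i - S.f e t (B₁.u e t) i) -
          ((S.ht t vA i - S.ht t vB i) + (S.hv t vA (rA - rB) i +
            (S.hv t vA - S.hv t vB) rB i)) := by
        have h3 := hA₂.r_eq i e (entry_mem k i) t ht
        have h4 := hB₂.r_eq i e (entry_mem k i) t ht
        rw [hA₂.bdry_r i t ht] at h3
        rw [hB₂.bdry_r i t ht] at h4
        change S.ht t vA i + S.hv t vA rA i = _ at h3
        change S.ht t vB i + S.hv t vB rB i = _ at h4
        simp only [map_sub, sub_apply, Pi.sub_apply]
        linear_combination h3 - h4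
      have e9 : S.c * |A₂.p e t i - B₂.p e t i| ≤
          ε + (ε + (S.H * (ε + S.Λ * (M * (Real.exp (-S.ν) * E))) + ε * R)) := by
        refine (mul_le_mul_of_nonneg_right (S.le_abs_lam i (q := (e, t)) ⟨entry_mem k i, ht⟩)
          (abs_nonneg _)).trans ?_
        rw [← abs_mul, e8]
        exact (abs_sub _ _).trans (add_le_add e1 ((abs_add_le _ _).trans
          (add_le_add e2 ((abs_add_le _ _).trans (add_le_add e4 e5)))))
      have e10 : S.c * M ≤ S.c * (M * E) := by
        have := mul_le_mul_of_nonneg_left hE (by positivity : 0 ≤ S.c * M)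
        linarith
      refine lt_of_mul_lt_mul_left ?_ hc.le
      linarith
    · have hE := S.one_le_exp i ht.1
      have e1 : |S.fx x t (A₁.u x t) i - S.fx x t (B₁.u x t) i| ≤ ε :=
        (norm_le_pi_norm _ i).trans (hfx (x, t) ⟨hx, ht⟩)
      have e2 : |S.fu x t (A₁.u x t) (A₁.p x t - B₁.p x t) i| ≤
          S.Cf * (M * Real.exp (S.μ * t)) :=
        abs_clm_apply_le (S.fu_le (x, t) ⟨hx, ht⟩ _) (hp.norm_le hM.le hx ht) i
      have e3 : |(S.fu x t (A₁.u x t) - S.fu x t (B₁.u x t)) (B₁.p x t) i| ≤ ε * P :=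
        abs_clm_apply_le (hfu (x, t) ⟨hx, ht⟩) (hP (x, t) ⟨hx, ht⟩) i
      have e4 : |S.lamx i x t * (A₂.p x t i - B₂.p x t i)| ≤
          S.a * |A₂.p x t i - B₂.p x t i| := by
        rw [abs_mul]
        exact mul_le_mul_of_nonneg_right (S.lamx_le i (x, t) ⟨hx, ht⟩) (abs_nonneg _)
      have e5 : (S.fx x t (A₁.u x t) i + S.fu x t (A₁.u x t) (A₁.p x t) i -
          S.lamx i x t * A₂.p x t i) - (S.fx x t (B₁.u x t) i + S.fu x t (B₁.u x t) (B₁.p x t) i -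
          S.lamx i x t * B₂.p x t i) = ((S.fx x t (A₁.u x t) i - S.fx x t (B₁.u x t) i) +
          (S.fu x t (A₁.u x t) (A₁.p x t - B₁.p x t) i +
            (S.fu x t (A₁.u x t) - S.fu x t (B₁.u x t)) (B₁.p x t) i)) -
          S.lamx i x t * (A₂.p x t i - B₂.p x t i) := by
        simp only [map_sub, sub_apply, Pi.sub_apply]
        ring
      have e6 := (abs_sub _ _).trans (add_le_add ((abs_add_le _ _).trans
        (add_le_add e1 ((abs_add_le _ _).trans (add_le_add e2 e3)))) e4)
      rw [← e5] at e6
      have e7 : M / 2 ≤ M / 2 * Real.exp (S.μ * t) := by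
        have := mul_le_mul_of_nonneg_left hE (by positivity : 0 ≤ M / 2)
        linarith
      refine e6.trans ?_
      have e8 : (1 + 2 * S.Cf) * (M / 2) * Real.exp (S.μ * t) =
        M / 2 * Real.exp (S.μ * t) + S.Cf * (M * Real.exp (S.μ * t)) := by ring
      linarith
  intro i x hx t ht
  simpa using key i x hx t ht

end BoxSystem

/-! ### Existence on a box -/

lemma closure_openBox {T : ℝ} (hT : 0 < T) : closure (Ioo (0 : ℝ) 1 ×ˢ Ioo (0 : ℝ) T) = box T := by
  rw [closure_prod_eq, closure_Ioo zero_ne_one, closure_Ioo hT.ne]; rfl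

lemma contDiffOn_box {T : ℝ} (hT : 0 < T) {u p r : ℝ → ℝ → ℝ}
    (hu : ∀ q ∈ box T, HasFDerivWithinAt (fun q : ℝ × ℝ => u q.1 q.2)
      (grad (p q.1 q.2) (r q.1 q.2)) (box T) q)
    (cp : ContinuousOn (fun q : ℝ × ℝ => p q.1 q.2) (box T))
    (cr : ContinuousOn (fun q : ℝ × ℝ => r q.1 q.2) (box T)) :
    ContDiffOn ℝ 1 (fun q : ℝ × ℝ => u q.1 q.2) (box T) := by
  have hU : UniqueDiffOn ℝ (box T) := (uniqueDiffOn_Icc zero_lt_one).prod (uniqueDiffOn_Icc hT)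
  rw [show (1 : WithTop ℕ∞) = 0 + 1 from (zero_add 1).symm, contDiffOn_succ_iff_fderivWithin hU]
  refine ⟨fun q hq => (hu q hq).differentiableWithinAt, by simp, contDiffOn_zero.2 ?_⟩
  exact (continuous_grad.comp_continuousOn (cp.prodMk cr)).congr fun q hq =>
    (hu q hq).fderivWithin (hU q hq)

/-- A uniform limit of `C¹` functions whose derivatives converge uniformly, on a box. -/
lemma hasFDerivWithinAt_limit {T : ℝ} (hT : 0 < T) {u p r : ℕ → ℝ → ℝ → ℝ} {U P R : ℝ → ℝ → ℝ}
    (hu : ∀ m, ∀ q ∈ box T, HasFDerivWithinAt (fun q : ℝ × ℝ => u m q.1 q.2)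
      (grad (p m q.1 q.2) (r m q.1 q.2)) (box T) q)
    (hU : ∀ q ∈ box T, Tendsto (fun m => u m q.1 q.2) atTop (𝓝 (U q.1 q.2)))
    (hP : TendstoUniformlyOn (fun m (q : ℝ × ℝ) => p m q.1 q.2) (fun q => P q.1 q.2) atTop (box T))
    (hR : TendstoUniformlyOn (fun m (q : ℝ × ℝ) => r m q.1 q.2) (fun q => R q.1 q.2) atTop (box T))
    (cU : ContinuousOn (fun q : ℝ × ℝ => U q.1 q.2) (box T))
    (cP : ContinuousOn (fun q : ℝ × ℝ => P q.1 q.2) (box T))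
    (cR : ContinuousOn (fun q : ℝ × ℝ => R q.1 q.2) (box T)) :
    ∀ q ∈ box T, HasFDerivWithinAt (fun q : ℝ × ℝ => U q.1 q.2)
      (grad (P q.1 q.2) (R q.1 q.2)) (box T) q := by
  set s : Set (ℝ × ℝ) := Ioo (0 : ℝ) 1 ×ˢ Ioo (0 : ℝ) T with hs
  have hcl : closure s = box T := closure_openBox hT
  have hso : IsOpen s := isOpen_Ioo.prod isOpen_Ioo
  have hsb : s ⊆ box T := hcl ▸ subset_closure
  have hgrad : TendstoUniformlyOn (fun m (q : ℝ × ℝ) => grad (p m q.1 q.2) (r m q.1 q.2))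
      (fun q => grad (P q.1 q.2) (R q.1 q.2)) atTop s := by
    rw [Metric.tendstoUniformlyOn_iff] at hP hR ⊢
    intro ε hε
    filter_upwards [hP (ε / 2) (by positivity), hR (ε / 2) (by positivity)] with m h1 h2 q hq
    have h3 : grad (P q.1 q.2) (R q.1 q.2) - grad (p m q.1 q.2) (r m q.1 q.2) =
        grad (P q.1 q.2 - p m q.1 q.2) (R q.1 q.2 - r m q.1 q.2) := by
      ext <;> simp [grad]
    rw [dist_eq_norm, h3]
    have h4 := h1 q (hsb hq)
    have h5 := h2 q (hsb hq)
    rw [Real.dist_eq] at h4 h5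
    exact (norm_grad_le _ _).trans_lt (by linarith)
  have hint : ∀ q ∈ s, HasFDerivAt (fun q : ℝ × ℝ => U q.1 q.2)
      (grad (P q.1 q.2) (R q.1 q.2)) q := fun q hq =>
    hasFDerivAt_of_tendstoUniformlyOn hso hgrad
      (fun m x hx => (hu m x (hsb hx)).hasFDerivAt
        (mem_of_superset (hso.mem_nhds hx) hsb)) (fun x hx => hU x (hsb hx)) hq
  intro q hq
  rw [← hcl]
  refine hasFDerivWithinAt_closure_of_tendsto_fderiv
    (fun x hx => (hint x hx).differentiableAt.differentiableWithinAt)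
    ((convex_Ioo 0 1).prod (convex_Ioo 0 T)) hso (fun y hy => (cU y (hcl ▸ hy)).mono hsb) ?_
  have h1 : Tendsto (fun q : ℝ × ℝ => grad (P q.1 q.2) (R q.1 q.2)) (𝓝[s] q)
      (𝓝 (grad (P q.1 q.2) (R q.1 q.2))) :=
    ((continuous_grad.comp_continuousOn (cP.prodMk cR)) q hq).mono hsb
  refine h1.congr' ?_
  filter_upwards [self_mem_nhdsWithin] with x hx using (hint x hx).fderiv.symm

namespace BoxSystem

variable {n k : ℕ}

/-- The iterates `∂ₓu` stay bounded, in the weighted and in the unweighted norm, and so do the time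
derivatives of the outgoing values. -/
lemma exists_bound_p (S : BoxSystem n k) (i₀ : Fin n) {A : ℕ → Iterate n}
    (hA : ∀ m, S.IsStep (A m) (A (m + 1))) {U : ℝ → ℝ → Fin n → ℝ}
    (hU : TendstoUniformlyOn (fun m (q : ℝ × ℝ) => (A m).u q.1 q.2) (fun q => U q.1 q.2) atTop
      (box S.T)) (cU : ContinuousOn (fun q : ℝ × ℝ => U q.1 q.2) (box S.T)) :
    ∃ N₀ : ℕ, ∃ B P R : ℝ, 0 < B ∧ 0 ≤ P ∧ 0 ≤ R ∧ ∀ m ≥ N₀, S.Near B (A m).p 0 ∧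
      (∀ q ∈ box S.T, ‖(A m).p q.1 q.2‖ ≤ P) ∧ ∀ t ∈ Icc 0 S.T, ‖outgoing k (A m).r t‖ ≤ R := by
  have hc := S.c_pos
  have hH := S.H_nonneg
  have hΛ := S.Λ_nonneg i₀
  have hx1 := S.one_le_expν i₀
  have hKb := isCompact_box S.T
  have hKt : IsCompact (Icc (0 : ℝ) S.T) := isCompact_Icc
  have cO := continuousOn_outgoing (S := S) cU
  obtain ⟨Nf, hNf⟩ := TendstoUniformlyOn.exists_bound hKb
    (tendstoUniformlyOn_comp hKb (g := fun (q : ℝ × ℝ) y => S.f q.1 q.2 y) S.f_cont hU cU)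
    (continuousOn_comp_prodMk (g := fun (q : ℝ × ℝ) y => S.f q.1 q.2 y) S.f_cont cU)
  obtain ⟨Nx, hNx⟩ := TendstoUniformlyOn.exists_bound hKb
    (tendstoUniformlyOn_comp hKb (g := fun (q : ℝ × ℝ) y => S.fx q.1 q.2 y) S.fx_cont hU cU)
    (continuousOn_comp_prodMk (g := fun (q : ℝ × ℝ) y => S.fx q.1 q.2 y) S.fx_cont cU)
  obtain ⟨Nt, hNt⟩ := TendstoUniformlyOn.exists_bound hKt
    (tendstoUniformlyOn_comp hKt (g := S.ht) S.ht_cont (tendstoUniformlyOn_outgoing (S := S) hU) cO)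
    (continuousOn_comp_prodMk (g := S.ht) S.ht_cont cO)
  obtain ⟨Nφ, hNφ⟩ := isCompact_Icc.exists_bound_of_continuousOn S.cont_φ'
  obtain ⟨N₀, hN₀⟩ := eventually_atTop.1 (hNf.and (hNx.and hNt))
  obtain ⟨Np, hNp⟩ := hKb.exists_bound_of_continuousOn (hA N₀).adm.cont_p
  obtain ⟨N, hN0, hle⟩ : ∃ N : ℝ, 0 ≤ N ∧ Nf ≤ N ∧ Nx ≤ N ∧ Nt ≤ N ∧ Nφ ≤ N ∧ Np ≤ N := by
    have := abs_nonneg Nf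
    have := abs_nonneg Nx
    have := abs_nonneg Nt
    have := abs_nonneg Nφ
    have := abs_nonneg Np
    refine ⟨|Nf| + |Nx| + |Nt| + |Nφ| + |Np|, by positivity, (le_abs_self _).trans ?_,
      (le_abs_self _).trans ?_, (le_abs_self _).trans ?_,
      (le_abs_self _).trans ?_, (le_abs_self _).trans ?_⟩ <;> linarith
  obtain ⟨B, hB0, hBc, hBe⟩ : ∃ B : ℝ, 0 < B ∧ N * (2 + S.H) ≤ S.c * B / 2 ∧ N * S.expν < B := by
    have hfrac : 0 ≤ N * (2 + S.H) / S.c := by positivity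
    have hNe : 0 ≤ N * S.expν := by positivity
    refine ⟨2 * (N * (2 + S.H) / S.c) + N * S.expν + 1, by linarith, ?_, by linarith⟩
    have h3 : 0 ≤ S.c * (N * S.expν + 1) := by positivity
    have h4 : S.c * (2 * (N * (2 + S.H) / S.c) + N * S.expν + 1) / 2 =
        N * (2 + S.H) + S.c * (N * S.expν + 1) / 2 := by field_simp; ring
    linarith
  have hbdd : ∀ m, S.Near B (A (N₀ + m + 1)).p 0 := by
    intro m
    induction m with
    | zero =>
      refine (Near.of_bound (N := N) hN0 fun i x hx t ht => ?_).mono hBe.le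
      simp only [Pi.zero_apply, sub_zero]
      exact ((norm_le_pi_norm _ i).trans (hNp (x, t) ⟨hx, ht⟩)).trans hle.2.2.2.2
    | succ m ih =>
      have h1 := hN₀ (N₀ + m) (by omega)
      have h2 := hN₀ (N₀ + m + 1) (by omega)
      exact (hA (N₀ + m)).near_p_zero (hA (N₀ + m + 1)) hN0 hB0
        (fun q hq => (h1.1 q hq).trans hle.1) (fun q hq => (h2.1 q hq).trans hle.1)
        (fun q hq => (h2.2.1 q hq).trans hle.2.1) (fun t ht => (h2.2.2 t ht).trans hle.2.2.1)
        (fun x hx => (hNφ x hx).trans hle.2.2.2.1) hBc hBe ih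
  obtain ⟨P, hP0, hP⟩ : ∃ P : ℝ, 0 ≤ P ∧ B * Real.exp (S.μ * S.T) ≤ P := ⟨_, by positivity, le_rfl⟩
  have hPb : ∀ m, ∀ q ∈ box S.T, ‖(A (N₀ + m + 1)).p q.1 q.2‖ ≤ P := by
    intro m q hq
    have h1 := (hbdd m).norm_le hB0.le hq.1 hq.2
    simp only [Pi.zero_apply, sub_zero] at h1
    refine (h1.trans (mul_le_mul_of_nonneg_left (Real.exp_le_exp.2 ?_) hB0.le)).trans hP
    exact mul_le_mul_of_nonneg_left hq.2.2 (S.μ_nonneg i₀)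
  refine ⟨N₀ + 1, B, P, N + S.Λ * P, hB0, hP0, by positivity, fun m hm => ?_⟩
  obtain ⟨m, rfl⟩ : ∃ m', m = N₀ + m' + 1 := ⟨m - (N₀ + 1), by omega⟩
  refine ⟨hbdd m, hPb m, fun t ht => ?_⟩
  rw [pi_norm_le_iff_of_nonneg (by positivity)]
  intro j
  have hj := one_sub_mem (entry_mem k j)
  rw [outgoing_apply, (hA (N₀ + m)).r_eq j _ hj t ht]
  refine (norm_sub_le _ _).trans (add_le_add ((norm_le_pi_norm _ j).trans
    (((hN₀ (N₀ + m) (by omega)).1 (_, t) ⟨hj, ht⟩).trans hle.1)) ?_)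
  rw [norm_mul]
  exact mul_le_mul (S.abs_lam_le j (q := (1 - entry k j, t)) ⟨hj, ht⟩)
    ((norm_le_pi_norm _ j).trans (hPb m (1 - entry k j, t) ⟨hj, ht⟩)) (norm_nonneg _) hΛ

/-- The weighted distances between late derivatives `∂ₓu` can be halved by going on far enough. -/
lemma exists_near_p_half {S : BoxSystem n k} {A : ℕ → Iterate n}
    (hA : ∀ m, S.IsStep (A m) (A (m + 1))) {U : ℝ → ℝ → Fin n → ℝ}
    (hU : TendstoUniformlyOn (fun m (q : ℝ × ℝ) => (A m).u q.1 q.2) (fun q => U q.1 q.2) atTop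
      (box S.T)) (cU : ContinuousOn (fun q : ℝ × ℝ => U q.1 q.2) (box S.T))
    {P R M : ℝ} (hP : 0 ≤ P) (hR : 0 ≤ R) (hM : 0 < M) {N : ℕ}
    (hPb : ∀ m ≥ N, ∀ q ∈ box S.T, ‖(A m).p q.1 q.2‖ ≤ P)
    (hRb : ∀ m ≥ N, ∀ t ∈ Icc 0 S.T, ‖outgoing k (A m).r t‖ ≤ R)
    (hNear : ∀ m ≥ N, ∀ l ≥ N, S.Near M (A m).p (A l).p) :
    ∃ N' ≥ N, ∀ m ≥ N', ∀ l ≥ N', S.Near (M / 2) (A m).p (A l).p := by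
  have hc := S.c_pos
  have hH := S.H_nonneg
  have hKb := isCompact_box S.T
  have hKt : IsCompact (Icc (0 : ℝ) S.T) := isCompact_Icc
  have cO := continuousOn_outgoing (S := S) cU
  have tO := tendstoUniformlyOn_outgoing (S := S) hU
  obtain ⟨ε, hε, hε1, hε2⟩ : ∃ ε > 0, ε * (2 + S.H + R) < S.c * M / 4 ∧
      ε * (1 + P) ≤ M / 2 := by
    refine ⟨min (S.c * M / 8 / (2 + S.H + R)) (M / 2 / (1 + P)), by positivity, ?_, ?_⟩
    · refine (mul_le_mul_of_nonneg_right (min_le_left _ _) (by positivity)).trans_lt ?_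
      rw [div_mul_cancel₀ _ (by positivity)]
      have : 0 < S.c * M := by positivity
      linarith
    · refine (mul_le_mul_of_nonneg_right (min_le_right _ _) (by positivity)).trans ?_
      rw [div_mul_cancel₀ _ (by positivity)]
  have ef := TendstoUniformlyOn.exists_near (tendstoUniformlyOn_comp hKb
    (g := fun (q : ℝ × ℝ) y => S.f q.1 q.2 y) S.f_cont hU cU) hε
  have efx := TendstoUniformlyOn.exists_near (tendstoUniformlyOn_comp hKb
    (g := fun (q : ℝ × ℝ) y => S.fx q.1 q.2 y) S.fx_cont hU cU) hε
  have efu := TendstoUniformlyOn.exists_near (tendstoUniformlyOn_comp hKb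
    (g := fun (q : ℝ × ℝ) y => S.fu q.1 q.2 y) S.fu_cont hU cU) hε
  have eht := TendstoUniformlyOn.exists_near
    (tendstoUniformlyOn_comp hKt (g := S.ht) S.ht_cont tO cO) hε
  have ehv := TendstoUniformlyOn.exists_near
    (tendstoUniformlyOn_comp hKt (g := S.hv) S.hv_cont tO cO) hε
  obtain ⟨N₂, ⟨⟨⟨⟨e1, e2⟩, e3⟩, e4⟩, e5⟩, hN₂⟩ :=
    (((((ef.and efx).and efu).and eht).and ehv).and (eventually_ge_atTop N)).exists
  refine ⟨N₂ + 2, by omega, fun m hm l hl => ?_⟩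
  obtain ⟨a, rfl, ha⟩ : ∃ a, m = a + 1 + 1 ∧ N₂ ≤ a := ⟨m - 2, by omega, by omega⟩
  obtain ⟨b, rfl, hb⟩ : ∃ b, l = b + 1 + 1 ∧ N₂ ≤ b := ⟨l - 2, by omega, by omega⟩
  have ha' : N₂ ≤ a + 1 := by omega
  have hb' : N₂ ≤ b + 1 := by omega
  exact (hA a).near_p (hA (a + 1)) (hA b) (hA (b + 1)) hε.le hM (e1 a ha b hb) (e1 _ ha' _ hb')
    (e2 _ ha' _ hb') (e3 _ ha' _ hb') (e4 _ ha' _ hb') (e5 _ ha' _ hb')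
    (hPb _ (hN₂.trans hb')) (hRb _ (hN₂.trans hb')) hε1 hε2
    (hNear _ (hN₂.trans ha') _ (hN₂.trans hb'))

/-- The derivatives `∂ₓu` of the iterates converge: they stay bounded, and their weighted distances
are halved again and again. -/
lemma exists_limit_p (S : BoxSystem n k) (i₀ : Fin n) {A : ℕ → Iterate n}
    (hA : ∀ m, S.IsStep (A m) (A (m + 1))) {U : ℝ → ℝ → Fin n → ℝ}
    (hU : TendstoUniformlyOn (fun m (q : ℝ × ℝ) => (A m).u q.1 q.2) (fun q => U q.1 q.2) atTop
      (box S.T)) (cU : ContinuousOn (fun q : ℝ × ℝ => U q.1 q.2) (box S.T)) :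
    ∃ P : ℝ → ℝ → Fin n → ℝ, TendstoUniformlyOn (fun m (q : ℝ × ℝ) => (A m).p q.1 q.2)
      (fun q => P q.1 q.2) atTop (box S.T) := by
  obtain ⟨N₀, B, P, R, hB, hP, hR, hbd⟩ := exists_bound_p S i₀ hA hU cU
  have hcauchy : ∀ j : ℕ, ∃ N ≥ N₀, ∀ m ≥ N, ∀ l ≥ N,
      S.Near (2 * B / 2 ^ j) (A m).p (A l).p := by
    intro j
    induction j with
    | zero =>
      refine ⟨N₀, le_rfl, fun m hm l hl => ?_⟩
      exact ((hbd m hm).1.trans (hbd l hl).1.symm).mono (by rw [pow_zero]; linarith)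
    | succ j ih =>
      obtain ⟨N, hN, hNear⟩ := ih
      obtain ⟨N', hN', h⟩ := exists_near_p_half hA hU cU hP hR (by positivity)
        (fun m hm => (hbd m (hN.trans hm)).2.1) (fun m hm => (hbd m (hN.trans hm)).2.2) hNear
      refine ⟨N', hN.trans hN', fun m hm l hl => ?_⟩
      rw [pow_succ, ← div_div]
      exact h m hm l hl
  refine exists_limit fun ε hε => ?_
  obtain ⟨j, hj⟩ := exists_pow_lt_of_lt_one (show 0 < ε / (2 * B) by positivity)
    (show (1 / 2 : ℝ) < 1 by norm_num)
  obtain ⟨N₁, -, hN₁⟩ := hcauchy j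
  refine ⟨N₁, fun m hm l hl => (hN₁ m hm l hl).mono ?_⟩
  rw [one_div, inv_pow, lt_div_iff₀ (by positivity)] at hj
  have : 2 * B / 2 ^ j = ((2 : ℝ) ^ j)⁻¹ * (2 * B) := by field_simp
  rw [this]; exact hj.le

/-- `u` is `C¹` on the box with `∂ₓu = p` and solves the initial-boundary value problem there. -/
structure IsSolution (S : BoxSystem n k) (u p : ℝ → ℝ → Fin n → ℝ) : Prop where
  hasFDeriv : ∀ i, ∀ q ∈ box S.T, HasFDerivWithinAt (fun q : ℝ × ℝ => u q.1 q.2 i)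
    (grad (p q.1 q.2 i) (S.f q.1 q.2 (u q.1 q.2) i - S.lam i q.1 q.2 * p q.1 q.2 i)) (box S.T) q
  cont : ContinuousOn (fun q : ℝ × ℝ => p q.1 q.2) (box S.T)
  init : ∀ x ∈ Icc (0 : ℝ) 1, u x 0 = S.φ x
  bdry : ∀ i, ∀ t ∈ Icc (0 : ℝ) S.T, u (entry k i) t i = S.h t (outgoing k u t) i

lemma exists_solution (S : BoxSystem n k) (i₀ : Fin n) : ∃ u p, S.IsSolution u p := by
  obtain ⟨A, hA⟩ := exists_iteration S
  obtain ⟨U, hU⟩ := exists_limit_u hA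
  have cU : ContinuousOn (fun q : ℝ × ℝ => U q.1 q.2) (box S.T) :=
    hU.continuousOn ((eventually_ge_atTop 1).mono fun m hm => by
      obtain ⟨l, rfl⟩ := Nat.exists_eq_add_of_le' hm
      exact (hA l).adm.cont_u).frequently
  obtain ⟨P, hP⟩ := S.exists_limit_p i₀ hA hU cU
  have cP : ContinuousOn (fun q : ℝ × ℝ => P q.1 q.2) (box S.T) :=
    hP.continuousOn ((eventually_ge_atTop 1).mono fun m hm => by
      obtain ⟨l, rfl⟩ := Nat.exists_eq_add_of_le' hm
      exact (hA l).adm.cont_p).frequently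
  have hΛ := S.Λ_nonneg i₀
  have tf := tendstoUniformlyOn_comp (isCompact_box S.T)
    (g := fun (q : ℝ × ℝ) y => S.f q.1 q.2 y) S.f_cont hU cU
  have cf := continuousOn_comp_prodMk (g := fun (q : ℝ × ℝ) y => S.f q.1 q.2 y) S.f_cont cU
  have th := tendstoUniformlyOn_comp isCompact_Icc (g := S.h) S.h_cont
    (tendstoUniformlyOn_outgoing (S := S) hU) (continuousOn_outgoing (S := S) cU)
  have hU' : ∀ q ∈ box S.T, Tendsto (fun m => (A (m + 1)).u q.1 q.2) atTop (𝓝 (U q.1 q.2)) :=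
    fun q hq => (hU.tendsto_at hq).comp (tendsto_add_atTop_nat 1)
  refine ⟨U, P, fun i => ?_, cP, fun x hx => ?_, fun i t ht => ?_⟩
  · have hPi : TendstoUniformlyOn (fun m (q : ℝ × ℝ) => (A (m + 1)).p q.1 q.2 i)
        (fun q => P q.1 q.2 i) atTop (box S.T) := by
      rw [Metric.tendstoUniformlyOn_iff] at hP ⊢
      intro ε hε
      filter_upwards [(tendsto_add_atTop_nat 1).eventually (hP ε hε)] with m hm q hq
      exact (dist_le_pi_dist _ _ i).trans_lt (hm q hq)
    refine hasFDerivWithinAt_limit S.T_pos (u := fun m x t => (A (m + 1)).u x t i)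
      (p := fun m x t => (A (m + 1)).p x t i) (r := fun m x t => (A (m + 1)).r x t i)
      (U := fun x t => U x t i) (P := fun x t => P x t i)
      (R := fun x t => S.f x t (U x t) i - S.lam i x t * P x t i)
      (fun m => (hA m).adm.hasFDeriv i) (fun q hq => (tendsto_pi_nhds.1 (hU' q hq)) i) hPi ?_
      (continuousOn_pi.1 cU i) (continuousOn_pi.1 cP i)
      ((continuousOn_pi.1 cf i).sub ((S.lam_c1 i).cont.mul (continuousOn_pi.1 cP i)))
    rw [Metric.tendstoUniformlyOn_iff] at tf hPi ⊢
    intro ε hε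
    have hδ : 0 < ε / (2 + S.Λ) := by positivity
    filter_upwards [tf _ hδ, hPi _ hδ] with m h1 h2 q hq
    have h3 := (dist_le_pi_dist _ _ i).trans_lt (h1 q hq)
    have h4 := h2 q hq
    have h5 := S.abs_lam_le i hq
    rw [Real.dist_eq] at h3 h4 ⊢
    rw [(hA m).r_eq i q.1 hq.1 q.2 hq.2]
    have hsplit : ∀ a b l x y : ℝ, a - l * x - (b - l * y) = (a - b) - l * (x - y) := by
      intros; ring
    rw [hsplit]
    refine (abs_sub _ _).trans_lt ?_
    rw [abs_mul]
    have h6 := mul_le_mul h5 h4.le (abs_nonneg _) hΛ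
    have h7 : (2 + S.Λ) * (ε / (2 + S.Λ)) = ε := by field_simp
    linarith
  · refine tendsto_nhds_unique (hU' (x, 0) ⟨hx, S.zero_mem_time⟩) ?_
    refine tendsto_const_nhds.congr fun m => ((hA m).adm.init x hx).symm
  · refine tendsto_nhds_unique (tendsto_pi_nhds.1 (hU' (entry k i, t) ⟨entry_mem k i, ht⟩) i) ?_
    exact (tendsto_pi_nhds.1 (th.tendsto_at ht) i).congr fun m => ((hA m).bdry i t ht).symm

lemma IsSolution.contDiffOn {S : BoxSystem n k} {u p : ℝ → ℝ → Fin n → ℝ}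
    (h : S.IsSolution u p) : ContDiffOn ℝ 1 (fun q : ℝ × ℝ => u q.1 q.2) (box S.T) := by
  have cu : ContinuousOn (fun q : ℝ × ℝ => u q.1 q.2) (box S.T) :=
    continuousOn_pi.2 fun i q hq => (h.hasFDeriv i q hq).continuousWithinAt
  have cf := continuousOn_comp_prodMk (g := fun (q : ℝ × ℝ) y => S.f q.1 q.2 y) S.f_cont cu
  exact contDiffOn_pi.2 fun i => contDiffOn_box S.T_pos (u := fun x t => u x t i)
    (p := fun x t => p x t i) (r := fun x t => S.f x t (u x t) i - S.lam i x t * p x t i)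
    (h.hasFDeriv i) (continuousOn_pi.1 h.cont i)
    ((continuousOn_pi.1 cf i).sub ((S.lam_c1 i).cont.mul (continuousOn_pi.1 h.cont i)))

end BoxSystem

/-! ### Passage to the half-strip -/

/-- The chain rule for `x ↦ g(x, v(x))` when only the derivative in the second variable is known to
depend continuously on both. -/
lemma hasDerivWithinAt_comp_of_partials {E F : Type*} [NormedAddCommGroup E] [NormedSpace ℝ E]
    [NormedAddCommGroup F] [NormedSpace ℝ F] {s : Set ℝ} {x : ℝ} (hx : x ∈ s) {g : ℝ → E → F}
    {gu : ℝ → E → E →L[ℝ] F} {gx : F} {v : ℝ → E} {v' : E}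
    (hgu : ∀ x' ∈ s, ∀ y, HasFDerivAt (g x') (gu x' y) y)
    (cgu : ContinuousOn (fun q : ℝ × E => gu q.1 q.2) (s ×ˢ univ))
    (hgx : HasDerivWithinAt (fun x' => g x' (v x)) gx s x) (hv : HasDerivWithinAt v v' s x) :
    HasDerivWithinAt (fun x' => g x' (v x')) (gx + gu x (v x) v') s x := by
  have hmem : ∀ᶠ x' in 𝓝[s] x, x' ∈ s := eventually_mem_nhdsWithin
  have h1 : (fun x' => g x' (v x') - g x' (v x) - gu x (v x) (v x' - v x)) =o[𝓝[s] x]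
      fun x' => v x' - v x := by
    rw [Asymptotics.isLittleO_iff]
    intro ε hε
    have h0 := (cgu (x, v x) ⟨hx, trivial⟩).tendsto
    rw [nhdsWithin_prod_eq, nhdsWithin_univ] at h0
    have h0' := Filter.Eventually.segment_of_prod_nhds (r := fun x' y => dist (gu x' y) (gu x (v x)) < ε)
      tendsto_const_nhds hv.continuousWithinAt (Metric.tendsto_nhds.1 h0 ε hε)
    filter_upwards [hmem, h0'] with x' hx' hseg
    refine (convex_segment (v x) (v x')).norm_image_sub_le_of_norm_hasFDerivWithin_le'
      (fun y _ => (hgu x' hx' y).hasFDerivWithinAt) (fun y hy => ?_) (left_mem_segment ..)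
      (right_mem_segment ..)
    rw [← dist_eq_norm]
    exact (hseg y hy).le
  have h2 := h1.trans_isBigO hv.differentiableWithinAt.isBigO_sub
  rw [hasDerivWithinAt_iff_isLittleO] at hgx hv ⊢
  have h3 := ((gu x (v x)).isBigO_comp (fun x' => v x' - v x - (x' - x) • v') (𝓝[s] x)).trans_isLittleO hv
  refine ((h2.add h3).add hgx).congr_left fun x' => ?_
  simp only [map_sub, map_smul, smul_add]
  abel

lemma exists_pos_lower_upper {T : ℝ} {n : ℕ} [Nonempty (Fin n)] {g : Fin n → ℝ × ℝ → ℝ}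
    (hT : 0 ≤ T) (hg : ∀ i, ContinuousOn (g i) (box T)) (hpos : ∀ i, ∀ q ∈ box T, 0 < g i q) :
    ∃ c > 0, ∃ Λ, ∀ i, ∀ q ∈ box T, c ≤ g i q ∧ g i q ≤ Λ := by
  have hne : (box T).Nonempty := ⟨(0, 0), ⟨le_rfl, zero_le_one⟩, ⟨le_rfl, hT⟩⟩
  choose m hm hmin using fun i => (isCompact_box T).exists_isMinOn hne (hg i)
  choose M hM hmax using fun i => (isCompact_box T).exists_isMaxOn hne (hg i)
  obtain ⟨i, hi⟩ := Finite.exists_min fun i => g i (m i)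
  obtain ⟨j, hj⟩ := Finite.exists_max fun i => g i (M i)
  exact ⟨g i (m i), hpos i _ (hm i), g j (M j), fun i' q hq =>
    ⟨(hi i').trans (hmin i' hq), le_trans (hmax i' hq) (hj i')⟩⟩

lemma IsC1InX.isC1X {g : ℝ → ℝ → ℝ} (hg : IsC1InX g) (T : ℝ) :
    IsC1X T g fun x t => derivWithin (fun x => g x t) (Icc 0 1) x where
  cont := hg.1.mono (box_subset_closedStrip T)
  cont_deriv := hg.2.2.mono (box_subset_closedStrip T)
  hasDerivWithinAt x hx t ht := (hg.2.1 t ht.1 x hx).hasDerivWithinAt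

lemma norm_sub_le_of_fderiv_bound {E F : Type*} [NormedAddCommGroup E] [NormedSpace ℝ E]
    [NormedAddCommGroup F] [NormedSpace ℝ F] {g : E → F} {C : ℝ} (hg : Differentiable ℝ g)
    (hC : ∀ y, ‖fderiv ℝ g y‖ ≤ C) (y y' : E) : ‖g y - g y'‖ ≤ C * ‖y - y'‖ :=
  convex_univ.norm_image_sub_le_of_norm_fderiv_le (fun x _ => hg x) (fun x _ => hC x) trivial
    trivial

/-- The hypotheses on the half-strip provide the quantitative ones on every box. -/
lemma exists_boxSystem {n k : ℕ} [Nonempty (Fin n)]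
    {lam : Fin n → ℝ → ℝ → ℝ} {f : ℝ → ℝ → (Fin n → ℝ) → Fin n → ℝ}
    {φ : ℝ → Fin n → ℝ} {h : ℝ → (Fin n → ℝ) → Fin n → ℝ}
    (hlam : ∀ i, IsC1InX (lam i))
    (hneg : ∀ i : Fin n, (i : ℕ) < k → ∀ p ∈ closedStrip, lam i p.1 p.2 < 0)
    (hpos : ∀ i : Fin n, k ≤ (i : ℕ) → ∀ p ∈ closedStrip, 0 < lam i p.1 p.2)
    (hf : IsC1InXU f) (hφ : ContDiffOn ℝ 1 φ (Icc 0 1))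
    (hh : ContDiffOn ℝ 1 (fun q : ℝ × (Fin n → ℝ) => h q.1 q.2) (Ici 0 ×ˢ univ))
    (hfbdd : ∀ K : Set (ℝ × ℝ), IsCompact K → K ⊆ closedStrip →
      ∃ C : ℝ, ∀ p ∈ K, ∀ y : Fin n → ℝ, ‖fderiv ℝ (fun z => f p.1 p.2 z) y‖ ≤ C)
    (hhbdd : ∀ K : Set ℝ, IsCompact K → K ⊆ Ici 0 →
      ∃ C : ℝ, ∀ t ∈ K, ∀ z : Fin n → ℝ, ‖fderiv ℝ (fun w => h t w) z‖ ≤ C)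
    (hcompat0 : Compat0 k φ h) (hcompat1 : Compat1 k lam f φ h) {T : ℝ} (hT : 0 < T) :
    ∃ S : BoxSystem n k, S.T = T ∧ S.lam = lam ∧ S.f = f ∧ S.φ = φ ∧ S.h = h := by
  have hbs := box_subset_closedStrip T
  have hts : Icc (0 : ℝ) T ⊆ Ici 0 := Icc_subset_Ici_self
  obtain ⟨c, hc, Λ, hcΛ⟩ := exists_pos_lower_upper
    (g := fun (i : Fin n) q => (1 - 2 * entry k i) * lam i q.1 q.2) hT.le
    (fun i => continuousOn_const.mul ((hlam i).1.mono hbs)) (fun i q hq => by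
      unfold entry
      split_ifs with hi
      · linarith [hneg i hi q (hbs hq)]
      · linarith [hpos i (not_lt.1 hi) q (hbs hq)])
  choose a ha using fun i => (isCompact_box T).exists_bound_of_continuousOn ((hlam i).2.2.mono hbs)
  obtain ⟨j, hj⟩ := Finite.exists_max a
  obtain ⟨Cf, hCf⟩ := hfbdd _ (isCompact_box T) hbs
  obtain ⟨H, hH⟩ := hhbdd _ isCompact_Icc hts
  have hscalar : ∀ i, HasBackChars T (lam i) (entry k i) ∧ TransportSolvable T (lam i)
      (fun x t => derivWithin (fun x => lam i x t) (Icc 0 1) x) (entry k i) := by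
    intro i
    unfold entry
    split_ifs with hi
    · exact transport_left hT.le ((hlam i).isC1X T) fun q hq => hneg i hi q (hbs hq)
    · exact transport_right hT.le ((hlam i).isC1X T) fun q hq => hpos i (not_lt.1 hi) q (hbs hq)
  have hbu : box T ×ˢ (univ : Set (Fin n → ℝ)) ⊆ closedStrip ×ˢ univ := prod_mono_left hbs
  have hIu : Icc (0 : ℝ) T ×ˢ (univ : Set (Fin n → ℝ)) ⊆ Ici 0 ×ˢ univ := prod_mono_left hts
  set D : ℝ × (Fin n → ℝ) → ℝ × (Fin n → ℝ) →L[ℝ] Fin n → ℝ :=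
    fderivWithin ℝ (fun q : ℝ × (Fin n → ℝ) => h q.1 q.2) (Ici 0 ×ˢ univ) with hD
  have hDd : ∀ t ∈ Ici (0 : ℝ), ∀ z, HasFDerivWithinAt (fun q : ℝ × (Fin n → ℝ) => h q.1 q.2)
      (D (t, z)) (Ici 0 ×ˢ univ) (t, z) := fun t ht z =>
    (hh.differentiableOn one_ne_zero (t, z) ⟨ht, trivial⟩).hasFDerivWithinAt
  have hDc : ContinuousOn D (Ici 0 ×ˢ univ) :=
    hh.continuousOn_fderivWithin ((uniqueDiffOn_Ici 0).prod uniqueDiffOn_univ) le_rfl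
  have hDt : ∀ t ∈ Ici (0 : ℝ), ∀ z, HasDerivWithinAt (fun t => h t z) (D (t, z) (1, 0))
      (Ici 0) t := fun t ht z =>
    (hDd t ht z).comp_hasDerivWithinAt (f := fun t : ℝ => (t, z)) t
      ((hasDerivWithinAt_id t _).prodMk (hasDerivWithinAt_const t _ z)) fun y hy => ⟨hy, trivial⟩
  have hDz : ∀ t ∈ Ici (0 : ℝ), ∀ z, HasFDerivAt (h t)
      ((D (t, z)).comp (ContinuousLinearMap.inr ℝ ℝ (Fin n → ℝ))) z := fun t ht z => by
    rw [← hasFDerivWithinAt_univ]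
    exact (hDd t ht z).comp (f := fun z : Fin n → ℝ => (t, z)) z
      (hasFDerivAt_prodMk_right t z).hasFDerivWithinAt fun y _ => ⟨ht, trivial⟩
  have hφd : ∀ x ∈ Icc (0 : ℝ) 1, HasDerivWithinAt φ (derivWithin φ (Icc 0 1) x) (Icc 0 1) x :=
    fun x hx => (hφ.differentiableOn one_ne_zero x hx).hasDerivWithinAt
  have h00 : (0 : ℝ) ∈ Ici (0 : ℝ) := mem_Ici.2 le_rfl
  refine ⟨{
    T := T, lam := lam, f := f, h := h, φ := φ, c := c, Λ := Λ, a := max (a j) 0, Cf := max Cf 0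
    H := max H 0
    lamx := fun i x t => derivWithin (fun x => lam i x t) (Icc 0 1) x
    fx := fun x t y => derivWithin (fun x => f x t y) (Icc 0 1) x
    fu := fun x t y => fderiv ℝ (fun y => f x t y) y
    ht := fun t z => D (t, z) (1, 0)
    hv := fun t z => (D (t, z)).comp (ContinuousLinearMap.inr ℝ ℝ (Fin n → ℝ))
    φ' := derivWithin φ (Icc 0 1)
    d := initialTimeDeriv lam f φ
    T_pos := hT
    c_pos := hc
    a_nonneg := le_max_right _ _
    Cf_nonneg := le_max_right _ _
    H_nonneg := le_max_right _ _
    lam_c1 := fun i => (hlam i).isC1X T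
    le_lam := fun i q hq => (hcΛ i q hq).1
    lam_le := fun i q hq => (hcΛ i q hq).2
    lamx_le := fun i q hq => ((ha i q hq).trans (hj i)).trans (le_max_left _ _)
    chars := fun i => (hscalar i).1
    solvable := fun i => (hscalar i).2
    f_cont := hf.1.mono hbu
    fx_cont := hf.2.2.2.1.mono hbu
    fu_cont := hf.2.2.2.2.mono hbu
    f_chain := fun v v' x hx t ht hv => hasDerivWithinAt_comp_of_partials hx
      (g := fun x y => f x t y) (gu := fun x y => fderiv ℝ (fun y => f x t y) y)
      (fun x' hx' y => (hf.2.2.1 x' hx' t ht.1 y).hasFDerivAt)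
      (hf.2.2.2.2.comp (f := fun q : ℝ × (Fin n → ℝ) => ((q.1, t), q.2)) (by fun_prop)
        fun q hq => ⟨⟨hq.1, ht.1⟩, trivial⟩)
      (hf.2.1 t ht.1 (v x) x hx).hasDerivWithinAt hv
    fu_le := fun q hq y => (hCf q hq y).trans (le_max_left _ _)
    f_lip := fun q hq => norm_sub_le_of_fderiv_bound (hf.2.2.1 q.1 hq.1 q.2 hq.2.1)
      fun y => (hCf q hq y).trans (le_max_left _ _)
    h_cont := hh.continuousOn.mono hIu
    ht_cont := (hDc.mono hIu).clm_apply continuousOn_const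
    hv_cont := (hDc.mono hIu).clm_comp continuousOn_const
    h_chain := fun v v' t ht hv => ?_
    hv_le := fun t ht z => ?_
    h_lip := fun t ht => norm_sub_le_of_fderiv_bound
      (fun z => (hDz t ht.1 z).differentiableAt) fun z => (hH t ht z).trans (le_max_left _ _)
    hasDeriv_φ := hφd
    cont_φ' := hφ.continuousOn_derivWithin (uniqueDiffOn_Icc zero_lt_one) le_rfl
    d_eq := fun x hx i => ?_
    compat0 := fun i => ?_
    compat1 := fun i => ?_ }, rfl, rfl, rfl, rfl, rfl⟩
  · have h1 := ((hDd t ht.1 (v t)).mono (prod_mono_left hts)).comp_hasDerivWithinAt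
      (f := fun t : ℝ => (t, v t)) t ((hasDerivWithinAt_id t (Icc 0 T)).prodMk hv)
      fun y hy => ⟨hy, trivial⟩
    refine h1.congr_deriv ?_
    rw [ContinuousLinearMap.comp_apply, ← map_add]
    simp
  · rw [← (hDz t ht.1 z).fderiv]
    exact (hH t ht z).trans (le_max_left _ _)
  · have := (hasDerivWithinAt_pi.1 (hφd x hx) i).derivWithin (uniqueDiffOn_Icc zero_lt_one x hx)
    rw [initialTimeDeriv, this]
  · unfold entry
    split_ifs with hi
    · exact (hcompat0 i).2 hi
    · exact (hcompat0 i).1 (not_lt.1 hi)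
  · have e1 := (hasDerivWithinAt_pi.1 (hDt 0 h00 (v0 k φ)) i).derivWithin (uniqueDiffOn_Ici 0 0 h00)
    have e2 := (hasFDerivAt_pi'.1 (hDz 0 h00 (v0 k φ)) i).fderiv
    have e3 := hcompat1 i
    rw [e1, e2] at e3
    unfold entry
    split_ifs with hi
    · exact e3.2 hi
    · exact e3.1 (not_lt.1 hi)

namespace BoxSystem

variable {n k : ℕ}

lemma IsSolution.isImage {S : BoxSystem n k} {u p : ℝ → ℝ → Fin n → ℝ}
    (h : S.IsSolution u p) : S.IsImage u u where
  cont i q hq := (h.hasFDeriv i q hq).continuousWithinAt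
  charDeriv i := by
    have h1 := hasCharDeriv_of_hasFDerivAt (T := S.T) (l := S.lam i) (u := fun x t => u x t i)
      (p := fun x t => p x t i) (r := fun x t => S.f x t (u x t) i - S.lam i x t * p x t i)
      fun x hx t ht =>
        (h.hasFDeriv i (x, t) ⟨Ioo_subset_Icc_self hx, Ioo_subset_Icc_self ht⟩).hasFDerivAt
          (prod_mem_nhds (Icc_mem_nhds hx.1 hx.2) (Icc_mem_nhds ht.1 ht.2))
    simpa only [sub_add_cancel] using h1
  init := h.init
  bdry := h.bdry

/-- Solutions on a box restrict to solutions on a lower box. -/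
lemma IsImage.restrict {S S' : BoxSystem n k} (hT : S.T ≤ S'.T) (hlam : S.lam = S'.lam)
    (hf : S.f = S'.f) (hφ : S.φ = S'.φ) (hh : S.h = S'.h) {u : ℝ → ℝ → Fin n → ℝ}
    (h : S'.IsImage u u) : S.IsImage u u where
  cont i := (h.cont i).mono (prod_mono_right (Icc_subset_Icc_right hT))
  charDeriv i := by
    rw [hlam, hf]
    exact fun γ a b ha hb => h.charDeriv i γ a b ha (hb.trans hT)
  init := hφ ▸ h.init
  bdry i t ht := hh ▸ h.bdry i t (Icc_subset_Icc_right hT ht)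

/-- A classical solution on the half-strip, which need not be differentiable on the boundary, is a
solution along characteristics on each box. -/
lemma isImage_of_isClassicalSolution (S : BoxSystem n k) {w : ℝ → ℝ → Fin n → ℝ}
    (hw : IsClassicalSolution k S.lam S.f S.φ S.h w) : S.IsImage w w where
  cont := continuousOn_pi.1 (hw.continuousOn.mono (box_subset_closedStrip S.T))
  charDeriv i := by
    have hd : ∀ x ∈ Ioo (0 : ℝ) 1, ∀ t ∈ Ioo (0 : ℝ) S.T,
        HasFDerivAt (fun q : ℝ × ℝ => w q.1 q.2 i)
          (grad (deriv (fun ξ => w ξ t i) x) (deriv (fun s => w x s i) t)) (x, t) := by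
      intro x hx t ht
      have h1 : DifferentiableAt ℝ (fun q : ℝ × ℝ => w q.1 q.2 i) (x, t) :=
        ((contDiffOn_pi.1 hw.contDiffOn i).differentiableOn one_ne_zero).differentiableAt
          ((isOpen_Ioo.prod isOpen_Ioi).mem_nhds ⟨hx, ht.1⟩)
      have h2 := h1.hasFDerivAt
      have h3 := (h2.comp_hasDerivAt (f := fun ξ : ℝ => (ξ, t)) x
        ((hasDerivAt_id x).prodMk (hasDerivAt_const x t))).deriv
      have h4 := (h2.comp_hasDerivAt (f := fun s : ℝ => (x, s)) t
        ((hasDerivAt_const t x).prodMk (hasDerivAt_id t))).deriv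
      refine h2.congr_fderiv ?_
      rw [grad_self (fderiv ℝ _ (x, t))]
      exact congr_arg₂ grad h3.symm h4.symm
    intro γ a b ha hb hγ s hs hγs
    refine (hasCharDeriv_of_hasFDerivAt (l := S.lam i) (u := fun x t => w x t i)
      (p := fun x t => deriv (fun ξ => w ξ t i) x) (r := fun x t => deriv (fun s => w x s i) t)
      hd γ a b ha hb hγ s hs hγs).congr_deriv ?_
    exact hw.system _ hγs s (ha.trans_lt hs.1) i
  init := by
    have h1 : EqOn (fun x => w x 0) S.φ (Ioo 0 1) := hw.initial
    refine h1.of_subset_closure (t := Icc 0 1) ?_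
      (fun x hx => (S.hasDeriv_φ x hx).continuousWithinAt) Ioo_subset_Icc_self
      (closure_Ioo zero_ne_one).ge
    exact hw.continuousOn.comp (f := fun x : ℝ => (x, (0 : ℝ))) (by fun_prop)
      fun x hx => ⟨hx, mem_Ici.2 le_rfl⟩
  bdry i := by
    have cw := hw.continuousOn.mono (box_subset_closedStrip S.T)
    have h1 : EqOn (fun t => w (entry k i) t i) (fun t => S.h t (outgoing k w t) i)
        (Ioo 0 S.T) := by
      intro t ht
      beta_reduce
      unfold entry
      split_ifs with hi
      · exact hw.boundary_right t ht.1 i hi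
      · exact hw.boundary_left t ht.1 i (not_lt.1 hi)
    refine h1.of_subset_closure (t := Icc 0 S.T) ?_ (continuousOn_pi.1 (continuousOn_comp_prodMk S.h_cont
      (continuousOn_outgoing (S := S) cw)) i) Ioo_subset_Icc_self (closure_Ioo S.T_pos.ne).ge
    exact (continuousOn_pi.1 cw i).comp (f := fun t : ℝ => (entry k i, t)) (by fun_prop)
      fun t ht => ⟨entry_mem k i, ht⟩

end BoxSystem

lemma box_mem_nhdsWithin {T : ℝ} {q : ℝ × ℝ} (hq : q.2 < T) : box T ∈ 𝓝[closedStrip] q := by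
  have h1 : {q : ℝ × ℝ | q.2 < T} ∈ 𝓝 q := (isOpen_lt continuous_snd continuous_const).mem_nhds hq
  filter_upwards [mem_nhdsWithin_of_mem_nhds h1, self_mem_nhdsWithin] with y hy hy'
  exact ⟨hy'.1, hy'.2, le_of_lt hy⟩

/-- A function that on each box `[0,1] × [0,N+1]` agrees with the solution there is a classical
solution, `C¹` up to the boundary. -/
lemma isClassicalSolution_of_boxes {n k : ℕ} {lam : Fin n → ℝ → ℝ → ℝ}
    {f : ℝ → ℝ → (Fin n → ℝ) → Fin n → ℝ} {φ : ℝ → Fin n → ℝ} {h : ℝ → (Fin n → ℝ) → Fin n → ℝ}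
    {S : ℕ → BoxSystem n k} (hST : ∀ N, (S N).T = N + 1) (hSlam : ∀ N, (S N).lam = lam)
    (hSf : ∀ N, (S N).f = f) (hSφ : ∀ N, (S N).φ = φ) (hSh : ∀ N, (S N).h = h)
    {U P : ℕ → ℝ → ℝ → Fin n → ℝ} (hU : ∀ N, (S N).IsSolution (U N) (P N))
    {u : ℝ → ℝ → Fin n → ℝ} (hu : ∀ N : ℕ, ∀ q ∈ box (N + 1), u q.1 q.2 = U N q.1 q.2) :
    IsClassicalSolution k lam f φ h u ∧
      ContDiffOn ℝ 1 (fun p : ℝ × ℝ => u p.1 p.2) closedStrip := by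
  have hlt : ∀ t : ℝ, t < (⌊t⌋₊ : ℝ) + 1 := Nat.lt_floor_add_one
  have hC : ContDiffOn ℝ 1 (fun p : ℝ × ℝ => u p.1 p.2) closedStrip := by
    intro q hq
    have hb : q ∈ box ((⌊q.2⌋₊ : ℝ) + 1) := ⟨hq.1, hq.2, (hlt q.2).le⟩
    have h1 := (hU ⌊q.2⌋₊).contDiffOn
    rw [hST] at h1
    exact ((h1.congr fun y hy => hu _ y hy) q hb).mono_of_mem_nhdsWithin
      (box_mem_nhdsWithin (hlt q.2))
  have hbdry : ∀ t ∈ Ioi (0 : ℝ), ∀ i : Fin n, u (entry k i) t i = h t (outgoing k u t) i := by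
    intro t ht i
    have hmem : t ∈ Icc (0 : ℝ) (⌊t⌋₊ + 1) := ⟨le_of_lt ht, (hlt t).le⟩
    have h1 := (hU ⌊t⌋₊).bdry i t (by rwa [hST])
    have h2 : outgoing k u t = outgoing k (U ⌊t⌋₊) t := by
      ext j
      rw [outgoing_apply, outgoing_apply]
      exact congr_fun (hu _ (_, t) ⟨one_sub_mem (entry_mem k j), hmem⟩) j
    rw [h2, ← hSh ⌊t⌋₊, ← h1]
    exact congr_fun (hu _ (_, t) ⟨entry_mem k i, hmem⟩) i
  refine ⟨⟨hC.continuousOn, hC.mono (prod_mono Ioo_subset_Icc_self Ioi_subset_Ici_self), ?_, ?_,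
    fun t ht i hi => ?_, fun t ht i hi => ?_⟩, hC⟩
  · intro x hx t ht i
    have hmem : (x, t) ∈ box ((⌊t⌋₊ : ℝ) + 1) :=
      ⟨Ioo_subset_Icc_self hx, le_of_lt ht, (hlt t).le⟩
    have hnhds : box ((⌊t⌋₊ : ℝ) + 1) ∈ 𝓝 (x, t) :=
      prod_mem_nhds (Icc_mem_nhds hx.1 hx.2) (Icc_mem_nhds ht (hlt t))
    have h1 := (hU ⌊t⌋₊).hasFDeriv i (x, t) (by rwa [hST])
    rw [hST] at h1
    have h2 := (h1.hasFDerivAt hnhds).congr_of_eventuallyEq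
      (f₁ := fun q : ℝ × ℝ => u q.1 q.2 i) (by
        filter_upwards [hnhds] with q hq using congr_fun (hu _ q hq) i)
    have h3 : HasDerivAt (fun ξ => u ξ t i) _ x :=
      h2.comp_hasDerivAt (f := fun ξ : ℝ => (ξ, t)) x
        ((hasDerivAt_id x).prodMk (hasDerivAt_const x t))
    have h4 : HasDerivAt (fun s => u x s i) _ t :=
      h2.comp_hasDerivAt (f := fun s : ℝ => (x, s)) t
        ((hasDerivAt_const t x).prodMk (hasDerivAt_id t))
    rw [h3.deriv, h4.deriv, hSf, hSlam, hu _ (x, t) hmem]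
    simp only [grad_apply]
    ring
  · intro x hx
    rw [hu 0 (x, 0) ⟨Ioo_subset_Icc_self hx, le_rfl, by positivity⟩, ← hSφ 0]
    exact (hU 0).init x (Ioo_subset_Icc_self hx)
  · simpa [entry, not_lt.2 hi] using hbdry t ht i
  · simpa [entry, hi] using hbdry t ht i

end HypIBVP

theorem theorem1 (n k : ℕ) (hk : 1 ≤ k) (hkn : k ≤ n)
    (lam : Fin n → ℝ → ℝ → ℝ) (f : ℝ → ℝ → (Fin n → ℝ) → Fin n → ℝ)
    (φ : ℝ → Fin n → ℝ) (h : ℝ → (Fin n → ℝ) → Fin n → ℝ)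
    (hlam : ∀ i, HypIBVP.IsC1InX (lam i))
    (hneg : ∀ i : Fin n, (i : ℕ) < k → ∀ p ∈ HypIBVP.closedStrip, lam i p.1 p.2 < 0)
    (hpos : ∀ i : Fin n, k ≤ (i : ℕ) → ∀ p ∈ HypIBVP.closedStrip, 0 < lam i p.1 p.2)
    (hf : HypIBVP.IsC1InXU f)
    (hφ : ContDiffOn ℝ 1 φ (Set.Icc 0 1))
    (hh : ContDiffOn ℝ 1 (fun q : ℝ × (Fin n → ℝ) => h q.1 q.2) (Set.Ici 0 ×ˢ Set.univ))
    (hfbdd : ∀ K : Set (ℝ × ℝ), IsCompact K → K ⊆ HypIBVP.closedStrip →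
      ∃ C : ℝ, ∀ p ∈ K, ∀ y : Fin n → ℝ, ‖fderiv ℝ (fun z => f p.1 p.2 z) y‖ ≤ C)
    (hhbdd : ∀ K : Set ℝ, IsCompact K → K ⊆ Set.Ici 0 →
      ∃ C : ℝ, ∀ t ∈ K, ∀ z : Fin n → ℝ, ‖fderiv ℝ (fun w => h t w) z‖ ≤ C)
    (hcompat0 : HypIBVP.Compat0 k φ h)
    (hcompat1 : HypIBVP.Compat1 k lam f φ h) :
    ∃ u : ℝ → ℝ → Fin n → ℝ,
      HypIBVP.IsClassicalSolution k lam f φ h u ∧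
      ContDiffOn ℝ 1 (fun p : ℝ × ℝ => u p.1 p.2) HypIBVP.closedStrip ∧
      ∀ w : ℝ → ℝ → Fin n → ℝ, HypIBVP.IsClassicalSolution k lam f φ h w →
        ∀ p ∈ HypIBVP.closedStrip, w p.1 p.2 = u p.1 p.2 := by
  have i₀ : Fin n := ⟨0, hk.trans hkn⟩
  have : Nonempty (Fin n) := ⟨i₀⟩
  choose S hST hSlam hSf hSφ hSh using fun N : ℕ =>
    HypIBVP.exists_boxSystem hlam hneg hpos hf hφ hh hfbdd hhbdd hcompat0 hcompat1
      (T := (N : ℝ) + 1) (by positivity)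
  choose U P hU using fun N => (S N).exists_solution i₀
  have hle : ∀ N M : ℕ, N ≤ M → ∀ q ∈ HypIBVP.box ((N : ℝ) + 1), U N q.1 q.2 = U M q.1 q.2 := by
    intro N M hNM
    have hT : (S N).T ≤ (S M).T := by
      rw [hST, hST]
      gcongr
    have h1 := (hU N).isImage.eq ((hU M).isImage.restrict hT ((hSlam N).trans (hSlam M).symm)
      ((hSf N).trans (hSf M).symm) ((hSφ N).trans (hSφ M).symm) ((hSh N).trans (hSh M).symm))
    rwa [hST] at h1
  have hfloor : ∀ N : ℕ, ∀ q ∈ HypIBVP.box ((N : ℝ) + 1),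
      U ⌊q.2⌋₊ q.1 q.2 = U N q.1 q.2 := by
    intro N q hq
    rcases le_total ⌊q.2⌋₊ N with h1 | h1
    · exact hle _ _ h1 q ⟨hq.1, hq.2.1, (Nat.lt_floor_add_one q.2).le⟩
    · exact (hle _ _ h1 q hq).symm
  obtain ⟨h1, h2⟩ := HypIBVP.isClassicalSolution_of_boxes hST hSlam hSf hSφ hSh hU
    (u := fun x t => U ⌊t⌋₊ x t) hfloor
  refine ⟨_, h1, h2, fun w hw q hq => ?_⟩
  have hw' : HypIBVP.IsClassicalSolution k (S ⌊q.2⌋₊).lam (S ⌊q.2⌋₊).f (S ⌊q.2⌋₊).φ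
      (S ⌊q.2⌋₊).h w := by
    rwa [hSlam, hSf, hSφ, hSh]
  refine ((S ⌊q.2⌋₊).isImage_of_isClassicalSolution hw').eq (hU ⌊q.2⌋₊).isImage q ?_
  rw [hST]
  exact ⟨hq.1, hq.2, (Nat.lt_floor_add_one q.2).le⟩
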